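/- Let $C$ be a rational angle over $\mathbb{C}$, that is, a (complete, reduced) nodal curve $C = C_1\cup_p C_2$ that is the union of two closed subcurves $C_1, C_2$, each a nonsingular rational curve (isomorphic to $\mathbb{P}^1_{\mathbb{C}}$), which meet only at one point $p$. Here nodal means that every closed point of $C$ is either nonsingular or a node, i.e. a point whose completed local ring is isomorphic to $\mathbb{C}[[x,y]]/(xy)$. Then every locally free coherent sheaf $E$ on $C$ is a direct sum of line bundles: there are $n\ge 0$ and line bundles $L_1,\dots,L_n$ on $C$ with $E\cong L_1\oplus\cdots\oplus L_n$. -/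

import Mathlib

open CategoryTheory CategoryTheory.Limits AlgebraicGeometry

attribute [local instance] MvPolynomial.gradedAlgebra
attribute [local instance] CategoryTheory.Abelian.hasFiniteBiproducts

noncomputable section

namespace RationalAngle

/-- The projective line `ℙ¹` over `ℂ`, as `Proj ℂ[X₀, X₁]`. -/
def P1 : Scheme.{0} := Proj (MvPolynomial.homogeneousSubmodule (Fin 2) ℂ)

/-- The structure morphism `ℙ¹ ⟶ Spec ℂ`. -/
def P1.toSpec : P1 ⟶ Spec (.of ℂ) :=
  Proj.toSpecZero (MvPolynomial.homogeneousSubmodule (Fin 2) ℂ) ≫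
    Spec.map (CommRingCat.ofHom
      (algebraMap ℂ (MvPolynomial.homogeneousSubmodule (Fin 2) ℂ 0)))

/-- A (complete) nonsingular rational curve over `ℂ`: a `ℂ`-scheme isomorphic to `ℙ¹`. -/
def IsNonsingularRationalCurve {D : Scheme.{0}} (t : D ⟶ Spec (.of ℂ)) : Prop :=
  ∃ e : D ≅ P1, e.hom ≫ P1.toSpec = t

/-- The point `x` is nonsingular of codimension one: its local ring is a discrete valuation
ring. -/
def IsNonsingularCurvePoint (C : Scheme.{0}) (x : C) : Prop :=
  ∃ _ : IsDomain (C.presheaf.stalk x), IsDiscreteValuationRing (C.presheaf.stalk x)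

/-- The point `x` is a node: the completed local ring at `x` is isomorphic to
`ℂ⟦X, Y⟧ / (X Y)`. A ring isomorphism is enough: for a closed point of a `ℂ`-scheme of finite type
the existence of a ring isomorphism and of an isomorphism of `ℂ`-algebras are equivalent, since
`ℂ⟦X, Y⟧ / (X Y)` looks the same over any of its coefficient fields. -/
def IsNode (C : Scheme.{0}) (x : C) : Prop :=
  Nonempty
    (AdicCompletion (IsLocalRing.maximalIdeal (C.presheaf.stalk x)) (C.presheaf.stalk x) ≃+*
      (MvPowerSeries (Fin 2) ℂ ⧸
        Ideal.span {(MvPowerSeries.X 0 * MvPowerSeries.X 1 : MvPowerSeries (Fin 2) ℂ)}))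

/-- A (complete) nodal curve over `ℂ`: a proper reduced `ℂ`-scheme each closed point of which is
either a nonsingular point of a curve or a node. -/
structure IsNodalCurve {C : Scheme.{0}} (s : C ⟶ Spec (.of ℂ)) : Prop where
  isProper : IsProper s
  isReduced : IsReduced C
  nonsingular_or_node : ∀ x : C, IsClosed {x} → IsNonsingularCurvePoint C x ∨ IsNode C x

/-- A rational angle `C = C₁ ∪_p C₂`: a nodal curve over `ℂ` which is the union of two closed
subschemes `C₁`, `C₂` that are nonsingular rational curves and meet only at a point `p`. -/
structure IsRationalAngle {C : Scheme.{0}} (s : C ⟶ Spec (.of ℂ)) : Prop where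
  isNodalCurve : IsNodalCurve s
  exists_components : ∃ (C₁ C₂ : Scheme.{0}) (i₁ : C₁ ⟶ C) (i₂ : C₂ ⟶ C) (p : C),
    IsClosedImmersion i₁ ∧ IsClosedImmersion i₂ ∧
    IsNonsingularRationalCurve (i₁ ≫ s) ∧ IsNonsingularRationalCurve (i₂ ≫ s) ∧
    Set.range i₁ ∪ Set.range i₂ = Set.univ ∧ Set.range i₁ ∩ Set.range i₂ = {p}

/-- A coherent sheaf on a (locally) Noetherian scheme: a quasi-coherent sheaf of modules of
finite type. -/
def IsCoherent {X : Scheme.{0}} (E : X.Modules) : Prop :=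
  SheafOfModules.IsQuasicoherent E ∧ SheafOfModules.IsFiniteType E

/-- A line bundle: a sheaf of modules which is locally isomorphic to the structure sheaf. -/
def IsLineBundle {X : Scheme.{0}} (L : X.Modules) : Prop :=
  ∀ x : X, ∃ U : X.Opens, x ∈ U ∧
    Nonempty (L.restrict U.ι ≅ (SheafOfModules.unit (U : Scheme.{0}).ringCatSheaf :
      (U : Scheme.{0}).Modules))

end RationalAngle

end

set_option linter.unusedSectionVars false

noncomputable section

namespace RationalAngle

/-! ### Bruhat elimination for weighted triangular matrices. -/

section Factorization

open Matrix

/-! Each component minus the node is an affine line, whose coordinate ring is a principal ideal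
domain, so `E` is free there; it is also free near the node `p`. Hence `E` is encoded by two
transition matrices `G₁`, `G₂` over the function fields of the two components. Sections may be
changed by `GL(A₁)` and `GL(A₂)` on the affine lines, and by one common matrix over the local ring
of `C` at `p`. If both transition matrices can be made diagonal at once, then `E` splits
(`exists_iso_biproduct_of_diagonal`).

On one component this is Grothendieck's theorem in Birkhoff's form: `G = a * diag (x ^ d) * b⁻¹`
with `a` invertible at `p` and `b` invertible on the affine line (`exists_birkhoff`). The difficulty
is that `a₁` and `a₂` must come from the same matrix over the local ring of `C`, that is, their
values `c₁`, `c₂` at `p` must agree. There is room for this. A constant matrix `v`, triangular for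
the weights `d`, can be moved through `diag (x ^ d)` and becomes a matrix regular on the affine line
(`twist`), and a monomial matrix only permutes the exponents. The Bruhat decomposition of `c₁⁻¹ *
c₂` relative to the two systems of degrees (`exists_monomial`) gives `c₁ * v * M = c₂ * w` with `v`,
`w` triangular and `M` monomial, which is exactly the required agreement
(`exists_simultaneous_factorization`).

Agreement at `p` suffices for gluing because the local ring at a node is the fibre product of the
two branches over `ℂ`, that is, the ideals `I₁`, `I₂` of the branches satisfy `I₁ + I₂ = 𝔪`
(`sup_ker_eq_maximalIdeal`). This is where nodality enters: it would fail for two tangent branches.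
It is derived from the completed local ring through its tangent cone, which is a pair of distinct
lines. -/

/-- Matrices `u` over `k` with `u i j ≠ 0` only if `d j ≤ d i`. -/
def IsTriangular {k n : Type*} [Zero k] (d : n → ℤ) (u : Matrix n n k) : Prop :=
  ∀ i j, u i j ≠ 0 → d j ≤ d i

variable {n : Type*} [Fintype n] [DecidableEq n]

lemma IsTriangular.mul {k : Type*} [Semiring k] {d : n → ℤ} {u v : Matrix n n k}
    (hu : IsTriangular d u) (hv : IsTriangular d v) : IsTriangular d (u * v) := by
  intro i j h
  obtain ⟨l, -, hl⟩ := Finset.exists_ne_zero_of_sum_ne_zero (Matrix.mul_apply (M := u) ▸ h)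
  exact (hv l j (right_ne_zero_of_mul hl)).trans (hu i l (left_ne_zero_of_mul hl))

lemma IsTriangular.one {k : Type*} [Semiring k] {d : n → ℤ} :
    IsTriangular d (1 : Matrix n n k) := by
  intro i j h
  by_cases hij : i = j
  · rw [hij]
  · exact absurd (Matrix.one_apply_ne hij) h

/-- The columns in `S` are finished: the entry `(σ j, j)` is the only nonzero one in its row and
in its column. -/
def IsMonomialOn {k n : Type*} [Zero k] (S : Finset n) (σ : n → n) (M : Matrix n n k) : Prop :=
  ∀ j ∈ S, (∀ i, M i j ≠ 0 → i = σ j) ∧ ∀ l, M (σ j) l ≠ 0 → l = j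

variable {k : Type*} [Field k]

/-- Elimination with pivot `(i, j)`: the row operations. -/
lemma exists_clear_column (M : Matrix n n k) {i j : n} (hM : M i j ≠ 0) (d : n → ℤ)
    (hi : ∀ l, M l j ≠ 0 → d i ≤ d l) :
    ∃ E E' : Matrix n n k, E' * E = 1 ∧ IsTriangular d E' ∧
      (∀ l, (E * M) i l = M i l) ∧
      ∀ m l, m ≠ i → (E * M) m l = M m l - M m j / M i j * M i l := by
  let c : n → k := fun m ↦ if m = i then 0 else M m j / M i j
  let N : Matrix n n k := Matrix.of fun m l ↦ if l = i then c m else 0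
  have hN : N * N = 0 := by
    ext a b
    rw [Matrix.mul_apply]
    refine Finset.sum_eq_zero fun l _ ↦ ?_
    by_cases hl : l = i
    · simp [N, hl, c]
    · simp [N, hl]
  have hNM : ∀ m l, (N * M) m l = c m * M i l := by
    intro m l
    rw [Matrix.mul_apply, Finset.sum_eq_single i] <;> simp +contextual [N]
  refine ⟨1 - N, 1 + N, ?_, ?_, ?_, ?_⟩
  · rw [mul_sub, add_mul, add_mul, hN]; simp
  · intro a b hab
    by_cases h : a = b
    · rw [h]
    · rw [Matrix.add_apply, Matrix.one_apply_ne h, zero_add] at hab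
      by_cases hb : b = i
      · subst hb
        have hab' : c a ≠ 0 := by simpa [N] using hab
        refine hi a fun h0 ↦ hab' ?_
        simp [c, h0]
      · simp [N, hb] at hab
  · intro l
    rw [sub_mul, one_mul, Matrix.sub_apply, hNM]; simp [c]
  · intro m l hm
    rw [sub_mul, one_mul, Matrix.sub_apply, hNM]; simp [c, hm]

/-- Elimination with pivot `(i, j)`: the column operations. -/
lemma exists_clear_row (M : Matrix n n k) {i j : n} (hM : M i j ≠ 0) (d : n → ℤ)
    (hj : ∀ l, M i l ≠ 0 → d l ≤ d j) :
    ∃ F : Matrix n n k, F.det ≠ 0 ∧ IsTriangular d F ∧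
      (∀ m, (M * F) m j = M m j) ∧
      ∀ m l, l ≠ j → (M * F) m l = M m l - M i l / M i j * M m j := by
  let c : n → k := fun m ↦ if m = j then 0 else M i m / M i j
  let N : Matrix n n k := Matrix.of fun m l ↦ if m = j then c l else 0
  have hN : N * N = 0 := by
    ext a b
    rw [Matrix.mul_apply]
    refine Finset.sum_eq_zero fun l _ ↦ ?_
    by_cases hl : l = j
    · simp [N, hl, c]
    · simp [N, hl]
  have hNM : ∀ m l, (M * N) m l = M m j * c l := by
    intro m l
    rw [Matrix.mul_apply, Finset.sum_eq_single j] <;> simp +contextual [N]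
  refine ⟨1 - N, ?_, ?_, ?_, ?_⟩
  · have : (1 + N) * (1 - N) = 1 := by rw [mul_sub, add_mul, add_mul, hN]; simp
    have := congrArg det this
    rw [det_mul, det_one] at this
    exact right_ne_zero_of_mul (this ▸ one_ne_zero)
  · intro a b hab
    by_cases h : a = b
    · rw [h]
    · rw [Matrix.sub_apply, Matrix.one_apply_ne h, zero_sub, neg_ne_zero] at hab
      by_cases hb : a = j
      · subst hb
        have hab' : c b ≠ 0 := by simpa [N] using hab
        refine hj b fun h0 ↦ hab' ?_
        simp [c, h0]
      · simp [N, hb] at hab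
  · intro m
    rw [mul_sub, mul_one, Matrix.sub_apply, hNM]; simp [c]
  · intro m l hl
    rw [mul_sub, mul_one, Matrix.sub_apply, hNM]; simp [c, hl]; ring

/-- Gaussian elimination, one finished column at a time. The pivot column has the largest `d₂` among
the unfinished ones and the pivot row the smallest `d₁` among the nonzero entries of that column;
with these choices every operation needed is triangular for the weights. The pivot row vanishes in
the finished columns, and the pivot column in the finished rows, so earlier work is not disturbed.
-/
lemma exists_isMonomialOn (c : Matrix n n k) (hc : c.det ≠ 0) (d₁ d₂ : n → ℤ) (m : ℕ)
    (hm : m ≤ Fintype.card n) :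
    ∃ (v w M : Matrix n n k) (S : Finset n) (σ : n → n), c * w = v * M ∧ v.det ≠ 0 ∧ w.det ≠ 0 ∧
      IsTriangular d₁ v ∧ IsTriangular d₂ w ∧ S.card = m ∧ IsMonomialOn S σ M := by
  induction m with
  | zero =>
    exact ⟨1, 1, c, ∅, id, by simp, by simp, by simp, .one, .one, by simp, by simp [IsMonomialOn]⟩
  | succ m ih =>
    obtain ⟨v, w, M, S, σ, h, hv, hw, hv', hw', hS, hM⟩ := ih (by omega)
    have hMdet : M.det ≠ 0 := by
      have := congrArg det h
      rw [det_mul, det_mul] at this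
      exact right_ne_zero_of_mul (this ▸ mul_ne_zero hc hw)
    have hne : Sᶜ.Nonempty := by
      rw [← Finset.card_pos, Finset.card_compl]; omega
    obtain ⟨j, hjS, hj⟩ := Finset.exists_max_image Sᶜ d₂ hne
    rw [Finset.mem_compl] at hjS
    classical
    have hcol : (Finset.univ.filter fun i ↦ M i j ≠ 0).Nonempty := by
      by_contra hcon
      rw [Finset.not_nonempty_iff_eq_empty, Finset.filter_eq_empty_iff] at hcon
      exact hMdet (det_eq_zero_of_column_eq_zero j fun i ↦ by simpa using hcon (Finset.mem_univ i))
    obtain ⟨i, hi, hi'⟩ := Finset.exists_min_image _ d₁ hcol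
    simp only [Finset.mem_filter, Finset.mem_univ, true_and] at hi hi'
    have hrow : ∀ l ∈ S, M i l = 0 := by
      intro l hl
      by_contra hne
      have h1 := (hM l hl).1 i hne
      have h2 := (hM l hl).2 j (h1 ▸ hi)
      exact hjS (h2 ▸ hl)
    have hrow' : ∀ l ∈ S, M (σ l) j = 0 := by
      intro l hl
      by_contra hne
      exact hjS ((hM l hl).2 j hne ▸ hl)
    obtain ⟨E, E', hE, hE', hE1, hE2⟩ := exists_clear_column M hi d₁ hi'
    have hij : (E * M) i j ≠ 0 := by rwa [hE1]
    obtain ⟨F, hF, hF', hF1, hF2⟩ := exists_clear_row (E * M) hij d₂ (by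
      intro l hl
      rw [hE1] at hl
      refine hj l (Finset.mem_compl.2 fun hlS ↦ hl (hrow l hlS)))
    have hcol0 : ∀ a, a ≠ i → (E * M) a j = 0 := by
      intro a ha
      rw [hE2 a j ha]; field_simp; ring
    have hEMF : ∀ a b, a ≠ i → b ≠ j →
        (E * M * F) a b = M a b - M a j / M i j * M i b := by
      intro a b ha hb
      rw [hF2 a b hb, hcol0 a ha, hE2 a b ha]; ring
    have hEMFi : ∀ b, b ≠ j → (E * M * F) i b = 0 := by
      intro b hb
      rw [hF2 i b hb]; field_simp; ring
    have hEMFj : ∀ a, a ≠ i → (E * M * F) a j = 0 := by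
      intro a ha
      rw [hF1, hcol0 a ha]
    have hdE' : E'.det ≠ 0 := by
      have := congrArg det hE
      rw [det_mul, det_one] at this
      exact left_ne_zero_of_mul (this ▸ one_ne_zero)
    have hσi : ∀ l ∈ S, σ l ≠ i := fun l hl h0 ↦ hi (h0 ▸ hrow' l hl)
    refine ⟨v * E', w * F, E * M * F, insert j S, Function.update σ j i, ?_, ?_, ?_, hv'.mul hE',
      hw'.mul hF', by rw [Finset.card_insert_of_notMem hjS, hS], ?_⟩
    · rw [← mul_assoc, h]
      simp only [mul_assoc]
      rw [← mul_assoc E' E, hE, one_mul]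
    · rw [det_mul]; exact mul_ne_zero hv hdE'
    · rw [det_mul]; exact mul_ne_zero hw hF
    · intro l hl
      rw [Finset.mem_insert] at hl
      by_cases hlj : l = j
      · subst hlj
        rw [Function.update_self]
        refine ⟨fun a ha ↦ ?_, fun b hb ↦ ?_⟩
        · by_contra hai; exact ha (hEMFj a hai)
        · by_contra hbj; exact hb (hEMFi b hbj)
      · have hlS : l ∈ S := hl.resolve_left hlj
        rw [Function.update_of_ne hlj]
        refine ⟨fun a ha ↦ ?_, fun b hb ↦ ?_⟩
        · by_cases hai : a = i
          · exact absurd (hai ▸ hEMFi l hlj) ha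
          · rw [hEMF a l hai hlj, hrow l hlS, mul_zero, sub_zero] at ha
            exact (hM l hlS).1 a ha
        · by_cases hbj : b = j
          · exact absurd (hbj ▸ hEMFj _ (hσi l hlS)) hb
          · rw [hEMF _ b (hσi l hlS) hbj, hrow' l hlS, zero_div, zero_mul, sub_zero] at hb
            exact (hM l hlS).2 b hb

/-- Bruhat decomposition relative to two weight functions. -/
lemma exists_monomial (c : Matrix n n k) (hc : c.det ≠ 0) (d₁ d₂ : n → ℤ) :
    ∃ (v w M : Matrix n n k) (σ : n → n), c * w = v * M ∧ v.det ≠ 0 ∧ w.det ≠ 0 ∧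
      IsTriangular d₁ v ∧ IsTriangular d₂ w ∧ ∀ i j, M i j ≠ 0 → i = σ j := by
  obtain ⟨v, w, M, S, σ, h, hv, hw, hv', hw', hS, hM⟩ :=
    exists_isMonomialOn c hc d₁ d₂ _ le_rfl
  refine ⟨v, w, M, σ, h, hv, hw, hv', hw', fun i j hij ↦ (hM j ?_).1 i hij⟩
  rw [(Finset.card_eq_iff_eq_univ S).1 hS]
  exact Finset.mem_univ j

/-! ### Birkhoff factorization and its simultaneous form on two branches. -/

/-- A coordinate on the projective line: `O` is the local ring of a point with uniformizer `x`, and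
`A` is the ring of functions on the complement of the point. -/
structure IsCoordinate {k K : Type*} [Field k] [Field K] [Algebra k K] (O A : Subalgebra k K)
    (x : K) : Prop where
  mem : x ∈ O
  ne_zero : x ≠ 0
  inv_mem : x⁻¹ ∈ A
  exists_residue : ∀ f ∈ O, ∃ c : k, x⁻¹ * (f - algebraMap k K c) ∈ O
  exists_zpow : ∀ f : K, f ≠ 0 → ∃ m : ℤ, f * x ^ (-m) ∈ O ∧ f⁻¹ * x ^ m ∈ O
  eq_zero_of_mem : ∀ f ∈ A, x⁻¹ * f ∈ O → f = 0

namespace IsCoordinate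

variable {K : Type*} [Field K] [Algebra k K] {O A : Subalgebra k K} {x : K}
  (h : IsCoordinate O A x)

include h

lemma zpow_mem {m : ℤ} (hm : m ≤ 0) : x ^ m ∈ A := by
  obtain ⟨a, rfl⟩ : ∃ a : ℕ, m = -a := ⟨m.natAbs, by omega⟩
  rw [_root_.zpow_neg, zpow_natCast, ← inv_pow]
  exact pow_mem h.inv_mem a

lemma zpow_mem' {m : ℤ} (hm : 0 ≤ m) : x ^ m ∈ O := by
  obtain ⟨a, rfl⟩ := Int.eq_ofNat_of_zero_le hm
  rw [zpow_natCast]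
  exact pow_mem h.mem a

lemma mem_of_inv_mul_mem {f : K} (hf : x⁻¹ * f ∈ O) : f ∈ O := by
  simpa [← mul_assoc, h.ne_zero] using mul_mem h.mem hf

/-- Throughout, `x⁻¹ * (f - c) ∈ O` expresses that `f` takes the value `c` at the point. This lemma
and the next ones say that taking values respects products, sums and determinants, with no residue
field to be constructed. -/
lemma residue_mul {f g : K} {c d : k} (hg : g ∈ O)
    (hfc : x⁻¹ * (f - algebraMap k K c) ∈ O) (hgd : x⁻¹ * (g - algebraMap k K d) ∈ O) :
    x⁻¹ * (f * g - algebraMap k K (c * d)) ∈ O := by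
  have : x⁻¹ * (f * g - algebraMap k K (c * d)) =
      x⁻¹ * (f - algebraMap k K c) * g + algebraMap k K c * (x⁻¹ * (g - algebraMap k K d)) := by
    rw [map_mul]; ring
  rw [this]
  exact add_mem (mul_mem hfc hg) (mul_mem (O.algebraMap_mem c) hgd)

lemma residue_sum {ι : Type*} (s : Finset ι) {f : ι → K} {c : ι → k}
    (hfc : ∀ i ∈ s, x⁻¹ * (f i - algebraMap k K (c i)) ∈ O) :
    x⁻¹ * (∑ i ∈ s, f i - algebraMap k K (∑ i ∈ s, c i)) ∈ O := by
  rw [map_sum, ← Finset.sum_sub_distrib, Finset.mul_sum]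
  exact sum_mem hfc

omit [Fintype n] [DecidableEq n] in
lemma exists_residue_matrix {a : Matrix n n K} (ha : ∀ i j, a i j ∈ O) :
    ∃ c : Matrix n n k, ∀ i j, x⁻¹ * (a i j - algebraMap k K (c i j)) ∈ O := by
  choose c hc using fun i j ↦ h.exists_residue (a i j) (ha i j)
  exact ⟨c, hc⟩

omit [DecidableEq n] in
lemma residue_matrix_mul {a b : Matrix n n K} {c d : Matrix n n k} (hb : ∀ i j, b i j ∈ O)
    (hac : ∀ i j, x⁻¹ * (a i j - algebraMap k K (c i j)) ∈ O)
    (hbd : ∀ i j, x⁻¹ * (b i j - algebraMap k K (d i j)) ∈ O) (i j : n) :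
    x⁻¹ * ((a * b) i j - algebraMap k K ((c * d) i j)) ∈ O := by
  rw [Matrix.mul_apply, Matrix.mul_apply]
  exact h.residue_sum _ fun l _ ↦ h.residue_mul (hb l j) (hac i l) (hbd l j)

lemma residue_det {a : Matrix n n K} {c : Matrix n n k}
    (ha : ∀ i j, x⁻¹ * (a i j - algebraMap k K (c i j)) ∈ O) :
    x⁻¹ * (a.det - algebraMap k K c.det) ∈ O := by
  have haO : ∀ i j, a i j ∈ O := fun i j ↦ by
    simpa using add_mem (h.mem_of_inv_mul_mem (ha i j)) (O.algebraMap_mem (c i j))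
  rw [det_apply', det_apply']
  refine h.residue_sum _ fun τ _ ↦ ?_
  have hprod : ∀ s : Finset n, x⁻¹ * (∏ i ∈ s, a (τ i) i -
      algebraMap k K (∏ i ∈ s, c (τ i) i)) ∈ O := by
    intro s
    induction s using Finset.induction_on with
    | empty => simp
    | insert i s hi ih =>
      rw [Finset.prod_insert hi, Finset.prod_insert hi]
      exact h.residue_mul (prod_mem fun i _ ↦ haO _ _) (ha _ _) ih
  refine h.residue_mul (prod_mem fun i _ ↦ haO _ _) (by simp) (hprod _)

lemma eq_zero_of_const {c : k} (hc : x⁻¹ * algebraMap k K c ∈ O) : c = 0 :=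
  (map_eq_zero_iff _ (algebraMap k K).injective).1 (h.eq_zero_of_mem _ (A.algebraMap_mem c) hc)

/-- The value of the determinant is the determinant of the values; a constant vanishing at the point
is zero. -/
lemma det_residue_eq_zero_iff {a : Matrix n n K} {c : Matrix n n k}
    (ha : ∀ i j, x⁻¹ * (a i j - algebraMap k K (c i j)) ∈ O) :
    c.det = 0 ↔ x⁻¹ * a.det ∈ O := by
  have := h.residue_det ha
  constructor
  · intro h0
    simpa [h0] using this
  · intro h0
    refine h.eq_zero_of_const ?_
    rw [mul_sub] at this
    simpa using sub_mem h0 this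

/-- Birkhoff factorization. -/
lemma exists_birkhoff (g : Matrix n n K) (hg : g.det ≠ 0) :
    ∃ (b a : Matrix n n K) (d : n → ℤ), (∀ i j, b i j ∈ A) ∧ b.det ≠ 0 ∧
      (b.det)⁻¹ ∈ A ∧ (∀ i j, a i j ∈ O) ∧ x⁻¹ * a.det ∉ O ∧
      g * b = a * diagonal fun j ↦ x ^ d j := by
  have hx := h.ne_zero
  -- The factorization is found by maximizing the total degree `∑ d` over all bases `b` of the
  -- lattice for which the columns of `g * b`, divided by `x ^ d j`, stay regular at the point.
  let P : ℤ → Prop := fun N ↦ ∃ (b : Matrix n n K) (d : n → ℤ), (∀ i j, b i j ∈ A) ∧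
    b.det ≠ 0 ∧ (b.det)⁻¹ ∈ A ∧ (∀ i j, (g * b) i j * x ^ (-d j) ∈ O) ∧ ∑ j, d j = N
  have hdetA : ∀ b : Matrix n n K, (∀ i j, b i j ∈ A) → b.det ∈ A := by
    intro b hb
    rw [det_apply']
    exact sum_mem fun τ _ ↦ mul_mem (by simp) (prod_mem fun i _ ↦ hb _ _)
  have hdetO : ∀ b : Matrix n n K, (∀ i j, b i j ∈ O) → b.det ∈ O := by
    intro b hb
    rw [det_apply']
    exact sum_mem fun τ _ ↦ mul_mem (by simp) (prod_mem fun i _ ↦ hb _ _)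
  have hinh : ∃ N, P N := by
    have : ∀ f : K, ∃ N : ℤ, ∀ m, m ≤ N → f * x ^ (-m) ∈ O := by
      intro f
      by_cases hf : f = 0
      · exact ⟨0, fun m _ ↦ by simp [hf]⟩
      · obtain ⟨N, hN, -⟩ := h.exists_zpow f hf
        refine ⟨N, fun m hm ↦ ?_⟩
        have : f * x ^ (-m) = f * x ^ (-N) * x ^ (N - m) := by
          rw [mul_assoc, ← zpow_add₀ hx]; congr 2; ring
        rw [this]
        exact mul_mem hN (h.zpow_mem' (by omega))
    choose N hN using this
    -- A crude common lower bound for the orders of the entries of column `j`; it shows that the set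
    -- of total degrees is nonempty.
    let e : n → ℤ := fun j ↦ -∑ i, |N (g i j)|
    refine ⟨∑ j, e j, 1, e, fun i j ↦ ?_, by simp, by simp, fun i j ↦ ?_, rfl⟩
    · by_cases hij : i = j
      · rw [hij, Matrix.one_apply_eq]; exact one_mem _
      · rw [Matrix.one_apply_ne hij]; exact zero_mem _
    · rw [mul_one]
      refine hN _ _ ?_
      have h1 : |N (g i j)| ≤ ∑ i, |N (g i j)| :=
        Finset.single_le_sum (f := fun i ↦ |N (g i j)|) (fun _ _ ↦ abs_nonneg _)
          (Finset.mem_univ i)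
      have h2 := neg_abs_le (N (g i j))
      change -∑ i, |N (g i j)| ≤ N (g i j)
      omega
  have hbdd : ∃ B, ∀ N, P N → N ≤ B := by
    obtain ⟨m, -, hm⟩ := h.exists_zpow g.det hg
    refine ⟨m, ?_⟩
    rintro N ⟨b, d, hb, hb0, hb1, hO, rfl⟩
    by_contra hlt
    push Not at hlt
    refine hb0 (h.eq_zero_of_mem _ (hdetA b hb) ?_)
    have h1 : (g * b * diagonal fun j ↦ x ^ (-d j)).det ∈ O :=
      hdetO _ fun i j ↦ by rw [mul_diagonal]; exact hO i j
    rw [det_mul, det_mul, det_diagonal] at h1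
    have h2 : ∏ j, x ^ (-d j) = x ^ (-∑ j, d j) := by
      have : ∀ s : Finset n, ∏ j ∈ s, x ^ (-d j) = x ^ (-∑ j ∈ s, d j) := by
        intro s
        induction s using Finset.induction_on with
        | empty => simp
        | insert i s hi ih => rw [Finset.prod_insert hi, ih, Finset.sum_insert hi, neg_add,
            zpow_add₀ hx]
      exact this _
    rw [h2] at h1
    -- If `∑ d` exceeded the order `m` of `det g`, this identity would make `det b` vanish at the
    -- point; being regular elsewhere, it would be zero.
    have : x⁻¹ * b.det = g.det * b.det * x ^ (-∑ j, d j) * (g.det⁻¹ * x ^ m) *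
        x ^ (∑ j, d j - m - 1) := by
      have h3 : x ^ (-∑ j, d j) * x ^ m * x ^ (∑ j, d j - m - 1) = x⁻¹ := by
        rw [← zpow_add₀ hx, ← zpow_add₀ hx, ← _root_.zpow_neg_one]; congr 1; ring
      rw [← h3]; field_simp
    rw [this]
    exact mul_mem (mul_mem h1 hm) (h.zpow_mem' (by omega))
  obtain ⟨N, ⟨b, d, hb, hb0, hb1, hO, hN⟩, hmax⟩ := Int.exists_greatest_of_bdd hbdd hinh
  refine ⟨b, g * b * diagonal (fun j ↦ x ^ (-d j)), d, hb, hb0, hb1, fun i j ↦ ?_, ?_, ?_⟩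
  · rw [mul_diagonal]; exact hO i j
  · intro hcon
    set a := g * b * diagonal fun j ↦ x ^ (-d j) with ha
    have haO : ∀ i j, a i j ∈ O := fun i j ↦ by rw [ha, mul_diagonal]; exact hO i j
    obtain ⟨c, hc⟩ := h.exists_residue_matrix haO
    have hc0 := (h.det_residue_eq_zero_iff hc).2 hcon
    obtain ⟨v, hv0, hv⟩ := Matrix.exists_mulVec_eq_zero_iff.2 hc0
    classical
    have hne : (Finset.univ.filter fun j ↦ v j ≠ 0).Nonempty := by
      obtain ⟨j, hj⟩ := Function.ne_iff.1 hv0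
      exact ⟨j, by simpa using hj⟩
    -- If `a` is singular at the point, let `v` be in the kernel of its value. Column `j₀` of `b` is
    -- replaced by the combination with coefficients `v j * x ^ (d j₀ - d j)`; minimality of `d j₀`
    -- makes these exponents nonpositive, so the change is invertible over `A`. The new column of `g
    -- * b` vanishes to one order more, contradicting maximality.
    obtain ⟨j₀, hj₀, hmin⟩ := Finset.exists_min_image _ d hne
    simp only [Finset.mem_filter, Finset.mem_univ, true_and] at hj₀ hmin
    let t : n → K := fun j ↦ algebraMap k K (v j) * x ^ (d j₀ - d j)
    have htA : ∀ j, t j ∈ A := by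
      intro j
      by_cases hj : v j = 0
      · simp [t, hj]
      · exact mul_mem (A.algebraMap_mem _) (h.zpow_mem (by have := hmin j hj; omega))
    let T : Matrix n n K := (1 : Matrix n n K).updateCol j₀ t
    have hTdet : T.det = algebraMap k K (v j₀) := by
      have : T.det = cramer 1 t j₀ := (cramer_apply _ _ _).symm
      rw [this, cramer_one]; simp [t]
    have hv' : algebraMap k K (v j₀) ≠ 0 := by simpa using hj₀
    have hTA : ∀ i j, T i j ∈ A := by
      intro i j
      by_cases hj : j = j₀
      · subst hj; simpa [T] using htA i
      · rw [show T i j = (1 : Matrix n n K) i j from updateCol_ne hj]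
        by_cases hij : i = j
        · rw [hij, Matrix.one_apply_eq]; exact one_mem _
        · rw [Matrix.one_apply_ne hij]; exact zero_mem _
    have hgbT : ∀ i j, j ≠ j₀ → (g * (b * T)) i j = (g * b) i j := by
      intro i j hj
      rw [← mul_assoc, Matrix.mul_apply]
      rw [Finset.sum_congr rfl fun l _ ↦ by
        rw [show T l j = (1 : Matrix n n K) l j from updateCol_ne hj]]
      rw [← Matrix.mul_apply, mul_one]
    have hgbT₀ : ∀ i, (g * (b * T)) i j₀ * x ^ (-(d j₀ + 1)) ∈ O := by
      intro i
      have h1 := h.residue_sum Finset.univ (f := fun j ↦ a i j * algebraMap k K (v j))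
        (c := fun j ↦ c i j * v j)
        fun j _ ↦ h.residue_mul (O.algebraMap_mem _) (hc i j) (by simp)
      have h2 : ∑ j, c i j * v j = 0 := congrFun hv i
      rw [h2, map_zero, sub_zero] at h1
      convert h1 using 1
      rw [← mul_assoc, Matrix.mul_apply, Finset.sum_mul, Finset.mul_sum]
      refine Finset.sum_congr rfl fun j _ ↦ ?_
      rw [show T j j₀ = t j by simp [T], ha, mul_diagonal]
      have h3 : x ^ (d j₀ - d j) * x ^ (-(d j₀ + 1)) = x⁻¹ * x ^ (-d j) := by
        rw [← zpow_add₀ hx, ← _root_.zpow_neg_one, ← zpow_add₀ hx]; congr 1; ring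
      simp only [t]
      linear_combination ((g * b) i j * algebraMap k K (v j)) * h3
    have := hmax (N + 1) ⟨b * T, Function.update d j₀ (d j₀ + 1), fun i j ↦ ?_, ?_, ?_, ?_, ?_⟩
    · omega
    · rw [Matrix.mul_apply]
      exact sum_mem fun l _ ↦ mul_mem (hb _ _) (hTA _ _)
    · rw [det_mul, hTdet]; exact mul_ne_zero hb0 hv'
    · rw [det_mul, hTdet, mul_inv, ← map_inv₀]
      exact mul_mem hb1 (A.algebraMap_mem _)
    · intro i j
      by_cases hj : j = j₀
      · subst hj; rw [Function.update_self]; exact hgbT₀ i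
      · rw [Function.update_of_ne hj, hgbT i j hj]; exact hO i j
    · rw [Finset.sum_update_of_mem (Finset.mem_univ _), ← hN,
        ← Finset.add_sum_erase _ d (Finset.mem_univ j₀), Finset.sdiff_singleton_eq_erase]
      ring
  · rw [mul_assoc, diagonal_mul_diagonal]
    have : (fun j ↦ x ^ (-d j) * x ^ d j) = fun _ ↦ 1 := by
      ext j; rw [← zpow_add₀ hx]; simp
    rw [this, diagonal_one, mul_one]

/-- Birkhoff factorization followed by a change of frame over the constants that is compatible
with the degrees. -/
lemma twist {g b a : Matrix n n K} {d : n → ℤ} {v : Matrix n n k} (hb : ∀ i j, b i j ∈ A)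
    (hb0 : b.det ≠ 0) (hb1 : (b.det)⁻¹ ∈ A) (hgb : g * b = a * diagonal fun j ↦ x ^ d j)
    (hv : IsTriangular d v) (hv0 : v.det ≠ 0) :
    ∃ b' : Matrix n n K, (∀ i j, b' i j ∈ A) ∧ b'.det ≠ 0 ∧ (b'.det)⁻¹ ∈ A ∧
      g * b' = a * v.map (algebraMap k K) * diagonal fun j ↦ x ^ d j := by
  have hx := h.ne_zero
  have h1 : (diagonal (fun j ↦ x ^ d j) : Matrix n n K) * diagonal (fun j ↦ x ^ (-d j)) = 1 := by
    rw [diagonal_mul_diagonal, ← diagonal_one]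
    congr 1
    ext j; rw [← zpow_add₀ hx]; simp
  have hdet : (v.map (algebraMap k K)).det = algebraMap k K v.det :=
    ((algebraMap k K).map_det v).symm
  have hdet' : ((diagonal fun j ↦ x ^ (-d j)) * v.map (algebraMap k K) *
      diagonal fun j ↦ x ^ d j).det = algebraMap k K v.det := by
    have h2 := congrArg det h1
    rw [det_mul, det_one] at h2
    rw [det_mul, det_mul, hdet]
    linear_combination (algebraMap k K v.det) * h2
  -- The conjugated matrix has entries `v l j * x ^ (d j - d l)`. Triangularity says that the
  -- exponent is nonpositive wherever `v l j ≠ 0`, so these lie in `A`, and the determinant is still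
  -- that of `v`.
  refine ⟨b * ((diagonal fun j ↦ x ^ (-d j)) * v.map (algebraMap k K) *
      diagonal fun j ↦ x ^ d j), fun i j ↦ ?_, ?_, ?_, ?_⟩
  · rw [Matrix.mul_apply]
    refine sum_mem fun l _ ↦ mul_mem (hb _ _) ?_
    rw [mul_diagonal, diagonal_mul, Matrix.map_apply]
    by_cases hvl : v l j = 0
    · rw [hvl]; simp
    · rw [mul_right_comm, ← zpow_add₀ hx]
      exact mul_mem (h.zpow_mem (by have := hv l j hvl; omega)) (A.algebraMap_mem _)
  · rw [det_mul, hdet']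
    exact mul_ne_zero hb0 (by simpa using hv0)
  · rw [det_mul, hdet', mul_inv, ← map_inv₀]
    exact mul_mem hb1 (A.algebraMap_mem _)
  · rw [← mul_assoc, hgb, mul_assoc a, ← mul_assoc (diagonal _), ← mul_assoc (diagonal _), h1,
      one_mul, mul_assoc]

end IsCoordinate

/-- Simultaneous diagonalization of the gluing matrices on the two branches of a node. -/
theorem exists_simultaneous_factorization {K₁ K₂ R : Type*} [Field K₁] [Field K₂] [Algebra k K₁]
    [Algebra k K₂] [CommRing R] {O₁ A₁ : Subalgebra k K₁} {O₂ A₂ : Subalgebra k K₂} {x₁ : K₁}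
    {x₂ : K₂} (h₁ : IsCoordinate O₁ A₁ x₁) (h₂ : IsCoordinate O₂ A₂ x₂) (φ₁ : R →+* K₁)
    (φ₂ : R →+* K₂)
    (hglue : ∀ o₁ ∈ O₁, ∀ o₂ ∈ O₂, ∀ c : k, x₁⁻¹ * (o₁ - algebraMap k K₁ c) ∈ O₁ →
      x₂⁻¹ * (o₂ - algebraMap k K₂ c) ∈ O₂ → ∃ r, φ₁ r = o₁ ∧ φ₂ r = o₂)
    (hunit : ∀ r, x₁⁻¹ * φ₁ r ∉ O₁ → IsUnit r)
    (g₁ : Matrix n n K₁) (g₂ : Matrix n n K₂) (hg₁ : g₁.det ≠ 0) (hg₂ : g₂.det ≠ 0) :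
    ∃ (r : Matrix n n R) (b₁ : Matrix n n K₁) (b₂ : Matrix n n K₂) (D₁ : n → K₁) (D₂ : n → K₂),
      IsUnit r.det ∧ ((∀ i j, b₁ i j ∈ A₁) ∧ b₁.det ≠ 0 ∧ (b₁.det)⁻¹ ∈ A₁) ∧
      ((∀ i j, b₂ i j ∈ A₂) ∧ b₂.det ≠ 0 ∧ (b₂.det)⁻¹ ∈ A₂) ∧
      g₁ * b₁ = r.map φ₁ * diagonal D₁ ∧ g₂ * b₂ = r.map φ₂ * diagonal D₂ := by
  obtain ⟨b₁, a₁, d₁, hb₁, hb₁0, hb₁1, ha₁, ha₁d, hgb₁⟩ := h₁.exists_birkhoff g₁ hg₁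
  obtain ⟨b₂, a₂, d₂, hb₂, hb₂0, hb₂1, ha₂, ha₂d, hgb₂⟩ := h₂.exists_birkhoff g₂ hg₂
  obtain ⟨c₁, hc₁⟩ := h₁.exists_residue_matrix ha₁
  obtain ⟨c₂, hc₂⟩ := h₂.exists_residue_matrix ha₂
  have hc₁0 : c₁.det ≠ 0 := fun h0 ↦ ha₁d ((h₁.det_residue_eq_zero_iff hc₁).1 h0)
  have hc₂0 : c₂.det ≠ 0 := fun h0 ↦ ha₂d ((h₂.det_residue_eq_zero_iff hc₂).1 h0)
  have hc₁u : IsUnit c₁.det := isUnit_iff_ne_zero.2 hc₁0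
  -- After this choice `c₁ * v * M = c₂ * w`: the corrected matrices `a₁ * v * M` and `a₂ * w` have
  -- the same value at the node.
  obtain ⟨v, w, M, σ, hvw, hv0, hw0, hv, hw, hM⟩ := exists_monomial (c₁⁻¹ * c₂)
    (by rw [det_mul, det_nonsing_inv]; exact mul_ne_zero (by simpa using hc₁0) hc₂0) d₁ d₂
  have hM0 : M.det ≠ 0 := by
    have := congrArg det hvw
    rw [det_mul, det_mul, det_mul, det_nonsing_inv] at this
    exact right_ne_zero_of_mul
      (this ▸ mul_ne_zero (mul_ne_zero (by simpa using hc₁0) hc₂0) hw0)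
  have hcc : c₂ * w = c₁ * (v * M) := by
    rw [← hvw, ← mul_assoc, ← mul_assoc, mul_nonsing_inv _ hc₁u, one_mul]
  obtain ⟨b₁', hb₁', hb₁0', hb₁1', hgb₁'⟩ := h₁.twist hb₁ hb₁0 hb₁1 hgb₁ hv hv0
  obtain ⟨b₂', hb₂', hb₂0', hb₂1', hgb₂'⟩ := h₂.twist hb₂ hb₂0 hb₂1 hgb₂ hw hw0
  have hconst : ∀ (u : Matrix n n k) (i j : n),
      x₁⁻¹ * (u.map (algebraMap k K₁) i j - algebraMap k K₁ (u i j)) ∈ O₁ := by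
    intro u i j; simp
  have hconst₂ : ∀ (u : Matrix n n k) (i j : n),
      x₂⁻¹ * (u.map (algebraMap k K₂) i j - algebraMap k K₂ (u i j)) ∈ O₂ := by
    intro u i j; simp
  have hmapO : ∀ (u : Matrix n n k) (i j : n), u.map (algebraMap k K₁) i j ∈ O₁ :=
    fun u i j ↦ O₁.algebraMap_mem _
  have hmapO₂ : ∀ (u : Matrix n n k) (i j : n), u.map (algebraMap k K₂) i j ∈ O₂ :=
    fun u i j ↦ O₂.algebraMap_mem _
  have hr₁ := h₁.residue_matrix_mul (hmapO (v * M)) hc₁ (hconst (v * M))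
  have hr₂ := h₂.residue_matrix_mul (hmapO₂ w) hc₂ (hconst₂ w)
  have hmem : ∀ i j, ∃ r, φ₁ r = (a₁ * (v * M).map (algebraMap k K₁)) i j ∧
      φ₂ r = (a₂ * w.map (algebraMap k K₂)) i j := by
    intro i j
    refine hglue _ ?_ _ ?_ ((c₂ * w) i j) ?_ (hr₂ i j)
    · rw [Matrix.mul_apply]; exact sum_mem fun l _ ↦ mul_mem (ha₁ _ _) (hmapO _ _ _)
    · rw [Matrix.mul_apply]; exact sum_mem fun l _ ↦ mul_mem (ha₂ _ _) (hmapO₂ _ _ _)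
    · rw [hcc]; exact hr₁ i j
  choose r hφ₁ hφ₂ using hmem
  have hφ₁' : (Matrix.of r).map φ₁ = a₁ * (v * M).map (algebraMap k K₁) := by
    ext i j; exact hφ₁ i j
  have hφ₂' : (Matrix.of r).map φ₂ = a₂ * w.map (algebraMap k K₂) := by
    ext i j; exact hφ₂ i j
  -- A nonzero `M i j` forces `i = σ j`, so `diag (x₁ ^ d₁) * M = M * diag (x₁ ^ (d₁ ∘ σ))`: moving
  -- `M` to the left only relabels the exponents.
  refine ⟨Matrix.of r, b₁' * M.map (algebraMap k K₁), b₂', fun j ↦ x₁ ^ d₁ (σ j),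
    fun j ↦ x₂ ^ d₂ j, hunit _ ?_, ⟨fun i j ↦ ?_, ?_, ?_⟩, ⟨hb₂', hb₂0', hb₂1'⟩, ?_, ?_⟩
  · intro hcon
    have : φ₁ (Matrix.of r).det = (a₁ * (v * M).map (algebraMap k K₁)).det := by
      rw [← hφ₁']; exact φ₁.map_det _
    rw [this] at hcon
    have := (h₁.det_residue_eq_zero_iff hr₁).2 hcon
    rw [det_mul, det_mul] at this
    exact mul_ne_zero hc₁0 (mul_ne_zero hv0 hM0) this
  · rw [Matrix.mul_apply]
    exact sum_mem fun l _ ↦ mul_mem (hb₁' _ _) (A₁.algebraMap_mem _)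
  · rw [det_mul, show (M.map (algebraMap k K₁)).det = algebraMap k K₁ M.det from
      ((algebraMap k K₁).map_det M).symm]
    exact mul_ne_zero hb₁0' (by simpa using hM0)
  · rw [det_mul, show (M.map (algebraMap k K₁)).det = algebraMap k K₁ M.det from
      ((algebraMap k K₁).map_det M).symm, mul_inv, ← map_inv₀]
    exact mul_mem hb₁1' (A₁.algebraMap_mem _)
  · rw [← mul_assoc, hgb₁', hφ₁', Matrix.map_mul, mul_assoc, mul_assoc, mul_assoc, mul_assoc]
    congr 2
    ext i j
    rw [diagonal_mul, mul_diagonal, Matrix.map_apply]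
    by_cases hij : M i j = 0
    · simp [hij]
    · rw [hM i j hij, mul_comm]
  · rw [hgb₂', hφ₂']

end Factorization

end RationalAngle

namespace RationalAngle

/-! ### Local algebra of a node: the two branches are transversal. -/

section Node

open IsLocalRing

section PowerSeries

open MvPowerSeries

variable {k : Type*} [Field k]

lemma mem_maximalIdeal_mvPowerSeries {f : MvPowerSeries (Fin 2) k} :
    f ∈ maximalIdeal (MvPowerSeries (Fin 2) k) ↔ constantCoeff f = 0 := by
  rw [mem_maximalIdeal, mem_nonunits_iff, isUnit_iff_constantCoeff, isUnit_iff_ne_zero, not_not]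

/-- Split `f` into the terms that involve `X 0` and the series `f₀` of the others; without constant
term the latter is divisible by `X 1`. -/
lemma exists_eq_X_mul_add_X_mul {f : MvPowerSeries (Fin 2) k} (hf : constantCoeff f = 0) :
    ∃ g h, f = X 0 * g + X 1 * h := by
  let f₀ : MvPowerSeries (Fin 2) k := fun m ↦ if m 0 = 0 then coeff m f else 0
  have hf₀ : ∀ m, coeff m f₀ = if m 0 = 0 then coeff m f else 0 := fun m ↦ rfl
  obtain ⟨g, hg⟩ : (X 0 : MvPowerSeries (Fin 2) k) ∣ f - f₀ := by
    rw [X_dvd_iff]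
    intro m hm
    rw [map_sub, hf₀, if_pos hm, sub_self]
  obtain ⟨h, hh⟩ : (X 1 : MvPowerSeries (Fin 2) k) ∣ f₀ := by
    rw [X_dvd_iff]
    intro m hm
    rw [hf₀]
    split_ifs with h0
    · have : m = 0 := by
        ext i; fin_cases i
        · exact h0
        · exact hm
      rw [this, coeff_zero_eq_constantCoeff]; exact hf
    · rfl
  exact ⟨g, h, by rw [← hg, ← hh]; ring⟩

lemma le_order_of_mem_pow {f : MvPowerSeries (Fin 2) k} (n : ℕ)
    (hf : f ∈ maximalIdeal (MvPowerSeries (Fin 2) k) ^ n) : (n : ℕ∞) ≤ f.order := by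
  induction n generalizing f with
  | zero => simp
  | succ n ih =>
    rw [pow_succ] at hf
    refine Submodule.mul_induction_on hf (fun a ha b hb ↦ ?_) fun a b ha hb ↦ ?_
    · have h1 := ih ha
      have h2 := one_le_order_iff_constCoeff_eq_zero.2 (mem_maximalIdeal_mvPowerSeries.1 hb)
      push_cast
      exact (add_le_add h1 h2).trans le_order_mul
    · exact (le_min ha hb).trans min_order_le_add

/-- The coordinate ring of the formal node. -/
abbrev FormalNode (k : Type*) [Field k] : Type _ :=
  MvPowerSeries (Fin 2) k ⧸ Ideal.span {(X 0 * X 1 : MvPowerSeries (Fin 2) k)}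

lemma span_X_mul_X_le :
    Ideal.span {(X 0 * X 1 : MvPowerSeries (Fin 2) k)} ≤ maximalIdeal _ := by
  rw [Ideal.span_singleton_le_iff_mem, mem_maximalIdeal_mvPowerSeries]
  simp

instance : Nontrivial (FormalNode k) :=
  Ideal.Quotient.nontrivial_iff.2 fun h ↦
    (maximalIdeal.isMaximal (MvPowerSeries (Fin 2) k)).ne_top
      (top_le_iff.1 (h ▸ span_X_mul_X_le))

instance : IsLocalRing (FormalNode k) :=
  .of_surjective' (Ideal.Quotient.mk _) Ideal.Quotient.mk_surjective

lemma mk_mem_maximalIdeal_formalNode {f : MvPowerSeries (Fin 2) k} :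
    (Ideal.Quotient.mk _ f : FormalNode k) ∈ maximalIdeal (FormalNode k) ↔
      f ∈ maximalIdeal (MvPowerSeries (Fin 2) k) := by
  have := IsLocalHom.of_surjective (Ideal.Quotient.mk (Ideal.span
    {(X 0 * X 1 : MvPowerSeries (Fin 2) k)})) Ideal.Quotient.mk_surjective
  rw [mem_maximalIdeal, mem_maximalIdeal, mem_nonunits_iff, mem_nonunits_iff, isUnit_map_iff]

lemma map_maximalIdeal_formalNode :
    (maximalIdeal (MvPowerSeries (Fin 2) k)).map (Ideal.Quotient.mk _) =
      maximalIdeal (FormalNode k) := by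
  refine le_antisymm ?_ fun a ha ↦ ?_
  · rw [Ideal.map_le_iff_le_comap]
    exact fun f hf ↦ mk_mem_maximalIdeal_formalNode.2 hf
  · obtain ⟨f, rfl⟩ := Ideal.Quotient.mk_surjective a
    exact Ideal.mem_map_of_mem _ (mk_mem_maximalIdeal_formalNode.1 ha)

lemma exists_eq_of_mem_maximalIdeal_formalNode {a : FormalNode k}
    (ha : a ∈ maximalIdeal (FormalNode k)) :
    ∃ g h : FormalNode k, a = Ideal.Quotient.mk _ (X 0) * g + Ideal.Quotient.mk _ (X 1) * h := by
  obtain ⟨f, rfl⟩ := Ideal.Quotient.mk_surjective a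
  obtain ⟨g, h, rfl⟩ := exists_eq_X_mul_add_X_mul
    (mem_maximalIdeal_mvPowerSeries.1 (mk_mem_maximalIdeal_formalNode.1 ha))
  exact ⟨Ideal.Quotient.mk _ g, Ideal.Quotient.mk _ h, by simp⟩

lemma coeff_single_two_sq (i j : Fin 2) (hij : i ≠ j) (g h : MvPowerSeries (Fin 2) k) :
    coeff (Finsupp.single i 2) ((X i * g + X j * h) ^ 2) = constantCoeff g ^ 2 := by
  have h1 : (X i * g + X j * h) ^ 2 = X i ^ 2 * g ^ 2 + X j * (2 * X i * g * h + X j * h ^ 2) := by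
    ring
  rw [h1, map_add, X_dvd_iff.1 (Dvd.intro _ rfl) _ (Finsupp.single_eq_of_ne hij.symm), add_zero,
    X_pow_eq]
  have := coeff_add_monomial_mul (Finsupp.single i 2) 0 (g ^ 2) (1 : k)
  rw [add_zero] at this
  rw [this]
  simp

/-- The cube of the maximal ideal has no quadratic terms and multiples of `X 0 * X 1` have no pure
powers. Thus the coefficients of the two squares are well defined on the quadratic part of the
formal node. -/
lemma coeff_single_two_eq_zero (i : Fin 2) {f : MvPowerSeries (Fin 2) k}
    (hf : f ∈ maximalIdeal (MvPowerSeries (Fin 2) k) ^ 3 ⊔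
      Ideal.span {(X 0 * X 1 : MvPowerSeries (Fin 2) k)}) :
    coeff (Finsupp.single i 2) f = 0 := by
  obtain ⟨a, ha, b, hb, rfl⟩ := Submodule.mem_sup.1 hf
  obtain ⟨c, rfl⟩ := Ideal.mem_span_singleton.1 hb
  rw [map_add, coeff_of_lt_order, zero_add]
  · fin_cases i
    · rw [mul_comm (X 0), mul_assoc]
      exact X_dvd_iff.1 (Dvd.intro _ rfl) _ (by simp)
    · rw [mul_assoc]
      exact X_dvd_iff.1 (Dvd.intro _ rfl) _ (by simp)
  · refine lt_of_lt_of_le ?_ (le_order_of_mem_pow 3 ha)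
    rw [Finsupp.degree_single]
    norm_num

/-- The tangent cone of a node is reduced. -/
lemma mem_sq_of_sq_mem_formalNode {a : FormalNode k} (ha : a ∈ maximalIdeal (FormalNode k))
    (ha2 : a ^ 2 ∈ maximalIdeal (FormalNode k) ^ 3) : a ∈ maximalIdeal (FormalNode k) ^ 2 := by
  obtain ⟨f, rfl⟩ := Ideal.Quotient.mk_surjective a
  obtain ⟨g, h, rfl⟩ := exists_eq_X_mul_add_X_mul
    (mem_maximalIdeal_mvPowerSeries.1 (mk_mem_maximalIdeal_formalNode.1 ha))
  rw [← map_maximalIdeal_formalNode, ← Ideal.map_pow, ← map_pow, ← Ideal.mem_comap,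
    Ideal.comap_map_of_surjective _ Ideal.Quotient.mk_surjective, ← RingHom.ker_eq_comap_bot,
    Ideal.mk_ker] at ha2
  -- The coefficient of `X 0 ^ 2` in the square of `X 0 * g + X 1 * h` is `g(0) ^ 2`, and it must
  -- vanish; likewise for `h`.
  have hg : constantCoeff g = 0 := by
    have := coeff_single_two_eq_zero 0 ha2
    rw [coeff_single_two_sq 0 1 (by decide)] at this
    exact pow_eq_zero_iff (two_ne_zero) |>.1 this
  have hh : constantCoeff h = 0 := by
    have := coeff_single_two_eq_zero 1 ha2
    rw [add_comm, coeff_single_two_sq 1 0 (by decide)] at this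
    exact pow_eq_zero_iff (two_ne_zero) |>.1 this
  rw [← map_maximalIdeal_formalNode, ← Ideal.map_pow]
  refine Ideal.mem_map_of_mem _ ?_
  rw [sq]
  exact add_mem
    (Ideal.mul_mem_mul (mem_maximalIdeal_mvPowerSeries.2 (by simp))
      (mem_maximalIdeal_mvPowerSeries.2 hg))
    (Ideal.mul_mem_mul (mem_maximalIdeal_mvPowerSeries.2 (by simp))
      (mem_maximalIdeal_mvPowerSeries.2 hh))

end PowerSeries

variable {R : Type*} [CommRing R] [IsLocalRing R]

/-- The second order structure at a node: tangent coordinates `x`, `y` with vanishing product,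
and a reduced tangent cone. -/
lemma exists_tangent_coordinates {k : Type*} [Field k]
    (e : AdicCompletion (maximalIdeal R) R ≃+* FormalNode k) :
    ∃ x y : R, x ∈ maximalIdeal R ∧ y ∈ maximalIdeal R ∧ x * y ∈ maximalIdeal R ^ 3 ∧
      maximalIdeal R ≤ Ideal.span {x, y} ⊔ maximalIdeal R ^ 2 ∧
      ∀ a ∈ maximalIdeal R, a ^ 2 ∈ maximalIdeal R ^ 3 → a ∈ maximalIdeal R ^ 2 := by
  set m := maximalIdeal R with hm
  have hm3 : m ^ 3 ≤ m := Ideal.pow_le_self (by norm_num)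
  have hm32 : m ^ 3 ≤ m ^ 2 := Ideal.pow_le_pow_right (by norm_num)
  -- All the information needed lives modulo `m ^ 3`, and `π` and `ρ` compare `R` with the formal
  -- node there: `π ∘ ρ` is the quotient map. Both `π` and this quotient map are local, so nonunits
  -- can be carried in either direction without determining the maximal ideal of the completion.
  let π : FormalNode k →+* R ⧸ m ^ 3 :=
    (AdicCompletion.evalₐ m 3).toRingHom.comp e.symm.toRingHom
  let ρ : R →+* FormalNode k := e.toRingHom.comp (algebraMap R (AdicCompletion m R))
  have hπρ : ∀ r, π (ρ r) = Ideal.Quotient.mk _ r := by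
    intro r
    simp only [π, ρ, RingHom.comp_apply]
    erw [RingEquiv.symm_apply_apply]
    exact (AdicCompletion.evalₐ m 3).commutes r
  have : Nontrivial (R ⧸ m ^ 3) :=
    Ideal.Quotient.nontrivial_iff.2 fun h ↦ (maximalIdeal.isMaximal R).ne_top (top_le_iff.1 (h ▸ hm3))
  have hπs : Function.Surjective π := fun y ↦ by
    obtain ⟨r, rfl⟩ := Ideal.Quotient.mk_surjective y
    exact ⟨ρ r, hπρ r⟩
  have : IsLocalHom π := .of_surjective π hπs
  have : IsLocalHom (Ideal.Quotient.mk (m ^ 3)) := .of_surjective _ Ideal.Quotient.mk_surjective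
  have hρm : ∀ r ∈ m, ρ r ∈ maximalIdeal (FormalNode k) := by
    intro r hr
    rw [hm, mem_maximalIdeal, mem_nonunits_iff, ← isUnit_map_iff (Ideal.Quotient.mk (m ^ 3)),
      ← hπρ, isUnit_map_iff] at hr
    exact hr
  have hπm : ∀ a r, π a = Ideal.Quotient.mk _ r → a ∈ maximalIdeal (FormalNode k) → r ∈ m := by
    intro a r har ha
    rw [hm, mem_maximalIdeal, mem_nonunits_iff, ← isUnit_map_iff (Ideal.Quotient.mk (m ^ 3)),
      ← har, isUnit_map_iff]
    exact ha
  have hmX : ∀ i, Ideal.Quotient.mk _ (MvPowerSeries.X i) ∈ maximalIdeal (FormalNode k) := by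
    intro i
    rw [mk_mem_maximalIdeal_formalNode, mem_maximalIdeal_mvPowerSeries]
    simp
  obtain ⟨x, hx⟩ := Ideal.Quotient.mk_surjective (π (Ideal.Quotient.mk _ (MvPowerSeries.X 0)))
  obtain ⟨y, hy⟩ := Ideal.Quotient.mk_surjective (π (Ideal.Quotient.mk _ (MvPowerSeries.X 1)))
  refine ⟨x, y, hπm _ _ hx.symm (hmX 0), hπm _ _ hy.symm (hmX 1), ?_, fun r hr ↦ ?_,
    fun a ha ha2 ↦ ?_⟩
  · rw [← Ideal.Quotient.eq_zero_iff_mem, map_mul, hx, hy, ← map_mul, ← map_mul,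
      Ideal.Quotient.eq_zero_iff_mem.2 (Ideal.mem_span_singleton_self _), map_zero]
  · obtain ⟨g, h, hgh⟩ := exists_eq_of_mem_maximalIdeal_formalNode (hρm r hr)
    obtain ⟨g', hg'⟩ := Ideal.Quotient.mk_surjective (π g)
    obtain ⟨h', hh'⟩ := Ideal.Quotient.mk_surjective (π h)
    have h1 : r - (x * g' + y * h') ∈ m ^ 3 := by
      rw [← Ideal.Quotient.eq_zero_iff_mem, map_sub, ← hπρ, hgh]
      simp [hx, hy, hg', hh']
    have h2 : r = (x * g' + y * h') + (r - (x * g' + y * h')) := by ring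
    rw [h2]
    refine Submodule.add_mem_sup ?_ (hm32 h1)
    exact Ideal.mem_span_pair.2 ⟨g', h', by ring⟩
  · have h1 : ρ a ∈ maximalIdeal (FormalNode k) ^ 2 := by
      refine mem_sq_of_sq_mem_formalNode (hρm a ha) ?_
      rw [← map_pow]
      have h2 : m.map ρ ≤ maximalIdeal (FormalNode k) :=
        Ideal.map_le_iff_le_comap.2 fun r hr ↦ hρm r hr
      exact Ideal.pow_right_mono h2 3 (by rw [← Ideal.map_pow]; exact Ideal.mem_map_of_mem _ ha2)
    have h3 : (maximalIdeal (FormalNode k)).map π ≤ m.map (Ideal.Quotient.mk (m ^ 3)) := by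
      refine Ideal.map_le_iff_le_comap.2 fun b hb ↦ ?_
      obtain ⟨r, hr⟩ := Ideal.Quotient.mk_surjective (π b)
      rw [Ideal.mem_comap, ← hr]
      exact Ideal.mem_map_of_mem _ (hπm b r hr.symm hb)
    have h4 : Ideal.Quotient.mk (m ^ 3) a ∈ (m ^ 2).map (Ideal.Quotient.mk (m ^ 3)) := by
      rw [Ideal.map_pow, ← hπρ]
      exact Ideal.pow_right_mono h3 2 (by rw [← Ideal.map_pow]; exact Ideal.mem_map_of_mem _ h1)
    rw [← Ideal.mem_comap, Ideal.comap_map_of_surjective _ Ideal.Quotient.mk_surjective,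
      ← RingHom.ker_eq_comap_bot, Ideal.mk_ker, sup_eq_left.2 hm32] at h4
    exact h4

/-- On a nonsingular branch the orders of `φ x` and `φ y` add up to at least three, so one of them
is at least two. Geometrically, each branch is tangent to one of the two lines of the tangent cone.
-/
lemma mem_sq_sup_ker_of_mul_mem {O : Type*} [CommRing O] [IsDomain O] [IsDiscreteValuationRing O]
    (φ : R →+* O) (hφ : Function.Surjective φ) {x y : R} (hxy : x * y ∈ maximalIdeal R ^ 3) :
    x ∈ maximalIdeal R ^ 2 ⊔ RingHom.ker φ ∨ y ∈ maximalIdeal R ^ 2 ⊔ RingHom.ker φ := by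
  have : IsLocalHom φ := .of_surjective φ hφ
  have hmap : (maximalIdeal R).map φ = maximalIdeal O := by
    refine le_antisymm (Ideal.map_le_iff_le_comap.2 fun r hr ↦ ?_) fun a ha ↦ ?_
    · rw [Ideal.mem_comap, mem_maximalIdeal, mem_nonunits_iff, isUnit_map_iff]; exact hr
    · obtain ⟨r, rfl⟩ := hφ a
      rw [mem_maximalIdeal, mem_nonunits_iff, isUnit_map_iff] at ha
      exact Ideal.mem_map_of_mem _ ha
  have hmem : ∀ z, φ z ∈ maximalIdeal O ^ 2 → z ∈ maximalIdeal R ^ 2 ⊔ RingHom.ker φ := by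
    intro z hz
    rwa [← hmap, ← Ideal.map_pow, ← Ideal.mem_comap, Ideal.comap_map_of_surjective _ hφ,
      ← RingHom.ker_eq_comap_bot] at hz
  by_contra! hcon
  have hx := fun h ↦ hcon.1 (hmem x h)
  have hy := fun h ↦ hcon.2 (hmem y h)
  have hxy' : φ x * φ y ∈ maximalIdeal O ^ 3 := by
    rw [← map_mul, ← hmap, ← Ideal.map_pow]; exact Ideal.mem_map_of_mem _ hxy
  obtain ⟨ϖ, hϖ⟩ := IsDiscreteValuationRing.exists_irreducible O
  rw [hϖ.maximalIdeal_eq, Ideal.span_singleton_pow, Ideal.mem_span_singleton] at hx hy hxy'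
  have hx0 : φ x ≠ 0 := fun h ↦ hx (h ▸ dvd_zero _)
  have hy0 : φ y ≠ 0 := fun h ↦ hy (h ▸ dvd_zero _)
  obtain ⟨i, u, hu⟩ := IsDiscreteValuationRing.eq_unit_mul_pow_irreducible hx0 hϖ
  obtain ⟨j, v, hv⟩ := IsDiscreteValuationRing.eq_unit_mul_pow_irreducible hy0 hϖ
  have hi : i < 2 := by
    by_contra h
    exact hx (hu ▸ (pow_dvd_pow ϖ (by omega)).mul_left _)
  have hj : j < 2 := by
    by_contra h
    exact hy (hv ▸ (pow_dvd_pow ϖ (by omega)).mul_left _)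
  have h1 : φ x * φ y = (u * v : Oˣ) * ϖ ^ (i + j) := by
    rw [hu, hv, pow_add, Units.val_mul]; ring
  rw [h1, Units.dvd_mul_left, pow_dvd_pow_iff hϖ.ne_zero hϖ.not_isUnit] at hxy'
  omega

/-- Suppose `x` generates the maximal ideal. Then `x ∉ I₁`, since otherwise `I₂ ≤ I₁`. Every element
of `I₁` is a multiple `x * j`, with `j ∈ I₁` by primality; thus `I₁ = 𝔪 I₁` is zero by Nakayama and
lies in `I₂`. -/
lemma maximalIdeal_ne_span_singleton [IsNoetherianRing R] {I₁ I₂ : Ideal R} [I₁.IsPrime]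
    [I₂.IsPrime] (h₁₂ : ¬ I₁ ≤ I₂) (h₂₁ : ¬ I₂ ≤ I₁) (x : R) :
    maximalIdeal R ≠ Ideal.span {x} := by
  intro hx
  have hxI : x ∉ I₁ := fun h ↦ h₂₁ <| (le_maximalIdeal (Ideal.IsPrime.ne_top ‹_›)).trans
    (hx ▸ (Ideal.span_singleton_le_iff_mem _).2 h)
  refine h₁₂ (le_trans ?_ bot_le)
  refine Submodule.le_of_le_smul_of_le_jacobson_bot (I := maximalIdeal R)
    (IsNoetherian.noetherian I₁) (maximalIdeal_le_jacobson _) fun i hi ↦ ?_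
  obtain ⟨j, rfl⟩ := Ideal.mem_span_singleton.1
    (hx ▸ le_maximalIdeal (Ideal.IsPrime.ne_top ‹I₁.IsPrime›) hi)
  rw [bot_sup_eq, smul_eq_mul]
  exact Ideal.mul_mem_mul (hx ▸ Ideal.mem_span_singleton_self x)
    (((Ideal.IsPrime.mem_or_mem ‹_› hi)).resolve_left hxI)

/-- Two nonsingular branches through a node meet transversally. -/
theorem sup_ker_eq_maximalIdeal [IsNoetherianRing R] {k O₁ O₂ : Type*} [Field k] [CommRing O₁]
    [CommRing O₂] [IsDomain O₁] [IsDomain O₂] [IsDiscreteValuationRing O₁]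
    [IsDiscreteValuationRing O₂]
    (φ₁ : R →+* O₁) (φ₂ : R →+* O₂) (hφ₁ : Function.Surjective φ₁) (hφ₂ : Function.Surjective φ₂)
    (hinf : RingHom.ker φ₁ ⊓ RingHom.ker φ₂ = ⊥) (h₁₂ : ¬ RingHom.ker φ₁ ≤ RingHom.ker φ₂)
    (h₂₁ : ¬ RingHom.ker φ₂ ≤ RingHom.ker φ₁)
    (h : (∃ _ : IsDomain R, IsDiscreteValuationRing R) ∨
      Nonempty (AdicCompletion (maximalIdeal R) R ≃+* FormalNode k)) :
    RingHom.ker φ₁ ⊔ RingHom.ker φ₂ = maximalIdeal R := by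
  have hI₁ := RingHom.ker_isPrime φ₁
  have hI₂ := RingHom.ker_isPrime φ₂
  have hne := maximalIdeal_ne_span_singleton h₁₂ h₂₁
  have hle : RingHom.ker φ₁ ⊔ RingHom.ker φ₂ ≤ maximalIdeal R :=
    sup_le (le_maximalIdeal hI₁.ne_top) (le_maximalIdeal hI₂.ne_top)
  obtain ⟨_, _⟩ | ⟨⟨e⟩⟩ := h
  · obtain ⟨ϖ, hϖ⟩ := IsDiscreteValuationRing.exists_irreducible R
    exact absurd hϖ.maximalIdeal_eq (hne ϖ)
  obtain ⟨x, y, hx, hy, hxy, hspan, hred⟩ := exists_tangent_coordinates e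
  have hnak : ∀ N : Ideal R, maximalIdeal R ≤ N ⊔ maximalIdeal R ^ 2 → maximalIdeal R ≤ N := by
    intro N hN
    refine Submodule.le_of_le_smul_of_le_jacobson_bot (I := maximalIdeal R)
      (IsNoetherian.noetherian _) (maximalIdeal_le_jacobson _) ?_
    rwa [smul_eq_mul, ← sq]
  -- The branches have different tangents: the sum of their ideals contains both coordinates modulo
  -- `𝔪 ^ 2`, and Nakayama concludes.
  have hdiff : ∀ {a b : R}, maximalIdeal R ≤ Ideal.span {a, b} ⊔ maximalIdeal R ^ 2 →
      a ∈ maximalIdeal R ^ 2 ⊔ RingHom.ker φ₁ → b ∈ maximalIdeal R ^ 2 ⊔ RingHom.ker φ₂ →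
      RingHom.ker φ₁ ⊔ RingHom.ker φ₂ = maximalIdeal R := by
    intro a b hab ha hb
    refine le_antisymm hle (hnak _ (hab.trans (sup_le ?_ le_sup_right)))
    rw [Ideal.span_le, Set.pair_subset_iff]
    constructor
    · refine (sup_le le_sup_right (le_sup_left.trans le_sup_left) :
        maximalIdeal R ^ 2 ⊔ RingHom.ker φ₁ ≤ _) ha
    · refine (sup_le le_sup_right (le_sup_right.trans le_sup_left) :
        maximalIdeal R ^ 2 ⊔ RingHom.ker φ₂ ≤ _) hb
  -- The branches cannot share a tangent. Writing `b = c + i = d + j` with `c, d ∈ 𝔪 ^ 2` and `i`,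
  -- `j` in the two ideals, `i * j = 0` gives `(b - c) * (b - d) = 0`, hence `b ^ 2 ∈ 𝔪 ^ 3`. The
  -- reduced tangent cone forces `b ∈ 𝔪 ^ 2`, and then `a` alone generates `𝔪`.
  have hsame : ∀ {a b : R}, maximalIdeal R ≤ Ideal.span {a, b} ⊔ maximalIdeal R ^ 2 →
      a ∈ maximalIdeal R → b ∈ maximalIdeal R →
      b ∈ maximalIdeal R ^ 2 ⊔ RingHom.ker φ₁ → b ∈ maximalIdeal R ^ 2 ⊔ RingHom.ker φ₂ →
      False := by
    intro a b hab ha hb hb₁ hb₂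
    obtain ⟨c, hc, i, hi, hci⟩ := Submodule.mem_sup.1 hb₁
    obtain ⟨d, hd, j, hj, hdj⟩ := Submodule.mem_sup.1 hb₂
    have hij : i * j = 0 := by
      have : i * j ∈ RingHom.ker φ₁ ⊓ RingHom.ker φ₂ :=
        ⟨Ideal.mul_mem_right _ _ hi, Ideal.mul_mem_left _ _ hj⟩
      rwa [hinf] at this
    have hb2 : b ^ 2 = d * b + c * (b - d) := by
      linear_combination hij - (b - d) * hci - i * hdj
    have hmem : b ^ 2 ∈ maximalIdeal R ^ 3 := by
      rw [hb2, pow_succ]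
      refine add_mem (Ideal.mul_mem_mul hd hb) (Ideal.mul_mem_mul hc (sub_mem hb ?_))
      exact Ideal.pow_le_self two_ne_zero hd
    have hb' := hred b hb hmem
    refine hne a (le_antisymm (hnak _ (hab.trans (sup_le ?_ le_sup_right)))
      ((Ideal.span_singleton_le_iff_mem _).2 ha))
    rw [Ideal.span_le, Set.pair_subset_iff]
    exact ⟨Ideal.mem_sup_left (Ideal.mem_span_singleton_self a), Ideal.mem_sup_right hb'⟩
  have hspan' : maximalIdeal R ≤ Ideal.span {y, x} ⊔ maximalIdeal R ^ 2 := by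
    rwa [Set.pair_comm]
  obtain h₁ | h₁ := mem_sq_sup_ker_of_mul_mem φ₁ hφ₁ hxy <;>
    obtain h₂ | h₂ := mem_sq_sup_ker_of_mul_mem φ₂ hφ₂ hxy
  · exact (hsame hspan' hy hx h₁ h₂).elim
  · exact hdiff hspan h₁ h₂
  · exact hdiff hspan' h₁ h₂
  · exact (hsame hspan hx hy h₁ h₂).elim

end Node

end RationalAngle

namespace RationalAngle

/-! ### Frames of sheaves of modules and their transition matrices. -/

section Frames

universe u

variable {X : Scheme.{u}}

/-- Restriction of sections of a sheaf of modules. -/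
def secRes (E : X.Modules) {U V : X.Opens} (h : V ≤ U) : Γ(E, U) →+ Γ(E, V) :=
  (E.presheaf.map (homOfLE h).op).hom

/-- Restriction of functions. -/
def funRes (X : Scheme.{u}) {U V : X.Opens} (h : V ≤ U) : Γ(X, U) →+* Γ(X, V) :=
  (X.presheaf.map (homOfLE h).op).hom

variable {E F : X.Modules} {U V W : X.Opens}

lemma secRes_smul (h : V ≤ U) (r : Γ(X, U)) (s : Γ(E, U)) :
    secRes E h (r • s) = funRes X h r • secRes E h s :=
  Scheme.Modules.map_smul E (homOfLE h) r s

@[simp]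
lemma secRes_secRes (h : V ≤ U) (h' : W ≤ V) (s : Γ(E, U)) :
    secRes E h' (secRes E h s) = secRes E (h'.trans h) s := by
  change (E.presheaf.map _ ≫ E.presheaf.map _) s = _
  rw [← Functor.map_comp]; rfl

@[simp]
lemma secRes_refl (h : U ≤ U) (s : Γ(E, U)) : secRes E h s = s := by
  change E.presheaf.map (𝟙 _) s = s
  rw [CategoryTheory.Functor.map_id]; rfl

@[simp]
lemma funRes_funRes (h : V ≤ U) (h' : W ≤ V) (s : Γ(X, U)) :
    funRes X h' (funRes X h s) = funRes X (h'.trans h) s := by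
  change (X.presheaf.map _ ≫ X.presheaf.map _) s = _
  rw [← Functor.map_comp]; rfl

@[simp]
lemma funRes_refl (h : U ≤ U) (s : Γ(X, U)) : funRes X h s = s := by
  change X.presheaf.map (𝟙 _) s = s
  rw [CategoryTheory.Functor.map_id]; rfl

lemma app_secRes (φ : E ⟶ F) (h : V ≤ U) (s : Γ(E, U)) :
    φ.app V (secRes E h s) = secRes F h (φ.app U s) :=
  ConcreteCategory.congr_hom (φ.mapPresheaf.naturality (homOfLE h).op) s

lemma sec_ext {α : Type*} (W : α → X.Opens) (hW : V ≤ ⨆ a, W a) (hWV : ∀ a, W a ≤ V)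
    {s t : Γ(E, V)} (h : ∀ a, secRes E (hWV a) s = secRes E (hWV a) t) : s = t :=
  TopCat.Sheaf.eq_of_locally_eq' ⟨_, E.isSheaf⟩ W V (fun a ↦ homOfLE (hWV a)) hW s t h

lemma exists_gluing {α : Type*} (W : α → X.Opens) (hW : V ≤ ⨆ a, W a) (hWV : ∀ a, W a ≤ V)
    (s : ∀ a, Γ(E, W a))
    (h : ∀ a b, secRes E inf_le_left (s a) = secRes E (inf_le_right : W a ⊓ W b ≤ W b) (s b)) :
    ∃ t : Γ(E, V), ∀ a, secRes E (hWV a) t = s a := by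
  obtain ⟨t, ht, -⟩ := TopCat.Sheaf.existsUnique_gluing' ⟨_, E.isSheaf⟩ W V
    (fun a ↦ homOfLE (hWV a)) hW s h
  exact ⟨t, ht⟩

/-- A morphism of sheaves of modules given by its effect on sections. -/
def modulesHomMk (f : ∀ U : X.Opens, Γ(E, U) →+ Γ(F, U))
    (hf : ∀ (U : X.Opens) (r : Γ(X, U)) (s : Γ(E, U)), f U (r • s) = r • f U s)
    (hnat : ∀ (U V : X.Opens) (h : V ≤ U) (s : Γ(E, U)),
      f V (secRes E h s) = secRes F h (f U s)) : E ⟶ F :=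
  ⟨PresheafOfModules.homMk
    { app := fun U ↦ AddCommGrpCat.ofHom (f U.unop)
      naturality := fun U V i ↦ by
        ext s
        exact hnat U.unop V.unop (leOfHom i.unop) s }
    fun U r s ↦ hf U.unop r s⟩

variable {ι κ : Type*} [Fintype ι] [Fintype κ]

/-- A frame of `E` over `U`: over each open subset of `U`, the sections `s i` restrict to a basis
of the module of sections of `E`. -/
def IsFrame (s : ι → Γ(E, U)) : Prop :=
  ∀ (V : X.Opens) (h : V ≤ U),
    Function.Bijective fun c : ι → Γ(X, V) ↦ ∑ i, c i • secRes E h (s i)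

lemma IsFrame.res {s : ι → Γ(E, U)} (hs : IsFrame s) (h : V ≤ U) :
    IsFrame fun i ↦ secRes E h (s i) := by
  intro W hW
  simpa using hs W (hW.trans h)

lemma IsFrame.exists_eq {s : ι → Γ(E, U)} (hs : IsFrame s) (h : V ≤ U) (m : Γ(E, V)) :
    ∃ c : ι → Γ(X, V), m = ∑ i, c i • secRes E h (s i) := by
  obtain ⟨c, hc⟩ := (hs V h).2 m
  exact ⟨c, hc.symm⟩

lemma IsFrame.unique {s : ι → Γ(E, U)} (hs : IsFrame s) (h : V ≤ U) {c d : ι → Γ(X, V)}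
    (hcd : ∑ i, c i • secRes E h (s i) = ∑ i, d i • secRes E h (s i)) : c = d :=
  (hs V h).1 hcd

lemma IsFrame.exists_matrix {s : ι → Γ(E, U)} (hs : IsFrame s) (t : κ → Γ(E, U)) :
    ∃ g : Matrix ι κ Γ(X, U), ∀ j, t j = ∑ i, g i j • s i := by
  choose g hg using fun j ↦ hs.exists_eq le_rfl (t j)
  exact ⟨Matrix.of fun i j ↦ g j i, fun j ↦ by simpa using hg j⟩

lemma sum_matrix_mul_smul {A M : Type*} [CommRing A] [AddCommGroup M] [Module A M] {μ : Type*}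
    {s : ι → M} {t : κ → M} {w : μ → M} {g : Matrix ι κ A} {h : Matrix κ μ A}
    (hg : ∀ j, t j = ∑ i, g i j • s i) (hh : ∀ l, w l = ∑ j, h j l • t j) (l : μ) :
    w l = ∑ i, (g * h) i l • s i := by
  rw [hh]
  simp_rw [hg, Matrix.mul_apply, Finset.smul_sum, Finset.sum_smul, smul_smul]
  rw [Finset.sum_comm]
  simp_rw [mul_comm]

lemma IsFrame.matrix_eq {s : ι → Γ(E, U)} (hs : IsFrame s) {g g' : Matrix ι κ Γ(X, U)}
    (h : ∀ j, ∑ i, g i j • s i = ∑ i, g' i j • s i) : g = g' := by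
  ext i j
  exact congrFun (hs.unique le_rfl (c := fun i ↦ g i j) (d := fun i ↦ g' i j)
    (by simpa using h j)) i

lemma IsFrame.mul_eq_one [DecidableEq ι] {s : ι → Γ(E, U)} {t : κ → Γ(E, U)} (hs : IsFrame s)
    {g : Matrix ι κ Γ(X, U)} {g' : Matrix κ ι Γ(X, U)}
    (hg : ∀ j, t j = ∑ i, g i j • s i) (hg' : ∀ j, s j = ∑ i, g' i j • t i) : g * g' = 1 := by
  refine hs.matrix_eq fun j ↦ ?_
  rw [← sum_matrix_mul_smul hg hg']
  simp [Matrix.one_apply]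

lemma IsFrame.card_eq [Nontrivial Γ(X, U)] {s : ι → Γ(E, U)} {t : κ → Γ(E, U)} (hs : IsFrame s)
    (ht : IsFrame t) : Fintype.card ι = Fintype.card κ := by
  classical
  obtain ⟨g, hg⟩ := hs.exists_matrix t
  obtain ⟨g', hg'⟩ := ht.exists_matrix s
  exact Matrix.square_of_invertible g g' (hs.mul_eq_one hg hg') (ht.mul_eq_one hg' hg)

lemma IsFrame.isUnit_det [DecidableEq ι] {s t : ι → Γ(E, U)} (hs : IsFrame s) (ht : IsFrame t)
    {g : Matrix ι ι Γ(X, U)} (hg : ∀ j, t j = ∑ i, g i j • s i) : IsUnit g.det := by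
  obtain ⟨g', hg'⟩ := ht.exists_matrix s
  have := congrArg Matrix.det (hs.mul_eq_one hg hg')
  rw [Matrix.det_mul, Matrix.det_one] at this
  exact IsUnit.of_mul_eq_one _ this

lemma IsFrame.reindex {s : ι → Γ(E, U)} (hs : IsFrame s) (e : κ ≃ ι) :
    IsFrame fun j ↦ s (e j) := by
  intro V h
  have := hs V h
  have h2 : (fun c : κ → Γ(X, V) ↦ ∑ j, c j • secRes E h (s (e j))) =
      (fun c : ι → Γ(X, V) ↦ ∑ i, c i • secRes E h (s i)) ∘
        (fun c : κ → Γ(X, V) ↦ c ∘ e.symm) := by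
    ext c
    simp only [Function.comp_apply]
    rw [← e.sum_comp]
    simp
  rw [h2]
  exact this.comp (e.symm.arrowCongr (Equiv.refl _)).symm.bijective

lemma secRes_sum_smul (h : V ≤ U) (s : ι → Γ(E, U)) (c : ι → Γ(X, U)) :
    secRes E h (∑ i, c i • s i) = ∑ i, funRes X h (c i) • secRes E h (s i) := by
  rw [map_sum]
  simp_rw [secRes_smul]

lemma IsFrame.matrix_smul [DecidableEq ι] {s : ι → Γ(E, U)} (hs : IsFrame s)
    {g : Matrix ι ι Γ(X, U)} (hg : IsUnit g.det) : IsFrame fun j ↦ ∑ i, g i j • s i := by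
  intro V h
  let G : Matrix ι ι Γ(X, V) := g.map (funRes X h)
  have hG : IsUnit G.det := by
    have : G.det = funRes X h g.det := ((funRes X h).map_det g).symm
    rw [this]; exact hg.map _
  have h2 : (fun c : ι → Γ(X, V) ↦ ∑ j, c j • secRes E h (∑ i, g i j • s i)) =
      (fun c : ι → Γ(X, V) ↦ ∑ i, c i • secRes E h (s i)) ∘
        (fun c : ι → Γ(X, V) ↦ G.mulVec c) := by
    ext c
    simp only [Function.comp_apply, secRes_sum_smul, Finset.smul_sum, Matrix.mulVec, dotProduct,
      Finset.sum_smul, smul_smul]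
    rw [Finset.sum_comm]
    simp [G, mul_comm]
  rw [h2]
  refine (hs V h).comp ⟨fun c d hcd ↦ ?_, fun c ↦ ⟨G⁻¹.mulVec c, ?_⟩⟩
  · have := congrArg G⁻¹.mulVec hcd
    simpa [Matrix.mulVec_mulVec, Matrix.nonsing_inv_mul _ hG] using this
  · simp [Matrix.mulVec_mulVec, Matrix.mul_nonsing_inv _ hG]

end Frames

end RationalAngle

namespace RationalAngle

/-! ### Frames under open immersions. -/

section Restriction

universe u

variable {X Y : Scheme.{u}} {ι : Type*} [Fintype ι]

lemma isFrame_restrictAppIso_iff (j : Y ⟶ X) [IsOpenImmersion j] (E : X.Modules) {U : Y.Opens}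
    (s : ι → Γ(E.restrict j, U)) :
    IsFrame (fun i ↦ (E.restrictAppIso j U).hom (s i)) ↔ IsFrame s := by
  have key : ∀ (V : Y.Opens) (hV : V ≤ U) (h : j ''ᵁ V ≤ j ''ᵁ U),
      (Function.Bijective fun c : ι → Γ(X, j ''ᵁ V) ↦
        ∑ i, c i • secRes E h ((E.restrictAppIso j U).hom (s i))) ↔
      Function.Bijective fun c : ι → Γ(Y, V) ↦ ∑ i, c i • secRes (E.restrict j) hV (s i) := by
    intro V hV h
    have h1 : (fun c : ι → Γ(Y, V) ↦ (∑ i, c i • secRes (E.restrict j) hV (s i) :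
          Γ(E.restrict j, V))) =
        (fun c : ι → Γ(X, j ''ᵁ V) ↦
          (∑ i, c i • secRes E h ((E.restrictAppIso j U).hom (s i)) : Γ(E, j ''ᵁ V))) ∘
        (fun c i ↦ (j.appIso V).inv (c i)) := by
      ext c
      rfl
    have h2 : Function.Bijective fun (c : ι → Γ(Y, V)) i ↦ (j.appIso V).inv (c i) :=
      (Equiv.piCongrRight fun _ ↦ (j.appIso V).commRingCatIsoToRingEquiv.symm.toEquiv).bijective
    rw [h1]
    exact ⟨fun h ↦ h.comp h2, fun h ↦ (Function.Bijective.of_comp_iff _ h2).1 h⟩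
  constructor
  · intro h V hV
    exact (key V hV (j.image_mono hV)).1 (h _ _)
  · intro h V' hV'
    obtain ⟨V, rfl⟩ : ∃ V, V' = j ''ᵁ V := by
      refine ⟨j ⁻¹ᵁ V', ?_⟩
      rw [j.image_preimage_eq_opensRange_inf]
      exact (inf_eq_right.2 (hV'.trans (j.image_le_opensRange U))).symm
    have hV : V ≤ U := (j.image_le_image_iff V U).1 hV'
    exact (key V hV hV').2 (h V hV)

/-- A sheaf with a global frame consisting of one section is trivial. -/
lemma nonempty_iso_unit_of_isFrame (M : Y.Modules) {s : Γ(M, ⊤)}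
    (hs : IsFrame fun _ : Unit ↦ s) :
    Nonempty (M ≅ (SheafOfModules.unit Y.ringCatSheaf : Y.Modules)) := by
  let U : Y.Modules := SheafOfModules.unit Y.ringCatSheaf
  let φ : U ⟶ M := modulesHomMk (E := U) (F := M)
    (fun V ↦ AddMonoidHom.mk' (fun r : Γ(Y, V) ↦ r • secRes M le_top s) fun a b ↦ add_smul _ _ _)
    (fun V r t ↦ mul_smul r (show Γ(Y, V) from t) _)
    (fun V W h t ↦ by
      have := secRes_smul (E := M) h (show Γ(Y, V) from t) (secRes M le_top s)
      rw [secRes_secRes] at this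
      exact this.symm)
  have : IsIso φ := by
    rw [Scheme.Modules.Hom.isIso_iff_isIso_app]
    intro V
    rw [ConcreteCategory.isIso_iff_bijective]
    have h1 := hs V le_top
    have h2 : (fun r : Γ(Y, V) ↦ r • secRes M (le_top : V ≤ ⊤) s) =
        (fun c : Unit → Γ(Y, V) ↦ ∑ i, c i • secRes M (le_top : V ≤ ⊤) s) ∘ (fun r _ ↦ r) := by
      ext r; simp
    have h3 : Function.Bijective fun (r : Γ(Y, V)) (_ : Unit) ↦ r :=
      (Equiv.funUnique Unit _).symm.bijective
    have h4 := h1.comp h3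
    rw [← h2] at h4
    exact h4
  exact ⟨(asIso φ).symm⟩

end Restriction

/-! ### Splitting a sheaf whose transition matrices are diagonal. -/

section Decomposition

variable {X : Scheme.{0}} {E : X.Modules} {n : ℕ} {α : Type*} {W : α → X.Opens}
  {s : ∀ a, Fin n → Γ(E, W a)}

lemma isLineBundle_of_isFrame {L : X.Modules} (hW : ⨆ a, W a = ⊤) (t : ∀ a, Γ(L, W a))
    (ht : ∀ a, IsFrame fun _ : Unit ↦ t a) : IsLineBundle L := by
  intro x
  obtain ⟨a, ha⟩ := TopologicalSpace.Opens.mem_iSup.1 (hW ▸ TopologicalSpace.Opens.mem_top x)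
  refine ⟨W a, ha, ?_⟩
  have h1 : (W a).ι ''ᵁ ⊤ ≤ W a := by simp
  have h2 := (ht a).res h1
  exact nonempty_iso_unit_of_isFrame _
    ((isFrame_restrictAppIso_iff (W a).ι L fun _ : Unit ↦
      (L.restrictAppIso (W a).ι ⊤).inv (secRes L h1 (t a))).1 (by simpa using h2))

/-- `y` is the component of `m` along the `i`-th section of the frames `s`. -/
def IsComponent (s : ∀ a, Fin n → Γ(E, W a)) (i : Fin n) {V : X.Opens} (m y : Γ(E, V)) : Prop :=
  ∀ (a : α) (V' : X.Opens) (h : V' ≤ V) (h' : V' ≤ W a) (c : Fin n → Γ(X, V')),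
    secRes E h m = ∑ j, c j • secRes E h' (s a j) → secRes E h y = c i • secRes E h' (s a i)

lemma le_iSup_inf (hW : ⨆ a, W a = ⊤) (V : X.Opens) : V ≤ ⨆ a, V ⊓ W a := by
  rw [← inf_iSup_eq, hW, inf_top_eq]

lemma IsComponent.unique (hW : ⨆ a, W a = ⊤) (hs : ∀ a, IsFrame (s a)) {i : Fin n} {V : X.Opens}
    {m y y' : Γ(E, V)} (h : IsComponent s i m y) (h' : IsComponent s i m y') : y = y' := by
  refine sec_ext _ (le_iSup_inf hW V) (fun a ↦ inf_le_left) fun a ↦ ?_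
  obtain ⟨c, hc⟩ := (hs a).exists_eq inf_le_right (secRes E (inf_le_left : V ⊓ W a ≤ V) m)
  rw [h a _ _ _ c hc, h' a _ _ _ c hc]

/-- Since the transition matrices are diagonal, the summand `c i • s a i` of a section does not
depend on the frame used to expand it, so the local components glue. -/
lemma exists_isComponent (hW : ⨆ a, W a = ⊤) (hs : ∀ a, IsFrame (s a))
    (hdiag : ∀ a b i, ∃ f : Γ(X, W a ⊓ W b),
      secRes E inf_le_left (s a i) = f • secRes E inf_le_right (s b i))
    (i : Fin n) {V : X.Opens} (m : Γ(E, V)) : ∃ y, IsComponent s i m y := by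
  choose f hf using hdiag
  have hf' : ∀ a b i (V : X.Opens) (ha : V ≤ W a) (hb : V ≤ W b),
      secRes E ha (s a i) = funRes X (le_inf ha hb) (f a b i) • secRes E hb (s b i) := by
    intro a b i V ha hb
    have := congrArg (secRes E (le_inf ha hb)) (hf a b i)
    rwa [secRes_smul, secRes_secRes, secRes_secRes] at this
  -- the component does not depend on the frame
  have key : ∀ a b (V' : X.Opens) (ha : V' ≤ W a) (hb : V' ≤ W b) (c d : Fin n → Γ(X, V')),
      ∑ j, c j • secRes E ha (s a j) = ∑ j, d j • secRes E hb (s b j) →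
      c i • secRes E ha (s a i) = d i • secRes E hb (s b i) := by
    intro a b V' ha hb c d hcd
    have h1 : ∑ j, c j • secRes E ha (s a j) =
        ∑ j, (c j * funRes X (le_inf ha hb) (f a b j)) • secRes E hb (s b j) :=
      Finset.sum_congr rfl fun j _ ↦ by rw [hf' a b j V' ha hb, mul_smul]
    have h2 := (hs b).unique hb (h1.symm.trans hcd)
    rw [hf' a b i V' ha hb, ← mul_smul]
    exact congrArg (· • _) (congrFun h2 i)
  choose c hc using fun a ↦ (hs a).exists_eq inf_le_right (secRes E (inf_le_left : V ⊓ W a ≤ V) m)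
  have hc' : ∀ a (V' : X.Opens) (h : V' ≤ V ⊓ W a), secRes E (h.trans inf_le_left) m =
      ∑ j, funRes X h (c a j) • secRes E (h.trans inf_le_right) (s a j) := by
    intro a V' h
    have := congrArg (secRes E h) (hc a)
    rw [secRes_sum_smul, secRes_secRes] at this
    simpa using this
  obtain ⟨y, hy⟩ := exists_gluing (fun a ↦ V ⊓ W a) (le_iSup_inf hW V) (fun a ↦ inf_le_left)
    (fun a ↦ c a i • secRes E inf_le_right (s a i)) (by
      intro a b
      rw [secRes_smul, secRes_smul, secRes_secRes, secRes_secRes]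
      refine key a b _ _ _ (fun j ↦ funRes X _ (c a j)) (fun j ↦ funRes X _ (c b j)) ?_
      rw [← hc' a _ inf_le_left, ← hc' b _ inf_le_right])
  refine ⟨y, fun a V' hV hVW d hd ↦ ?_⟩
  have h1 := congrArg (secRes E (le_inf hV hVW)) (hy a)
  rw [secRes_secRes, secRes_smul, secRes_secRes] at h1
  rw [h1]
  refine key a a _ _ _ (fun j ↦ funRes X _ (c a j)) _ ?_
  rw [← hd, ← hc' a V' (le_inf hV hVW)]

/-- The projection of `E` onto the `i`-th summand. -/
lemma exists_projection (hW : ⨆ a, W a = ⊤) (hs : ∀ a, IsFrame (s a))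
    (hdiag : ∀ a b i, ∃ f : Γ(X, W a ⊓ W b),
      secRes E inf_le_left (s a i) = f • secRes E inf_le_right (s b i)) (i : Fin n) :
    ∃ e : E ⟶ E, ∀ (V : X.Opens) (m : Γ(E, V)), IsComponent s i m (e.app V m) := by
  choose p hp using fun (V : X.Opens) (m : Γ(E, V)) ↦ exists_isComponent hW hs hdiag i m
  refine ⟨modulesHomMk (fun V ↦ AddMonoidHom.mk' (p V) fun m m' ↦ ?_) (fun V r m ↦ ?_)
    (fun V V' h m ↦ ?_), fun V m ↦ hp V m⟩
  · refine (hp V (m + m')).unique hW hs fun a V' h h' c hc ↦ ?_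
    obtain ⟨d, hd⟩ := (hs a).exists_eq h' (secRes E h m)
    obtain ⟨d', hd'⟩ := (hs a).exists_eq h' (secRes E h m')
    have : c = d + d' := (hs a).unique h' (by
      rw [← hc, map_add, hd, hd', ← Finset.sum_add_distrib]
      exact Finset.sum_congr rfl fun j _ ↦ (add_smul _ _ _).symm)
    rw [map_add, hp V m a V' h h' d hd, hp V m' a V' h h' d' hd', this, Pi.add_apply, add_smul]
  · refine (hp V (r • m)).unique hW hs fun a V' h h' c hc ↦ ?_
    obtain ⟨d, hd⟩ := (hs a).exists_eq h' (secRes E h m)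
    have : c = fun j ↦ funRes X h r * d j := (hs a).unique h' (by
      rw [← hc, secRes_smul, hd, Finset.smul_sum]
      exact Finset.sum_congr rfl fun j _ ↦ (mul_smul _ _ _).symm)
    change secRes E h (r • p V m) = _
    rw [secRes_smul, hp V m a V' h h' d hd, this, mul_smul]
  · refine (hp V' (secRes E h m)).unique hW hs fun a V'' h₁ h₂ c hc ↦ ?_
    rw [secRes_secRes] at hc ⊢
    exact hp V m a V'' _ h₂ c hc

/-- A sheaf with frames on an open cover such that the transition matrices are diagonal is a
direct sum of line bundles. -/
theorem exists_iso_biproduct_of_diagonal (hW : ⨆ a, W a = ⊤) (hs : ∀ a, IsFrame (s a))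
    (hdiag : ∀ a b i, ∃ f : Γ(X, W a ⊓ W b),
      secRes E inf_le_left (s a i) = f • secRes E inf_le_right (s b i)) :
    ∃ L : Fin n → X.Modules, (∀ i, IsLineBundle (L i)) ∧ Nonempty (E ≅ ⨁ L) := by
  choose e he using exists_projection hW hs hdiag
  -- equality of endomorphisms can be tested on components
  have hloc : ∀ (φ ψ : E ⟶ E), (∀ (a : α) (V : X.Opens) (h : V ≤ W a) (c : Fin n → Γ(X, V)),
      φ.app V (∑ j, c j • secRes E h (s a j)) = ψ.app V (∑ j, c j • secRes E h (s a j))) →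
      φ = ψ := by
    intro φ ψ h
    refine Scheme.Modules.hom_ext _ _ fun V ↦ ?_
    ext m
    refine sec_ext _ (le_iSup_inf hW V) (fun a ↦ inf_le_left) fun a ↦ ?_
    obtain ⟨c, hc⟩ := (hs a).exists_eq inf_le_right (secRes E (inf_le_left : V ⊓ W a ≤ V) m)
    rw [← app_secRes, ← app_secRes, hc]
    exact h a _ _ c
  have heval : ∀ i a (V : X.Opens) (h : V ≤ W a) (c : Fin n → Γ(X, V)),
      (e i).app V (∑ j, c j • secRes E h (s a j)) = c i • secRes E h (s a i) := by
    intro i a V h c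
    have := he i V (∑ j, c j • secRes E h (s a j)) a V le_rfl h c (by simp)
    simpa using this
  have hone : ∀ i a (V : X.Opens) (h : V ≤ W a) (r : Γ(X, V)),
      r • secRes E h (s a i) = ∑ j, (Pi.single i r : Fin n → Γ(X, V)) j • secRes E h (s a j) := by
    intro i a V h r
    rw [Finset.sum_eq_single i]
    · simp
    · intro j _ hj; simp [Pi.single_eq_of_ne hj]
    · simp
  have hee : ∀ i, e i ≫ e i = e i := by
    intro i
    refine hloc _ _ fun a V h c ↦ ?_
    rw [Scheme.Modules.Hom.comp_app, ConcreteCategory.comp_apply, heval, hone, heval]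
    simp
  have hij : ∀ i j, i ≠ j → e i ≫ e j = 0 := by
    intro i j hij
    refine hloc _ _ fun a V h c ↦ ?_
    rw [Scheme.Modules.Hom.comp_app, ConcreteCategory.comp_apply, heval, hone, heval]
    simp [Pi.single_eq_of_ne hij.symm]
  have hsum : ∑ i, e i = 𝟙 E := by
    refine hloc _ _ fun a V h c ↦ ?_
    have h1 : ∀ (S : Finset (Fin n)) (m : Γ(E, V)), (∑ i ∈ S, e i).app V m =
        ∑ i ∈ S, (e i).app V m := by
      intro S m
      induction S using Finset.induction_on with
      | empty => simp
      | insert i S hi ih =>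
        rw [Finset.sum_insert hi, Finset.sum_insert hi, Scheme.Modules.Hom.add_app, ← ih]
        rfl
    rw [h1]
    simp_rw [heval]
    rfl
  -- The projections are orthogonal idempotents with sum the identity. They split because the
  -- category is abelian, and the `i`-th image is a line bundle with local generators `π i (s a i)`.
  choose L ι π hι hπ using fun i ↦ IsIdempotentComplete.idempotents_split E (e i) (hee i)
  refine ⟨L, fun i ↦ ?_, ⟨?_⟩⟩
  · refine isLineBundle_of_isFrame hW (fun a ↦ (π i).app _ (s a i)) fun a V h ↦ ⟨?_, ?_⟩
    · intro c d hcd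
      have h1 : ∀ c : Unit → Γ(X, V),
          (ι i).app V (∑ u, c u • secRes (L i) h ((π i).app _ (s a i))) =
            c () • secRes E h (s a i) := by
        intro c
        have h2 : (ι i).app V ((π i).app V (secRes E h (s a i))) = secRes E h (s a i) := by
          rw [← ConcreteCategory.comp_apply, ← Scheme.Modules.Hom.comp_app, hπ]
          have := heval i a V h (Pi.single i 1)
          rw [← hone] at this
          simpa using this
        rw [Finset.univ_unique, Finset.sum_singleton, Scheme.Modules.Hom.app_smul, ← app_secRes,
          h2]
      have h3 := congrArg ((ι i).app V) hcd
      simp only [h1] at h3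
      rw [hone, hone] at h3
      have h4 := congrFun ((hs a).unique h h3) i
      ext u
      simpa using h4
    · intro y
      obtain ⟨c, hc⟩ := (hs a).exists_eq h ((ι i).app V y)
      refine ⟨fun _ ↦ c i, ?_⟩
      have h1 : (e i).app V ((ι i).app V y) = (ι i).app V y := by
        rw [← ConcreteCategory.comp_apply, ← Scheme.Modules.Hom.comp_app, ← hπ, ← Category.assoc,
          hι, Category.id_comp]
      have h2 : (π i).app V ((ι i).app V y) = y := by
        rw [← ConcreteCategory.comp_apply, ← Scheme.Modules.Hom.comp_app, hι]
        rfl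
      rw [hc, heval] at h1
      change ∑ _u : Unit, c i • secRes (L i) h ((π i).app _ (s a i)) = y
      rw [Finset.univ_unique, Finset.sum_singleton, ← app_secRes,
        ← Scheme.Modules.Hom.app_smul, h1, ← hc, h2]
  · let b : Bicone L :=
      { pt := E
        π := π
        ι := ι
        ι_π := fun i j ↦ by
          split_ifs with h
          · subst h; simpa using hι i
          · have h1 : ι i ≫ π j = ι i ≫ (e i ≫ e j) ≫ π j := by
              rw [← hπ i, ← hπ j]
              simp only [Category.assoc]
              rw [hι j, Category.comp_id, ← Category.assoc (ι i), hι i, Category.id_comp]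
            rw [h1, hij i j h]; simp }
    have hb : b.IsBilimit := isBilimitOfTotal b (by simpa [b, hπ] using hsum)
    exact biproduct.uniqueUpToIso L hb

end Decomposition

end RationalAngle

namespace RationalAngle

/-! ### Existence of frames: locally, and over a principal ideal domain. -/

section LocalFrames

universe u

variable {X Y : Scheme.{u}}

lemma IsFrame.of_iso {ι : Type*} [Fintype ι] {E F : X.Modules} {U : X.Opens} (e : E ≅ F)
    {s : ι → Γ(E, U)} (hs : IsFrame s) : IsFrame fun i ↦ e.hom.app U (s i) := by
  intro V h
  have h1 : (fun c : ι → Γ(X, V) ↦ ∑ i, c i • secRes F h (e.hom.app U (s i))) =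
      e.hom.app V ∘ fun c : ι → Γ(X, V) ↦ ∑ i, c i • secRes E h (s i) := by
    ext c
    simp only [Function.comp_apply, map_sum, Scheme.Modules.Hom.app_smul, app_secRes]
  rw [h1]
  exact (ConcreteCategory.bijective_of_isIso (e.hom.app V)).comp (hs V h)

/-- For finite `I` the coproduct is a biproduct: the maps `p i` from the universal property are
coordinates, and the images of `1` under the injections form the frame. -/
lemma exists_isFrame_free (I : Type u) [Fintype I] :
    ∃ s : I → Γ((SheafOfModules.free I : Y.Modules), ⊤), IsFrame s := by
  classical
  let Fr : Y.Modules := SheafOfModules.free (R := Y.ringCatSheaf) I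
  let O : Y.Modules := SheafOfModules.unit Y.ringCatSheaf
  let inj : I → (O ⟶ Fr) := fun i ↦ SheafOfModules.ιFree i
  let p : I → (Fr ⟶ O) := fun i ↦
    Cofan.IsColimit.desc (SheafOfModules.isColimitFreeCofan (R := Y.ringCatSheaf) I)
      fun j ↦ if j = i then 𝟙 _ else 0
  have hp : ∀ i j, inj j ≫ p i = if j = i then 𝟙 _ else 0 := fun i j ↦
    Cofan.IsColimit.fac (SheafOfModules.isColimitFreeCofan (R := Y.ringCatSheaf) I) _ j
  have hsum : ∑ i, p i ≫ inj i = 𝟙 Fr := by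
    refine Cofan.IsColimit.hom_ext (SheafOfModules.isColimitFreeCofan (R := Y.ringCatSheaf) I)
      _ _ fun j ↦ ?_
    change inj j ≫ _ = inj j ≫ 𝟙 _
    rw [Preadditive.comp_sum, Finset.sum_eq_single j]
    · rw [← Category.assoc, hp, if_pos rfl, Category.id_comp, Category.comp_id]
    · intro i _ hi
      rw [← Category.assoc, hp, if_neg hi.symm, zero_comp]
    · simp
  have happ : ∀ (V : Y.Opens) (S : Finset I) (m : Γ(Fr, V)),
      (∑ i ∈ S, p i ≫ inj i).app V m = ∑ i ∈ S, (inj i).app V ((p i).app V m) := by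
    intro V S m
    induction S using Finset.induction_on with
    | empty => simp
    | insert i S hi ih =>
      rw [Finset.sum_insert hi, Finset.sum_insert hi, Scheme.Modules.Hom.add_app, ← ih]
      rfl
  let one : ∀ V : Y.Opens, Γ(O, V) := fun V ↦ (1 : Γ(Y, V))
  have hone : ∀ (V : Y.Opens) (r : Γ(O, V)), r = (show Γ(Y, V) from r) • one V :=
    fun V r ↦ (mul_one (show Γ(Y, V) from r)).symm
  have hres : ∀ V : Y.Opens, secRes O (le_top : V ≤ ⊤) (one ⊤) = one V :=
    fun V ↦ (funRes Y (le_top : V ≤ ⊤)).map_one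
  refine ⟨fun i ↦ (inj i).app ⊤ (one ⊤), fun V h ↦ ?_⟩
  have hinj : ∀ i, secRes Fr h ((inj i).app ⊤ (one ⊤)) = (inj i).app V (one V) := by
    intro i
    rw [← app_secRes, hres]
  have hfun : (fun c : I → Γ(Y, V) ↦ ∑ i, c i • secRes Fr h ((inj i).app ⊤ (one ⊤))) =
      fun c ↦ ∑ i, c i • (inj i).app V (one V) := by
    ext c
    exact Finset.sum_congr rfl fun i _ ↦ by rw [hinj]
  change Function.Bijective
    (fun c : I → Γ(Y, V) ↦ ∑ i, c i • secRes Fr h ((inj i).app ⊤ (one ⊤)))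
  rw [hfun]
  have hcoord : ∀ (c : I → Γ(Y, V)) (i : I),
      (p i).app V (∑ j, c j • (inj j).app V (one V)) = c i • one V := by
    intro c i
    rw [map_sum, Finset.sum_eq_single i]
    · rw [Scheme.Modules.Hom.app_smul, ← ConcreteCategory.comp_apply,
        ← Scheme.Modules.Hom.comp_app, hp, if_pos rfl]
      rfl
    · intro j _ hj
      rw [Scheme.Modules.Hom.app_smul, ← ConcreteCategory.comp_apply,
        ← Scheme.Modules.Hom.comp_app, hp, if_neg hj]
      exact mul_zero (c j)
    · simp
  refine ⟨fun c d hcd ↦ ?_, fun m ↦ ?_⟩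
  · ext i
    have := congrArg ((p i).app V) hcd
    simp only [hcoord] at this
    rw [← mul_one (c i), ← mul_one (d i)]
    exact this
  · refine ⟨fun i ↦ (p i).app V m, ?_⟩
    have h1 := happ V Finset.univ m
    rw [hsum] at h1
    refine Eq.trans ?_ h1.symm
    refine Finset.sum_congr rfl fun i _ ↦ ?_
    exact ((inj i).app_smul (show Γ(Y, V) from (p i).app V m) (one V)).symm.trans
      (congrArg ((inj i).app V) (hone V ((p i).app V m)).symm)

/-- Passes from generating sections of `M` over `W`, which live on a slice site, to a morphism of
modules on a scheme. The transport preserves colimits, hence free modules and epimorphisms. -/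
lemma exists_epi_free_restrict (M : X.Modules) (W : X.Opens)
    (G : SheafOfModules.GeneratingSections ((SheafOfModules.overFunctor X.ringCatSheaf W).obj M))
    (u : Y ⟶ (W : Scheme.{u})) [IsOpenImmersion u] :
    ∃ π : (SheafOfModules.free G.I : Y.Modules) ⟶ M.restrict (u ≫ W.ι),
      Epi π ∧ (IsIso G.π → IsIso π) := by
  let F := (Scheme.Modules.overEquiv W).functor ⋙ Scheme.Modules.restrictFunctor u
  let iso : SheafOfModules.overFunctor X.ringCatSheaf _ ⋙ F ≅
      Scheme.Modules.restrictFunctor (u ≫ W.ι) :=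
    (Functor.associator _ _ _).symm ≪≫
      Functor.isoWhiskerRight (Scheme.Modules.overFunctorEquiv _) _ ≪≫
      (Scheme.Modules.restrictFunctorComp _ _).symm
  have hu : PreservesColimitsOfSize.{u, u} (Scheme.Modules.restrictFunctor u) := inferInstance
  have hF : PreservesColimitsOfSize.{u, u} F := inferInstance
  have hF0 : PreservesColimitsOfSize.{0, 0} F := preservesColimitsOfSize_shrink.{0, u, 0, u} F
  let F' : SheafOfModules.{u} (X.ringCatSheaf.over W) ⥤ SheafOfModules.{u} Y.ringCatSheaf := F
  have hF' : PreservesColimitsOfSize.{u, u} F' := hF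
  let η : SheafOfModules.unit Y.ringCatSheaf ≅ F'.obj (SheafOfModules.unit _) :=
    (Scheme.Modules.restrictUnitIso u).symm
  let a : (SheafOfModules.free G.I : Y.Modules) ≅ F.obj (SheafOfModules.free G.I) :=
    SheafOfModules.mapFreeIso F' G.I η
  have h₁ : ∀ {P Q R S : Y.Modules} (a : P ⟶ Q) (b : Q ⟶ R) (c : R ⟶ S),
      IsIso a → Epi b → IsIso c → Epi (a ≫ b ≫ c) := fun a b c _ _ _ ↦ inferInstance
  have h₂ : ∀ {P Q R S : Y.Modules} (a : P ⟶ Q) (b : Q ⟶ R) (c : R ⟶ S),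
      IsIso a → IsIso b → IsIso c → IsIso (a ≫ b ≫ c) := fun a b c _ _ _ ↦ inferInstance
  refine ⟨a.hom ≫ F.map G.π ≫ (iso.app M).hom, ?_, fun h ↦ ?_⟩
  · exact h₁ _ _ _ (Iso.isIso_hom a) inferInstance (Iso.isIso_hom (iso.app M))
  · exact h₂ _ _ _ (Iso.isIso_hom a) inferInstance (Iso.isIso_hom (iso.app M))

end LocalFrames

end RationalAngle

namespace RationalAngle

section LocalFrames

variable {X Y : Scheme.{0}}

/-- Through the full and faithful functor `tilde`, the epimorphism becomes a surjection from a
finitely generated module onto a free one. -/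
lemma finite_of_epi_free {A : CommRingCat.{0}} [Nontrivial A] {I J : Type} [Finite I]
    (f : (SheafOfModules.free I : (Spec A).Modules) ⟶ SheafOfModules.free J) (hf : Epi f) :
    Finite J := by
  let g : (tilde.functor A).obj (ModuleCat.of A (I →₀ A)) ⟶
      (tilde.functor A).obj (ModuleCat.of A (J →₀ A)) :=
    (tildeFinsupp I).hom ≫ f ≫ (tildeFinsupp J).inv
  have key : ∀ {P Q R S : (Spec A).Modules} (a : P ⟶ Q) (b : Q ⟶ R) (c : R ⟶ S),
      IsIso a → Epi b → IsIso c → Epi (a ≫ b ≫ c) := fun a b c _ _ _ ↦ inferInstance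
  have hg : Epi g := key _ _ _ (Iso.isIso_hom _) hf (Iso.isIso_inv _)
  obtain ⟨h, hh⟩ := (tilde.functor A).map_surjective g
  rw [← hh] at hg
  have := (tilde.functor A).epi_of_epi_map hg
  rw [ModuleCat.epi_iff_surjective] at this
  have : Module.Finite A (J →₀ A) := Module.Finite.of_surjective h.hom this
  exact Module.Finite.finite_basis (R := A) (M := J →₀ A) (ι := J) Finsupp.basisSingleOne

/-- Local freeness alone permits infinite index sets. On a small affine open subset the finite
generating family maps onto the free module, which makes the index set finite. -/
lemma exists_isFrame_of_isLocallyFree (E : X.Modules) (hE : SheafOfModules.IsLocallyFree E)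
    (hE' : SheafOfModules.IsFiniteType E) (x : X) :
    ∃ U : X.Opens, x ∈ U ∧ ∃ (n : ℕ) (s : Fin n → Γ(E, U)), IsFrame s := by
  obtain ⟨q, hq⟩ := hE.exists_isLocallyFreeData
  obtain ⟨q', hq'⟩ := hE'.exists_localGeneratorsData
  have hc := (Opens.coversTop_iff _ _).mp q.coversTop
  have hc' := (Opens.coversTop_iff _ _).mp q'.coversTop
  obtain ⟨i, hi⟩ := hc.exists_mem x
  obtain ⟨i', hi'⟩ := hc'.exists_mem x
  obtain ⟨W, hW, G, hG⟩ : ∃ W : X.Opens, x ∈ W ∧ ∃ G : SheafOfModules.GeneratingSections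
      ((SheafOfModules.overFunctor X.ringCatSheaf W).obj E), IsIso G.π :=
    ⟨q.X i, hi, q.generators i, hq.isIso i⟩
  obtain ⟨W', hW', G', hG'⟩ : ∃ W : X.Opens, x ∈ W ∧ ∃ G : SheafOfModules.GeneratingSections
      ((SheafOfModules.overFunctor X.ringCatSheaf W).obj E), Finite G.I :=
    ⟨q'.X i', hi', q'.generators i', (hq'.isFiniteType i').finite⟩
  obtain ⟨V, hV, hxV, hVle⟩ := X.isBasis_affineOpens.exists_subset_of_mem_open
    (show x ∈ ((W ⊓ W' : X.Opens) : Set X) from ⟨hW, hW'⟩) (W ⊓ W').isOpen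
  obtain ⟨V, hV, rfl⟩ := hV
  replace hV : IsAffineOpen V := hV
  replace hVle : V ≤ W ⊓ W' := hVle
  let j := hV.fromSpec
  let u : Spec Γ(X, V) ⟶ (W : Scheme.{0}) := IsOpenImmersion.lift W.ι j (by
    simpa [j] using hVle.trans inf_le_left)
  let u' : Spec Γ(X, V) ⟶ (W' : Scheme.{0}) := IsOpenImmersion.lift W'.ι j (by
    simpa [j] using hVle.trans inf_le_right)
  have hu : u ≫ W.ι = j := IsOpenImmersion.lift_fac _ _ _
  have hu' : u' ≫ W'.ι = j := IsOpenImmersion.lift_fac _ _ _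
  have : IsOpenImmersion u := inferInstance
  have : IsOpenImmersion u' := inferInstance
  obtain ⟨π, -, hπ⟩ := exists_epi_free_restrict E W G u
  obtain ⟨π', hπ', -⟩ := exists_epi_free_restrict E W' G' u'
  have hπi : IsIso π := hπ hG
  have : Nontrivial Γ(X, V) := by
    have : Nonempty V := ⟨⟨x, hxV⟩⟩
    infer_instance
  let c := (Scheme.Modules.restrictFunctorCongr (hu'.trans hu.symm)).app E
  have key : ∀ {P Q R S : (Spec Γ(X, V)).Modules} (a : P ⟶ Q) (b : Q ⟶ R) (c : S ≅ R),
      Epi a → IsIso b → Epi (a ≫ b ≫ c.inv) := fun a b c _ _ ↦ inferInstance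
  let e := @asIso _ _ _ _ π hπi
  have := finite_of_epi_free _ (key π' c.hom e hπ' (Iso.isIso_hom _))
  have := Fintype.ofFinite G.I
  obtain ⟨s, hs⟩ := exists_isFrame_free (Y := Spec Γ(X, V)) G.I
  have hs' := (isFrame_restrictAppIso_iff _ E _).mpr
    ((hs.of_iso e).reindex (Fintype.equivFin _).symm)
  refine ⟨_, ?_, _, _, hs'⟩
  have h1 : x ∈ Set.range (u ≫ W.ι) := by
    rw [hu]
    simpa [j] using hxV
  obtain ⟨y, hy⟩ := h1
  exact ⟨y, trivial, hy⟩

/-- The module of global sections is finite and torsion-free, both being local properties visible on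
the frames, hence free over a principal ideal domain; quasi-coherence makes the sheaf the one
associated with this module. -/
lemma exists_isFrame_of_isPrincipalIdealRing {A : CommRingCat.{0}} [IsDomain A]
    [IsPrincipalIdealRing A] (N : (Spec A).Modules) [SheafOfModules.IsQuasicoherent N]
    (h : ∀ x : Spec A, ∃ U : (Spec A).Opens, x ∈ U ∧ ∃ (n : ℕ) (s : Fin n → Γ(N, U)), IsFrame s) :
    ∃ (n : ℕ) (s : Fin n → Γ(N, ⊤)), IsFrame s := by
  choose U hxU n s hs using h
  obtain ⟨D, hD⟩ : ∃ D : A → (Spec A).Opens, ∀ f, D f = PrimeSpectrum.basicOpen f := ⟨_, fun _ ↦ rfl⟩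
  have hloc : ∀ f, IsLocalization.Away f Γ(Spec A, D f) := by
    intro f
    generalize hV : D f = V
    rw [hD] at hV
    subst hV
    infer_instance
  have hiso : IsIso N.fromTildeΓ := inferInstance
  have hlocN := (isIso_fromTildeΓ_iff_isLocalizing N).mp hiso
  let res : ∀ V : (Spec A).Opens, Γ(N, ⊤) →ₗ[A] Γ(N, V) := fun V ↦
    ((modulesSpecToSheaf.obj N).obj.map V.leTop.op).hom
  have hres : ∀ V x, res V x = secRes N le_top x := fun V x ↦ rfl
  have hlocN' : ∀ f, IsLocalizedModule.Away f (res (D f)) := by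
    intro f
    rw [hD]
    exact hlocN f
  have hbas : ∀ x : Spec A, ∃ f : A, x ∈ D f ∧ D f ≤ U x := by
    intro x
    obtain ⟨_, ⟨_, ⟨f, rfl⟩, rfl⟩, h1, h2⟩ :=
      PrimeSpectrum.isBasis_basic_opens.exists_subset_of_mem_open (hxU x) (U x).isOpen
    refine ⟨f, ?_, ?_⟩
    · rw [hD]
      exact h1
    · rw [hD]
      exact h2
  choose f hxf hfU using hbas
  have hspan : Ideal.span (Set.range f) = ⊤ := by
    rw [← PrimeSpectrum.iSup_basicOpen_eq_top_iff, eq_top_iff]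
    intro x _
    refine TopologicalSpace.Opens.mem_iSup.mpr ⟨x, ?_⟩
    have := hxf x
    rw [hD] at this
    exact this
  have hfin : Module.Finite A Γ(N, ⊤) := by
    refine Module.Finite.of_localizationSpan' (Set.range f) hspan (Mₚ := fun g ↦ Γ(N, D g))
      (Rₚ := fun g ↦ Γ(Spec A, D g)) (fun g ↦ res (D g)) ?_
    rintro ⟨_, x, rfl⟩
    refine Module.Finite.of_surjective (Fintype.linearCombination Γ(Spec A, D (f x))
      fun i ↦ secRes N (hfU x) (s x i)) ?_
    exact (hs x _ (hfU x)).2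
  have htf : Module.IsTorsionFree A Γ(N, ⊤) := by
    refine ⟨fun a ha m m' hm ↦ ?_⟩
    refine sec_ext U (fun x _ ↦ TopologicalSpace.Opens.mem_iSup.mpr ⟨x, hxU x⟩)
      (fun _ ↦ le_top) fun x ↦ ?_
    obtain ⟨c, hc⟩ := (hs x).exists_eq le_rfl (secRes N le_top m)
    obtain ⟨c', hc'⟩ := (hs x).exists_eq le_rfl (secRes N le_top m')
    have : Nonempty (U x) := ⟨⟨x, hxU x⟩⟩
    let a' : Γ(Spec A, U x) := funRes (Spec A) le_top ((Scheme.ΓSpecIso A).inv a)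
    have ha' : a' ≠ 0 := by
      intro h0
      have h1 := (map_eq_zero_iff _ (map_injective_of_isIntegral (Spec A)
        (homOfLE (le_top : U x ≤ ⊤)))).mp h0
      have h2 := (map_eq_zero_iff _ (ConcreteCategory.bijective_of_isIso
        (Scheme.ΓSpecIso A).inv).1).mp h1
      exact ha.ne_zero h2
    have h3 : a' • secRes N (le_top : U x ≤ ⊤) m = a' • secRes N (le_top : U x ≤ ⊤) m' := by
      rw [← secRes_smul, ← secRes_smul]
      exact congrArg _ hm
    rw [hc, hc', Finset.smul_sum, Finset.smul_sum] at h3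
    simp only [smul_smul] at h3
    rw [hc, hc']
    refine Finset.sum_congr rfl fun i _ ↦ ?_
    rw [mul_left_cancel₀ ha' (congrFun ((hs x).unique le_rfl h3) i)]
  have : Module.Free A Γ(N, ⊤) := Module.free_of_finite_type_torsion_free'
  let b := Module.Free.chooseBasis A Γ(N, ⊤)
  let ι := Module.Free.ChooseBasisIndex A Γ(N, ⊤)
  let e : ModuleCat.of A Γ(N, ⊤) ≅ ModuleCat.of A (ι →₀ A) := b.repr.toModuleIso
  let e' : tilde (ModuleCat.of A Γ(N, ⊤)) ≅ N := @asIso _ _ _ _ N.fromTildeΓ hiso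
  let e'' : (SheafOfModules.free ι : (Spec A).Modules) ≅ tilde (ModuleCat.of A (ι →₀ A)) :=
    (tildeFinsupp ι).symm
  obtain ⟨t, ht⟩ := exists_isFrame_free (Y := Spec A) ι
  exact ⟨_, _, (ht.of_iso (e'' ≪≫ (tilde.functor A).mapIso e.symm ≪≫ e')).reindex
    (Fintype.equivFin _).symm⟩

end LocalFrames

end RationalAngle

namespace RationalAngle

/-! ### Coordinates on a rational function field. -/

section Coordinate

open Polynomial

variable {k K : Type*} [Field k] [Field K] [Algebra k K]

/-- Here `K` is generated by `x` as a field, `A = k[x⁻¹]`, and `hlocal` says that nonunits of `O`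
are closed under addition. The point is that `c + x * g` is a unit of `O` whenever `c ≠ 0`; so every
nonzero rational function is a power of `x` times a unit with a definite value. -/
lemma IsCoordinate.of_polynomial {O A : Subalgebra k K} {x : K} (hx : x ∈ O) (hx' : x⁻¹ ∉ O)
    (hlocal : ∀ f ∈ O, ∀ g ∈ O, f⁻¹ ∉ O → g⁻¹ ∉ O → f + g ≠ 0 → (f + g)⁻¹ ∉ O)
    (hK : ∀ f : K, ∃ p q : k[X], aeval x q ≠ 0 ∧ f = aeval x p / aeval x q)
    (hA : ∀ f, f ∈ A ↔ ∃ p : k[X], f = aeval x⁻¹ p) : IsCoordinate O A x := by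
  have hx0 : x ≠ 0 := by
    rintro rfl
    simp at hx'
  have hk : ∀ c : k, algebraMap k K c ∈ O := fun c ↦ O.algebraMap_mem c
  have hmem : ∀ p : k[X], aeval x p ∈ O := fun p ↦
    Algebra.adjoin_le (by simpa using hx) (aeval_mem_adjoin_singleton k x)
  have hunit : ∀ (c : k) (g : K), c ≠ 0 → g ∈ O →
      algebraMap k K c + x * g ≠ 0 ∧ (algebraMap k K c + x * g)⁻¹ ∈ O := by
    intro c g hc hg
    have hc' : algebraMap k K c ≠ 0 := by simpa using hc
    have hcO : (algebraMap k K c)⁻¹ ∈ O := by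
      rw [← map_inv₀]
      exact hk _
    -- Being a nonunit is expressed by `f⁻¹ ∉ O`, which misses `f = 0` because `0⁻¹ = 0`; this case
    -- is treated apart.
    rcases eq_or_ne g 0 with rfl | hg0
    · simpa using ⟨hc, hcO⟩
    have hxg : (-(x * g))⁻¹ ∉ O := by
      intro h
      refine hx' ?_
      have : x⁻¹ = -(g * (-(x * g))⁻¹) := by
        field_simp
      rw [this]
      exact O.neg_mem (O.mul_mem hg h)
    refine ⟨fun h0 ↦ hx' ?_, ?_⟩
    · have h1 : algebraMap k K c = -(x * g) := eq_neg_of_add_eq_zero_left h0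
      rw [h1] at hcO
      exact absurd hcO hxg
    · by_contra h
      refine hlocal _ (O.add_mem (hk c) (O.mul_mem hx hg)) _ (O.neg_mem (O.mul_mem hx hg)) h hxg
        (by simpa using hc) ?_
      simpa using hcO
  have hcoeff : ∀ p : k[X], aeval x p = algebraMap k K (p.coeff 0) + x * aeval x p.divX := by
    intro p
    conv_lhs => rw [← p.X_mul_divX_add]
    rw [map_add, map_mul, aeval_X, aeval_C, add_comm]
  have hpoly : ∀ p : k[X], p ≠ 0 → ∃ (m : ℕ) (c : k) (g : K), c ≠ 0 ∧ g ∈ O ∧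
      aeval x p = x ^ m * (algebraMap k K c + x * g) := by
    intro p hp
    obtain ⟨q, hq, hdvd⟩ := exists_eq_pow_rootMultiplicity_mul_and_not_dvd p hp 0
    simp only [map_zero, sub_zero] at hq hdvd
    refine ⟨rootMultiplicity 0 p, q.coeff 0, aeval x q.divX, fun h ↦ hdvd (X_dvd_iff.mpr h), hmem _, ?_⟩
    conv_lhs => rw [hq]
    rw [map_mul, map_pow, aeval_X, hcoeff]
  have hfac : ∀ f : K, f ≠ 0 → ∃ (m : ℤ) (c : k) (u : K), f = x ^ m * u ∧ u ∈ O ∧ u⁻¹ ∈ O ∧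
      x⁻¹ * (u - algebraMap k K c) ∈ O := by
    intro f hf
    obtain ⟨p, q, hq, rfl⟩ := hK f
    have hp : p ≠ 0 := by
      rintro rfl
      simp at hf
    have hq0 : q ≠ 0 := by
      rintro rfl
      simp at hq
    obtain ⟨m₁, c₁, g₁, hc₁, hg₁, h₁⟩ := hpoly p hp
    obtain ⟨m₂, c₂, g₂, hc₂, hg₂, h₂⟩ := hpoly q hq0
    obtain ⟨hu₁, hu₁'⟩ := hunit c₁ g₁ hc₁ hg₁
    obtain ⟨hu₂, hu₂'⟩ := hunit c₂ g₂ hc₂ hg₂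
    have hm : ∀ {c g}, g ∈ O → algebraMap k K c + x * g ∈ O := fun hg ↦
      O.add_mem (hk _) (O.mul_mem hx hg)
    have hc₂' : algebraMap k K c₂ ≠ 0 := by simpa using hc₂
    refine ⟨m₁ - m₂, c₁ / c₂, (algebraMap k K c₁ + x * g₁) / (algebraMap k K c₂ + x * g₂),
      ?_, ?_, ?_, ?_⟩
    · rw [h₁, h₂, zpow_sub₀ hx0, zpow_natCast, zpow_natCast]
      field_simp
    · rw [div_eq_mul_inv]
      exact O.mul_mem (hm hg₁) hu₂'
    · rw [inv_div, div_eq_mul_inv]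
      exact O.mul_mem (hm hg₂) hu₁'
    · have : x⁻¹ * ((algebraMap k K c₁ + x * g₁) / (algebraMap k K c₂ + x * g₂) -
          algebraMap k K (c₁ / c₂)) = (g₁ - algebraMap k K (c₁ / c₂) * g₂) *
          (algebraMap k K c₂ + x * g₂)⁻¹ := by
        rw [map_div₀]
        field_simp
        ring
      rw [this]
      exact O.mul_mem (O.sub_mem hg₁ (O.mul_mem (hk _) hg₂)) hu₂'
  have hneg : ∀ (m : ℤ) (u : K), u⁻¹ ∈ O → u ≠ 0 → x ^ m * u ∈ O → 0 ≤ m := by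
    intro m u hu hu0 h
    by_contra hm
    push Not at hm
    obtain ⟨n, hn⟩ := Int.eq_ofNat_of_zero_le (show 0 ≤ -m - 1 by omega)
    refine hx' ?_
    have : x⁻¹ = x ^ n * (x ^ m * u) * u⁻¹ := by
      rw [← mul_assoc, mul_inv_cancel_right₀ hu0, ← zpow_natCast, ← zpow_add₀ hx0, ← hn,
        show -m - 1 + m = (-1 : ℤ) by ring, zpow_neg_one]
    rw [this]
    exact O.mul_mem (O.mul_mem (O.pow_mem hx n) h) hu
  refine ⟨hx, hx0, (hA _).mpr ⟨X, by simp⟩, fun f hf ↦ ?_, fun f hf ↦ ?_, fun f hf h ↦ ?_⟩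
  · rcases eq_or_ne f 0 with rfl | hf0
    · exact ⟨0, by simp⟩
    obtain ⟨m, c, u, rfl, hu, hu', hc⟩ := hfac f hf0
    have hu0 : u ≠ 0 := right_ne_zero_of_mul hf0
    rcases (hneg m u hu' hu0 hf).eq_or_lt with rfl | hm
    · exact ⟨c, by simpa using hc⟩
    · refine ⟨0, ?_⟩
      obtain ⟨n, hn⟩ := Int.eq_ofNat_of_zero_le (show 0 ≤ m - 1 by omega)
      have : x⁻¹ * (x ^ m * u - algebraMap k K 0) = x ^ n * u := by
        rw [map_zero, sub_zero, ← mul_assoc, ← zpow_neg_one, ← zpow_add₀ hx0, ← zpow_natCast, ← hn,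
          show -1 + m = m - 1 by ring]
      rw [this]
      exact O.mul_mem (O.pow_mem hx n) hu
  · obtain ⟨m, c, u, rfl, hu, hu', hc⟩ := hfac f hf
    have hxm : x ^ m ≠ 0 := zpow_ne_zero _ hx0
    refine ⟨m, ?_, ?_⟩
    · rw [zpow_neg, mul_comm, inv_mul_cancel_left₀ hxm]
      exact hu
    · rw [mul_inv, mul_right_comm, inv_mul_cancel₀ hxm, one_mul]
      exact hu'
  · obtain ⟨p, rfl⟩ := (hA f).mp hf
    by_contra hp
    have hp0 : p ≠ 0 := by
      rintro rfl
      simp at hp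
    -- Clearing the pole turns `p(x⁻¹)` into the reversed polynomial in `x`, a unit at the point
    -- since its constant term is the leading coefficient of `p`. So a nonzero element of `A` cannot
    -- vanish there.
    have hrev : aeval x⁻¹ p * x ^ p.natDegree = aeval x p.reverse := by
      let := invertibleOfNonzero (inv_ne_zero hx0)
      have := eval₂_reverse_mul_pow (algebraMap k K) x⁻¹ p
      rw [invOf_eq_inv, inv_inv] at this
      rw [aeval_def, aeval_def, ← this, mul_assoc, ← mul_pow, inv_mul_cancel₀ hx0, one_pow, mul_one]
    rw [hcoeff, coeff_zero_reverse] at hrev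
    obtain ⟨hv, hv'⟩ := hunit p.leadingCoeff _ (leadingCoeff_ne_zero.mpr hp0) (hmem p.reverse.divX)
    rw [← hrev] at hv hv'
    refine hx' ?_
    have : x⁻¹ = x ^ p.natDegree * (x⁻¹ * aeval x⁻¹ p) * (aeval x⁻¹ p * x ^ p.natDegree)⁻¹ := by
      generalize aeval x⁻¹ p = w at hp
      field_simp
    rw [this]
    exact O.mul_mem (O.mul_mem (O.pow_mem hx _) h) hv'

end Coordinate

end RationalAngle

namespace RationalAngle

/-! ### The projective line: standard charts and closed points. -/

section ProjectiveLine

open MvPolynomial HomogeneousLocalization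

/-- The grading of `ℂ[X₀, X₁]` by degree. -/
abbrev forms : ℕ → Submodule ℂ (MvPolynomial (Fin 2) ℂ) := homogeneousSubmodule (Fin 2) ℂ

lemma eval₂_mul_of_isHomogeneous {σ k R : Type*} [CommRing k] [CommRing R] {F : MvPolynomial σ k}
    {n : ℕ} (hF : F.IsHomogeneous n) (φ : k →+* R) (r : R) (v : σ → R) :
    eval₂ φ (fun i ↦ r * v i) F = r ^ n * eval₂ φ v F := by
  rw [eval₂_eq, eval₂_eq, Finset.mul_sum]
  refine Finset.sum_congr rfl fun d hd ↦ ?_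
  have hdeg : ∑ i ∈ d.support, d i = n := by
    have := hF (mem_support_iff.mp hd)
    rw [Finsupp.weight_apply, Finsupp.sum] at this
    simpa using this
  simp only [mul_pow]
  rw [Finset.prod_mul_distrib, Finset.prod_pow_eq_pow_sum, hdeg]
  ring

lemma algebraMap_mul_mk {R : Type*} [CommRing R] {M : Submonoid R} (a d : R) (hd : d ∈ M) :
    algebraMap R (Localization M) d * Localization.mk a ⟨d, hd⟩ =
      algebraMap R (Localization M) a := by
  rw [Localization.mk_eq_mk']
  exact IsLocalization.mk'_spec' (Localization M) a ⟨d, hd⟩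

/-- The constants in the degree zero part of a localization of `ℂ[X₀, X₁]`. -/
def constAway (l : MvPolynomial (Fin 2) ℂ) : ℂ →+* Away forms l :=
  (fromZeroRingHom forms _).comp (algebraMap ℂ (forms 0))

lemma val_constAway (l : MvPolynomial (Fin 2) ℂ) (c : ℂ) :
    (constAway l c).val = algebraMap (MvPolynomial (Fin 2) ℂ) (Localization.Away l) (C c) :=
  Localization.mk_one_eq_algebraMap (C c)

/-- The fraction `m / l` of two linear forms. -/
def fracAway {l m : MvPolynomial (Fin 2) ℂ} (hl : l ∈ forms 1) (hm : m ∈ forms 1) :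
    Away forms l :=
  Away.mk forms hl 1 m (by simpa using hm)

lemma algebraMap_mul_val_fracAway {l m : MvPolynomial (Fin 2) ℂ} (hl : l ∈ forms 1)
    (hm : m ∈ forms 1) : algebraMap _ (Localization.Away l) l * (fracAway hl hm).val =
      algebraMap (MvPolynomial (Fin 2) ℂ) (Localization.Away l) m := by
  have : algebraMap _ (Localization.Away l) l = algebraMap _ (Localization.Away l) (l ^ 1) := by
    rw [pow_one]
  rw [fracAway, Away.val_mk, this]
  exact algebraMap_mul_mk _ _ _

/-- Dividing `X i = a i * l + b i * m` by `l` and using homogeneity, `F / l ^ n` equals `F(a + b t)`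
with `t = m / l`. -/
lemma exists_polynomial_away {l m : MvPolynomial (Fin 2) ℂ} (hl : l ∈ forms 1) (hm : m ∈ forms 1)
    {a b : Fin 2 → ℂ} (h : ∀ i, X i = C (a i) * l + C (b i) * m) (z : Away forms l) :
    ∃ p : Polynomial ℂ, z = p.eval₂ (constAway l) (fracAway hl hm) := by
  obtain ⟨n, F, hF, rfl⟩ := Away.mk_surjective forms hl z
  refine ⟨eval₂ Polynomial.C (fun i ↦ Polynomial.C (a i) + Polynomial.C (b i) * Polynomial.X) F, ?_⟩
  apply (HomogeneousLocalization.val_injective _ : Function.Injective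
    (HomogeneousLocalization.val (𝒜 := forms) (x := Submonoid.powers l)))
  have hF' : F.IsHomogeneous n := by simpa using hF
  let ι : Away forms l →+* Localization.Away l := algebraMap _ _
  let j : MvPolynomial (Fin 2) ℂ →+* Localization.Away l := algebraMap _ _
  have hι : ∀ w, ι w = w.val := fun w ↦ rfl
  have ht : j l * ι (fracAway hl hm) = j m := algebraMap_mul_val_fracAway hl hm
  rw [← hι, ← hι, Polynomial.hom_eval₂]
  have h1 : Polynomial.eval₂ (ι.comp (constAway l)) (ι (fracAway hl hm)) (eval₂ Polynomial.C
      (fun i ↦ Polynomial.C (a i) + Polynomial.C (b i) * Polynomial.X) F) =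
      eval₂ (ι.comp (constAway l)) (fun i ↦ ι (constAway l (a i)) +
        ι (constAway l (b i)) * ι (fracAway hl hm)) F := by
    rw [← Polynomial.coe_eval₂RingHom, ← MvPolynomial.coe_eval₂Hom, ← RingHom.comp_apply,
      ← MvPolynomial.coe_eval₂Hom]
    congr 1
    ext i <;> simp
  have h2 : IsUnit (j l ^ n) := (IsLocalization.Away.algebraMap_isUnit l).pow n
  rw [h1]
  refine h2.mul_left_cancel ?_
  rw [← eval₂_mul_of_isHomogeneous hF']
  have h3 : (fun i ↦ j l * (ι (constAway l (a i)) + ι (constAway l (b i)) * ι (fracAway hl hm))) =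
      fun i ↦ j (X i) := by
    funext i
    rw [h i, mul_add, mul_left_comm, ht, hι, hι, val_constAway, val_constAway]
    simp only [j, map_add, map_mul]
    ring
  rw [h3]
  have h4 : eval₂ (ι.comp (constAway l)) (fun i ↦ j (X i)) F = j F := by
    have : ι.comp (constAway l) = j.comp C := by
      ext c
      exact val_constAway l c
    rw [this, ← MvPolynomial.coe_eval₂Hom]
    congr 1
    ext i <;> simp
  rw [h4, hι, Away.val_mk, ← map_pow]
  exact algebraMap_mul_mk _ _ _

/-- The complement of the zero of the linear form `l` on the projective line. -/
def lineOpen (l : MvPolynomial (Fin 2) ℂ) : P1.Opens := Proj.basicOpen forms l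

/-- The section of the structure sheaf defined by a fraction. -/
def lineSec (l : MvPolynomial (Fin 2) ℂ) : Away forms l →+* Γ(P1, lineOpen l) :=
  (Proj.awayToSection forms l).hom

lemma lineSec_bijective {l : MvPolynomial (Fin 2) ℂ} (hl : l ∈ forms 1) :
    Function.Bijective (lineSec l) := by
  have := ConcreteCategory.bijective_of_isIso (Proj.basicOpenIsoAway forms l hl one_pos).hom
  rw [Proj.basicOpenIsoAway_hom] at this
  exact this

lemma isAffineOpen_lineOpen {l : MvPolynomial (Fin 2) ℂ} (hl : l ∈ forms 1) :
    IsAffineOpen (lineOpen l) :=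
  Proj.isAffineOpen_basicOpen forms l hl one_pos

/-- The germ of the fraction `m / l` is invertible where both forms do not vanish. -/
lemma germ_fracAway_mul {l m : MvPolynomial (Fin 2) ℂ} (hl : l ∈ forms 1) (hm : m ∈ forms 1)
    {y : P1} (hyl : y ∈ lineOpen l) (hym : y ∈ lineOpen m) :
    P1.presheaf.germ _ y hyl (lineSec l (fracAway hl hm)) *
      P1.presheaf.germ _ y hym (lineSec m (fracAway hm hl)) = 1 := by
  let y' : ProjectiveSpectrum forms := y
  let e : AtPrime forms y'.asHomogeneousIdeal.toIdeal →+* P1.presheaf.stalk y :=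
    (Proj.stalkIso' forms y').symm.toRingHom
  have key : ∀ (l : MvPolynomial (Fin 2) ℂ) (hyl : y ∈ lineOpen l) (z : Away forms l),
      P1.presheaf.germ _ y hyl (lineSec l z) =
        e (HomogeneousLocalization.mapId forms (Submonoid.powers_le.mpr hyl) z) := fun l hyl z ↦
    ConcreteCategory.congr_hom (ProjectiveSpectrum.Proj.awayToSection_germ forms l y hyl) z
  rw [key, key, ← map_mul]
  convert map_one e
  apply HomogeneousLocalization.val_injective
  simp only [fracAway, Away.mk, HomogeneousLocalization.mapId, HomogeneousLocalization.val_mul,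
    HomogeneousLocalization.val_one]
  refine (Localization.mk_eq_mk_iff.mpr ?_).trans Localization.mk_one
  rw [Localization.r_iff_exists]
  refine ⟨1, ?_⟩
  simp

/-- The constant functions on a scheme over `ℂ`. -/
def scalars {X : Scheme.{0}} (s : X ⟶ Spec (.of ℂ)) (U : X.Opens) : ℂ →+* Γ(X, U) :=
  (funRes X le_top).comp ((Scheme.ΓSpecIso (.of ℂ)).inv ≫ s.appTop).hom

lemma funRes_scalars {X : Scheme.{0}} (s : X ⟶ Spec (.of ℂ)) {U V : X.Opens} (h : V ≤ U) (c : ℂ) :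
    funRes X h (scalars s U c) = scalars s V c :=
  funRes_funRes _ _ _

lemma germ_scalars {X : Scheme.{0}} (s : X ⟶ Spec (.of ℂ)) {U : X.Opens} {x : X} (hx : x ∈ U)
    (c : ℂ) : X.presheaf.germ U x hx (scalars s U c) =
      X.presheaf.germ ⊤ x trivial (scalars s ⊤ c) := by
  rw [← funRes_scalars s (le_top : U ≤ ⊤)]
  exact TopCat.Presheaf.germ_res_apply X.presheaf _ x hx _

/-- Reconciles the constants pulled back from `Spec ℂ` with those of the graded ring. -/
lemma scalars_lineOpen {l : MvPolynomial (Fin 2) ℂ} (hl : l ∈ forms 1) :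
    scalars P1.toSpec (lineOpen l) = (lineSec l).comp (constAway l) := by
  let φ : CommRingCat.of ℂ ⟶ Γ(P1, lineOpen l) :=
    CommRingCat.ofHom (constAway l) ≫ Proj.awayToSection forms l
  have h : (lineOpen l).ι ≫ P1.toSpec = (lineOpen l).toSpecΓ ≫ Spec.map φ := by
    have h1 := Proj.awayι_toSpecZero forms l hl one_pos
    rw [Proj.awayι, Category.assoc, Iso.inv_comp_eq, Proj.basicOpenIsoSpec_hom] at h1
    have h2 := congrArg (· ≫ Spec.map (CommRingCat.ofHom (algebraMap ℂ (forms 0)))) h1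
    simp only [Category.assoc, Proj.basicOpenToSpec, ← Spec.map_comp] at h2
    exact h2
  have h2 := congrArg Scheme.Hom.appTop h
  rw [Scheme.Hom.comp_appTop, Scheme.Hom.comp_appTop, Scheme.Opens.toSpecΓ_appTop,
    Scheme.ΓSpecIso_naturality_assoc, ← Iso.inv_comp_eq, Iso.eq_comp_inv, Category.assoc, Category.assoc] at h2
  have h3 : (lineOpen l).ι.appTop ≫ (lineOpen l).topIso.hom =
      P1.presheaf.map (homOfLE (le_top : lineOpen l ≤ ⊤)).op := (P1.presheaf.map_comp _ _).symm
  rw [h3] at h2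
  exact congrArg CommRingCat.Hom.hom h2

end ProjectiveLine

end RationalAngle

namespace RationalAngle

section ProjectiveLine

open MvPolynomial HomogeneousLocalization

lemma X_mem_forms (i : Fin 2) : (X i : MvPolynomial (Fin 2) ℂ) ∈ forms 1 :=
  isHomogeneous_X ℂ i

lemma exists_mem_lineOpen (y : P1) : ∃ i, y ∈ lineOpen (X i) := by
  have h := Proj.iSup_basicOpen_eq_top' forms (fun i : Fin 2 ↦ (X i : MvPolynomial (Fin 2) ℂ))
    (fun i ↦ ⟨1, X_mem_forms i⟩) ?_
  · exact TopologicalSpace.Opens.mem_iSup.mp (h.ge (show y ∈ (⊤ : P1.Opens) from trivial))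
  · rw [eq_top_iff]
    rintro p -
    induction p using MvPolynomial.induction_on with
    | C a => exact Subalgebra.algebraMap_mem _ (⟨C a, isHomogeneous_C _ a⟩ : forms 0)
    | add p q hp hq => exact add_mem hp hq
    | mul_X p i hp => exact mul_mem hp (Algebra.subset_adjoin ⟨i, rfl⟩)

lemma exists_forall_mem_lineOpen : ∃ η : P1, ∀ f, f ≠ 0 → η ∈ lineOpen f := by
  have hX : (X 0 : MvPolynomial (Fin 2) ℂ) ∈ HomogeneousIdeal.irrelevant forms := by
    rw [HomogeneousIdeal.mem_irrelevant_iff, GradedRing.proj_apply]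
    exact DirectSum.decompose_of_mem_ne forms (X_mem_forms 0) one_ne_zero
  let η : ProjectiveSpectrum forms := ⟨⊥, Ideal.isPrime_bot, fun h ↦ X_ne_zero 0 (h hX)⟩
  exact ⟨η, fun f hf h ↦ hf h⟩

/-- The zero ideal is a point lying in every nonempty open subset, and the stalks embed into
localizations of the domain `ℂ[X₀, X₁]`. -/
instance isIntegral_P1 : IsIntegral P1 := by
  obtain ⟨η', hη'⟩ := exists_forall_mem_lineOpen
  have hη : ∀ U : P1.Opens, ∀ y ∈ U, η' ∈ U := by
    intro U y hy
    obtain ⟨_, ⟨_, ⟨f, rfl⟩, rfl⟩, hyf, hfU⟩ :=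
      (Proj.isBasis_basicOpen forms).exists_subset_of_mem_open hy U.isOpen
    refine hfU (hη' f fun hf ↦ hyf ?_)
    rw [hf]
    exact zero_mem _
  have : IrreducibleSpace P1 := by
    have h1 : closure {η'} = Set.univ := by
      refine Set.eq_univ_of_forall fun y ↦ mem_closure_iff.mpr fun U hU hy ↦ ?_
      exact ⟨η', hη ⟨U, hU⟩ y hy, rfl⟩
    have h2 : IsIrreducible (Set.univ : Set P1) := h1 ▸ isIrreducible_singleton.closure
    exact { isPreirreducible_univ := h2.isPreirreducible, toNonempty := ⟨η'⟩ }
  have : IsReduced P1 := by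
    have : ∀ y : P1, _root_.IsReduced (P1.presheaf.stalk y) := by
      intro y
      let y' : ProjectiveSpectrum forms := y
      let e : P1.presheaf.stalk y →+* AtPrime forms y'.asHomogeneousIdeal.toIdeal :=
        (Proj.stalkIso' forms y').toRingHom
      have he : Function.Injective e := (Proj.stalkIso' forms y').injective
      have : IsDomain (Localization.AtPrime y'.asHomogeneousIdeal.toIdeal) :=
        IsLocalization.isDomain_localization (Ideal.primeCompl_le_nonZeroDivisors _)
      let ι : AtPrime forms y'.asHomogeneousIdeal.toIdeal →+*
        Localization.AtPrime y'.asHomogeneousIdeal.toIdeal := algebraMap _ _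
      have hι : Function.Injective ι := HomogeneousLocalization.val_injective _
      exact isReduced_of_injective (ι.comp e) (hι.comp he)
    exact isReduced_of_isReduced_stalk P1
  exact isIntegral_of_irreducibleSpace_of_isReduced P1

/-- At a closed point of a scheme locally of finite type over `ℂ` every germ is a constant up to
the maximal ideal. -/
lemma exists_germ_scalars_sub_mem {X : Scheme.{0}} (s : X ⟶ Spec (.of ℂ)) [LocallyOfFiniteType s]
    {q : X} (hq : IsClosed {q}) (f : X.presheaf.stalk q) :
    ∃ c : ℂ, f - X.presheaf.germ ⊤ q trivial (scalars s ⊤ c) ∈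
      IsLocalRing.maximalIdeal (X.presheaf.stalk q) := by
  have hsurj : Function.Surjective (residueFieldIsoBase s q hq).inv :=
    (ConcreteCategory.bijective_of_isIso (residueFieldIsoBase s q hq).inv).2
  obtain ⟨c, hc⟩ := hsurj (X.residue q f)
  refine ⟨c, ?_⟩
  have h1 := congrArg Scheme.Hom.appTop (SpecMap_residueFieldIsoBase_inv s q hq)
  rw [Scheme.fromSpecResidueField, Scheme.Hom.comp_appTop, Scheme.Hom.comp_appTop,
    Scheme.fromSpecStalk_appTop] at h1
  have h3 : ∀ {A B : CommRingCat.{0}} (g : A ⟶ B),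
      (Scheme.ΓSpecIso A).inv ≫ (Spec.map g).appTop ≫ (Scheme.ΓSpecIso B).hom = g := fun g ↦ by
    rw [Scheme.ΓSpecIso_naturality, Iso.inv_hom_id_assoc]
  have h2 : (residueFieldIsoBase s q hq).inv = CommRingCat.ofHom (scalars s ⊤) ≫
      X.presheaf.germ ⊤ q trivial ≫ X.residue q := by
    have h4 : CommRingCat.ofHom (scalars s ⊤) = (Scheme.ΓSpecIso (.of ℂ)).inv ≫ s.appTop := by
      have : X.presheaf.map (homOfLE (le_top : (⊤ : X.Opens) ≤ ⊤)).op = 𝟙 _ := X.presheaf.map_id _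
      change ((Scheme.ΓSpecIso (.of ℂ)).inv ≫ s.appTop) ≫ X.presheaf.map (homOfLE _).op = _
      rw [this, Category.comp_id]
    have h5 : (Spec (X.presheaf.stalk q)).presheaf.map
        (homOfLE (le_top : (⊤ : (Spec (X.presheaf.stalk q)).Opens) ≤ ⊤)).op = 𝟙 _ :=
      (Spec (X.presheaf.stalk q)).presheaf.map_id _
    rw [← h3 (residueFieldIsoBase s q hq).inv, h1, h4]
    simp only [Category.assoc]
    erw [h5]
    simp only [Category.id_comp, h3]
  rw [h2] at hc
  rw [← IsLocalRing.residue_eq_zero_iff, map_sub, sub_eq_zero]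
  exact hc.symm

/-- Modulo `l`, a form `F` of degree `n` is `F(b) * m ^ n`. A prime containing `l` but not `m`
therefore contains `F` only if `l` divides `F`; this makes the zero locus of `l` a single point. -/
lemma mem_of_mem_span {l m : MvPolynomial (Fin 2) ℂ}
    {a b : Fin 2 → ℂ} (h : ∀ i, X i = C (a i) * l + C (b i) * m)
    {𝔮 𝔮' : Ideal (MvPolynomial (Fin 2) ℂ)} (h𝔮 : 𝔮.IsPrime) (hl : l ∈ 𝔮) (hm : m ∉ 𝔮)
    (hl' : l ∈ 𝔮') {n : ℕ} {F : MvPolynomial (Fin 2) ℂ} (hF : F.IsHomogeneous n) (hF𝔮 : F ∈ 𝔮) :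
    F ∈ 𝔮' := by
  let π := Ideal.Quotient.mk (Ideal.span {l})
  have hπl : π l = 0 := Ideal.Quotient.eq_zero_iff_mem.mpr (Ideal.mem_span_singleton_self l)
  have h1 : π F = π (m ^ n * C (eval b F)) := by
    have h2 : π F = eval₂ (π.comp C) (fun i ↦ π m * π (C (b i))) F := by
      have h3 : (fun i ↦ π m * π (C (b i))) = fun i ↦ π (X i) := by
        funext i
        rw [h i, map_add, map_mul, hπl, mul_zero, zero_add, map_mul, mul_comm]
      rw [h3, ← MvPolynomial.coe_eval₂Hom, ← RingHom.comp_id π]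
      congr 1
      ext i <;> simp
    rw [h2, eval₂_mul_of_isHomogeneous hF, map_mul, map_pow, ← RingHom.comp_apply π C,
      ← eval₂_id, ← RingHom.comp_id (π.comp C), hom_eval₂]
    rfl
  have h2 : F - m ^ n * C (eval b F) ∈ Ideal.span {l} := Ideal.Quotient.eq.mp h1
  rw [Ideal.mem_span_singleton] at h2
  have h3 : m ^ n * C (eval b F) ∈ 𝔮 := by
    have := 𝔮.sub_mem hF𝔮 (𝔮.mem_of_dvd h2 hl)
    simpa using this
  have h4 : eval b F = 0 := by
    by_contra h0
    rcases h𝔮.mem_or_mem h3 with h5 | h5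
    · exact hm (h𝔮.mem_of_pow_mem n h5)
    · refine h𝔮.ne_top (Ideal.eq_top_of_isUnit_mem _ h5 ?_)
      exact (IsUnit.mk0 _ h0).map C
  rw [h4, map_zero, mul_zero, sub_zero] at h2
  exact 𝔮'.mem_of_dvd h2 hl'

lemma eq_of_notMem_lineOpen {l m : MvPolynomial (Fin 2) ℂ}
    {a b : Fin 2 → ℂ} (h : ∀ i, X i = C (a i) * l + C (b i) * m) {y z : P1}
    (hy : y ∉ lineOpen l) (hz : z ∉ lineOpen l) : y = z := by
  have hm : ∀ y : P1, y ∉ lineOpen l → m ∉ (show Proj forms from y).asHomogeneousIdeal.toIdeal := by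
    intro y hy hym
    obtain ⟨i, hi⟩ := exists_mem_lineOpen y
    refine hi ?_
    have hyl : l ∈ (show Proj forms from y).asHomogeneousIdeal.toIdeal := not_not.mp hy
    change X i ∈ (show Proj forms from y).asHomogeneousIdeal.toIdeal
    rw [h i]
    exact add_mem (Ideal.mul_mem_left _ _ hyl) (Ideal.mul_mem_left _ _ hym)
  have hle : ∀ y z : P1, y ∉ lineOpen l → z ∉ lineOpen l →
      (show Proj forms from y).asHomogeneousIdeal.toIdeal ≤
        (show Proj forms from z).asHomogeneousIdeal.toIdeal := by
    intro y z hy hz F hF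
    have h1 := DirectSum.sum_support_decompose forms F
    rw [← h1]
    refine Ideal.sum_mem _ fun i _ ↦ ?_
    exact mem_of_mem_span h (show Proj forms from y).isPrime (not_not.mp hy) (hm y hy)
      (not_not.mp hz) (SetLike.coe_mem (DirectSum.decompose forms F i))
      ((show Proj forms from y).asHomogeneousIdeal.isHomogeneous i hF)
  have := le_antisymm (hle y z hy hz) (hle z y hz hy)
  refine ProjectiveSpectrum.ext (x := (show Proj forms from y)) (y := (show Proj forms from z)) ?_
  exact HomogeneousIdeal.toIdeal_injective this

/-- In a chart `X i ≠ 0` around `q`, the other coordinate `X k / X i` has a value `c ∈ ℂ` at `q`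
because `q` is closed; take `l = X k - c * X i` and `m = X i`. -/
lemma exists_linear_forms [LocallyOfFiniteType P1.toSpec] {q : P1} (hq : IsClosed {q}) :
    ∃ (l m : MvPolynomial (Fin 2) ℂ) (hl : l ∈ forms 1) (hm : m ∈ forms 1) (a b : Fin 2 → ℂ),
      (∀ i, X i = C (a i) * l + C (b i) * m) ∧ l ≠ 0 ∧ (lineOpen l : Set P1) = {q}ᶜ ∧
      ∃ hqm : q ∈ lineOpen m, P1.presheaf.germ _ q hqm (lineSec m (fracAway hm hl)) ∈
        IsLocalRing.maximalIdeal (P1.presheaf.stalk q) := by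
  obtain ⟨i, hi⟩ := exists_mem_lineOpen q
  obtain ⟨k, hki, hk⟩ : ∃ k : Fin 2, k ≠ i ∧ ∀ j, j ≠ i → j = k := by
    fin_cases i
    · exact ⟨1, by decide, by decide⟩
    · exact ⟨0, by decide, by decide⟩
  obtain ⟨c, hc⟩ := exists_germ_scalars_sub_mem P1.toSpec hq
    (P1.presheaf.germ _ q hi (lineSec (X i) (fracAway (X_mem_forms i) (X_mem_forms k))))
  have hl : (X k - C c * X i : MvPolynomial (Fin 2) ℂ) ∈ forms 1 := by
    refine Submodule.sub_mem _ (X_mem_forms k) ?_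
    have := (forms 1).smul_mem c (X_mem_forms i)
    rwa [smul_eq_C_mul] at this
  have hl0 : (X k - C c * X i : MvPolynomial (Fin 2) ℂ) ≠ 0 := by
    intro h0
    have := congrArg (eval fun j ↦ if j = k then (1 : ℂ) else 0) h0
    simp [hki.symm] at this
  have hsub : fracAway (X_mem_forms i) hl =
      fracAway (X_mem_forms i) (X_mem_forms k) - constAway (X i) c := by
    apply HomogeneousLocalization.val_injective
    have hu := IsLocalization.Away.algebraMap_isUnit (S := Localization.Away
      (X i : MvPolynomial (Fin 2) ℂ)) (X i : MvPolynomial (Fin 2) ℂ)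
    refine hu.mul_left_cancel ?_
    rw [HomogeneousLocalization.val_sub, val_constAway, mul_sub, algebraMap_mul_val_fracAway,
      algebraMap_mul_val_fracAway, map_sub, map_mul, mul_comm (algebraMap _ _ (C c))]
  have hspan : ∀ j, (X j : MvPolynomial (Fin 2) ℂ) =
      C (if j = i then 0 else 1) * (X k - C c * X i) + C (if j = i then 1 else c) * X i := by
    intro j
    split_ifs with h
    · simp [h]
    · rw [hk j h]
      simp
  have hmem : P1.presheaf.germ _ q hi (lineSec (X i) (fracAway (X_mem_forms i) hl)) ∈
      IsLocalRing.maximalIdeal (P1.presheaf.stalk q) := by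
    rw [hsub, map_sub, map_sub]
    have h1 : lineSec (X i) (constAway (X i) c) = scalars P1.toSpec (lineOpen (X i)) c := by
      rw [scalars_lineOpen (X_mem_forms i)]
      rfl
    rw [h1]
    convert hc using 2
    exact germ_scalars _ _ _
  have hql : q ∉ lineOpen (X k - C c * X i) := by
    intro h
    have h1 := germ_fracAway_mul hl (X_mem_forms i) h hi
    exact (IsLocalRing.mem_maximalIdeal _).mp hmem (IsUnit.of_mul_eq_one_right _ h1)
  refine ⟨_, _, hl, X_mem_forms i, _, _, hspan, hl0, ?_, hi, hmem⟩
  ext y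
  refine ⟨fun hy hyq ↦ hql (Set.mem_singleton_iff.mp hyq ▸ hy), fun hy ↦ ?_⟩
  by_contra h
  exact hy (eq_of_notMem_lineOpen hspan h hql)

end ProjectiveLine

end RationalAngle

namespace RationalAngle

/-! ### The coordinate at a closed point of the projective line. -/

section ProjectiveLine

open HomogeneousLocalization

instance nonempty_top_P1 : Nonempty (⊤ : P1.Opens) := ⟨⟨genericPoint P1, trivial⟩⟩

instance algebraFunctionField : Algebra ℂ P1.functionField :=
  ((P1.germToFunctionField ⊤).hom.comp (scalars P1.toSpec ⊤)).toAlgebra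

lemma germToFunctionField_scalars (U : P1.Opens) [Nonempty U] (c : ℂ) :
    P1.germToFunctionField U (scalars P1.toSpec U c) = algebraMap ℂ P1.functionField c :=
  germ_scalars _ _ _

lemma exists_polynomial_section {l m : MvPolynomial (Fin 2) ℂ} (hl : l ∈ forms 1)
    (hm : m ∈ forms 1) {a b : Fin 2 → ℂ}
    (h : ∀ i, MvPolynomial.X i = MvPolynomial.C (a i) * l + MvPolynomial.C (b i) * m)
    (f : Γ(P1, lineOpen l)) :
    ∃ p : Polynomial ℂ, f = p.eval₂ (scalars P1.toSpec (lineOpen l))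
      (lineSec l (fracAway hl hm)) := by
  obtain ⟨z, rfl⟩ := (lineSec_bijective hl).2 f
  obtain ⟨p, hp⟩ := exists_polynomial_away hl hm h z
  refine ⟨p, ?_⟩
  rw [scalars_lineOpen hl, ← Polynomial.hom_eval₂, ← hp]

/-- The coordinate is `x = l / m`. The functions off `q` are polynomials in `m / l`, and the
function field is the fraction field of the polynomials in `l / m`. -/
lemma exists_isCoordinate [LocallyOfFiniteType P1.toSpec] {q : P1} (hq : IsClosed {q}) :
    ∃ (U : P1.Opens) (_ : Nonempty U), (U : Set P1) = {q}ᶜ ∧ IsAffineOpen U ∧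
      IsPrincipalIdealRing Γ(P1, U) ∧
      ∃ (O A : Subalgebra ℂ P1.functionField) (x : P1.functionField),
        (∀ f, f ∈ O ↔ ∃ s : P1.presheaf.stalk q, algebraMap _ P1.functionField s = f) ∧
        (∀ f, f ∈ A ↔ ∃ s : Γ(P1, U), P1.germToFunctionField U s = f) ∧ IsCoordinate O A x := by
  obtain ⟨l, m, hl, hm, a, b, h, hl0, hU, hqm, hx⟩ := exists_linear_forms hq
  have h' : ∀ i, MvPolynomial.X i = MvPolynomial.C (b i) * m + MvPolynomial.C (a i) * l :=
    fun i ↦ (h i).trans (add_comm _ _)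
  have hne : Nonempty (lineOpen l) := by
    obtain ⟨η, hη⟩ := exists_forall_mem_lineOpen
    exact ⟨⟨η, hη l hl0⟩⟩
  have hne' : Nonempty (lineOpen m) := ⟨⟨q, hqm⟩⟩
  let ι : P1.presheaf.stalk q →+* P1.functionField := algebraMap _ _
  have hι : Function.Injective ι := IsFractionRing.injective _ _
  let O : Subalgebra ℂ P1.functionField :=
    { ι.range with
      algebraMap_mem' := fun c ↦ ⟨P1.presheaf.germ ⊤ q trivial (scalars P1.toSpec ⊤ c),
        P1.algebraMap_germ_eq_germToFunctionField _ _⟩ }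
  let A : Subalgebra ℂ P1.functionField :=
    { (P1.germToFunctionField (lineOpen l)).hom.range with
      algebraMap_mem' := fun c ↦ ⟨scalars P1.toSpec (lineOpen l) c,
        germToFunctionField_scalars _ c⟩ }
  let t := P1.germToFunctionField (lineOpen l) (lineSec l (fracAway hl hm))
  let x := P1.germToFunctionField (lineOpen m) (lineSec m (fracAway hm hl))
  have htx : t * x = 1 := germ_fracAway_mul hl hm _ _
  have htinv : x⁻¹ = t := (eq_inv_of_mul_eq_one_left htx).symm
  have hιx : ι (P1.presheaf.germ _ q hqm (lineSec m (fracAway hm hl))) = x :=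
    P1.algebraMap_germ_eq_germToFunctionField _ _
  have haeval : ∀ {V : P1.Opens} [Nonempty V] (s : Γ(P1, V)) (p : Polynomial ℂ),
      P1.germToFunctionField V (p.eval₂ (scalars P1.toSpec V) s) =
        Polynomial.aeval (P1.germToFunctionField V s) p := by
    intro V _ s p
    have : (P1.germToFunctionField V).hom.comp (scalars P1.toSpec V) =
        algebraMap ℂ P1.functionField := RingHom.ext fun c ↦ germToFunctionField_scalars V c
    rw [Polynomial.aeval_def, ← this]
    exact Polynomial.hom_eval₂ p _ (P1.germToFunctionField V).hom s
  refine ⟨lineOpen l, hne, hU, isAffineOpen_lineOpen hl, ?_, O, A, x, fun f ↦ Iff.rfl,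
    fun f ↦ Iff.rfl, ?_⟩
  · refine IsPrincipalIdealRing.of_surjective (Polynomial.eval₂RingHom
      (scalars P1.toSpec (lineOpen l)) (lineSec l (fracAway hl hm))) fun f ↦ ?_
    obtain ⟨p, hp⟩ := exists_polynomial_section hl hm h f
    exact ⟨p, hp.symm⟩
  have hunit : ∀ f, (ι f)⁻¹ ∉ O → ¬ IsUnit f := by
    rintro f hf ⟨u, rfl⟩
    refine hf ⟨(u⁻¹ : (P1.presheaf.stalk q)ˣ), ?_⟩
    refine eq_inv_of_mul_eq_one_left ?_
    rw [← map_mul, Units.inv_mul, map_one]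
  have hunit' : ∀ f, ¬ IsUnit f → ι f ≠ 0 → (ι f)⁻¹ ∉ O := by
    rintro f hf h0 ⟨g, hg⟩
    refine hf (IsUnit.of_mul_eq_one g (hι ?_))
    rw [map_mul, hg, mul_inv_cancel₀ h0, map_one]
  refine IsCoordinate.of_polynomial ⟨_, hιx⟩ ?_ ?_ ?_ ?_
  · rw [← hιx]
    refine hunit' _ ((IsLocalRing.mem_maximalIdeal _).mp hx) ?_
    rw [hιx]
    exact right_ne_zero_of_mul_eq_one htx
  · rintro _ ⟨f, rfl⟩ _ ⟨g, rfl⟩ hf hg h0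
    have := IsLocalRing.nonunits_add (hunit f hf) (hunit g hg)
    change (ι f + ι g)⁻¹ ∉ O
    have h0 : ι f + ι g ≠ 0 := h0
    rw [← map_add] at h0 ⊢
    exact hunit' _ this h0
  · intro f
    have := functionField_isFractionRing_of_isAffineOpen P1 (lineOpen m) (isAffineOpen_lineOpen hm)
    obtain ⟨u, v, hv, rfl⟩ := IsFractionRing.div_surjective (A := Γ(P1, lineOpen m)) f
    obtain ⟨p, rfl⟩ := exists_polynomial_section hm hl h' u
    obtain ⟨p', rfl⟩ := exists_polynomial_section hm hl h' v
    have hp : ∀ p : Polynomial ℂ, algebraMap Γ(P1, lineOpen m) P1.functionField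
        (p.eval₂ (scalars P1.toSpec (lineOpen m)) (lineSec m (fracAway hm hl))) =
        Polynomial.aeval x p := fun p ↦ haeval _ _
    refine ⟨p, p', ?_, ?_⟩
    · rw [← hp]
      exact IsFractionRing.to_map_ne_zero_of_mem_nonZeroDivisors hv
    · rw [hp, hp]
  · intro f
    rw [htinv]
    constructor
    · rintro ⟨s, rfl⟩
      obtain ⟨p, rfl⟩ := exists_polynomial_section hl hm h s
      exact ⟨p, haeval _ _⟩
    · rintro ⟨p, rfl⟩
      exact ⟨_, haeval _ _⟩

end ProjectiveLine

end RationalAngle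

namespace RationalAngle

/-! ### Frames over affine lines, and the local rings of the projective line. -/

section AffineFrames

variable {X : Scheme.{0}}

lemma exists_isFrame_of_isAffineOpen (E : X.Modules) [SheafOfModules.IsQuasicoherent E]
    (h : ∀ x : X, ∃ U : X.Opens, x ∈ U ∧ ∃ (n : ℕ) (s : Fin n → Γ(E, U)), IsFrame s)
    {U : X.Opens} (hU : IsAffineOpen U) [IsDomain Γ(X, U)] [IsPrincipalIdealRing Γ(X, U)] :
    ∃ (n : ℕ) (s : Fin n → Γ(E, U)), IsFrame s := by
  let j := hU.fromSpec
  have hq : SheafOfModules.IsQuasicoherent (E.restrict j) :=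
    Scheme.Modules.isQuasicoherent_restrictFunctor j E
  have hloc : ∀ y : Spec Γ(X, U), ∃ V : (Spec Γ(X, U)).Opens, y ∈ V ∧
      ∃ (n : ℕ) (s : Fin n → Γ(E.restrict j, V)), IsFrame s := by
    intro y
    obtain ⟨V, hyV, n, s, hs⟩ := h (j y)
    refine ⟨j ⁻¹ᵁ V, hyV, n,
      fun i ↦ (E.restrictAppIso j _).inv (secRes E (j.image_preimage_le V) (s i)), ?_⟩
    rw [← isFrame_restrictAppIso_iff]
    convert hs.res (j.image_preimage_le V) with i
    exact ConcreteCategory.congr_hom (E.restrictAppIso j _).inv_hom_id _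
  obtain ⟨n, s, hs⟩ := exists_isFrame_of_isPrincipalIdealRing (E.restrict j) hloc
  rw [← isFrame_restrictAppIso_iff] at hs
  have hle : U ≤ j ''ᵁ ⊤ := by
    rw [Scheme.Hom.image_top_eq_opensRange, hU.opensRange_fromSpec]
  exact ⟨n, _, hs.res hle⟩

end AffineFrames

section Stalk

variable {q : P1} {O A : Subalgebra ℂ P1.functionField} {x : P1.functionField}

lemma IsCoordinate.inv_notMem (h : IsCoordinate O A x) : x⁻¹ ∉ O := by
  intro hx
  exact one_ne_zero (h.eq_zero_of_mem 1 A.one_mem (by simpa using hx))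

/-- Subtract from `s` its value `c`, regarded as a germ: if `s` is a nonunit then so is this
constant germ, which forces `c = 0`. -/
lemma IsCoordinate.mem_maximalIdeal_iff (h : IsCoordinate O A x)
    (hO : ∀ f, f ∈ O ↔ ∃ s : P1.presheaf.stalk q, algebraMap _ P1.functionField s = f)
    (s : P1.presheaf.stalk q) : s ∈ IsLocalRing.maximalIdeal (P1.presheaf.stalk q) ↔
      x⁻¹ * algebraMap _ P1.functionField s ∈ O := by
  let ι : P1.presheaf.stalk q →+* P1.functionField := algebraMap _ _
  have hι : Function.Injective ι := IsFractionRing.injective _ _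
  have h1 : ∀ s : P1.presheaf.stalk q, x⁻¹ * ι s ∈ O →
      s ∈ IsLocalRing.maximalIdeal (P1.presheaf.stalk q) := by
    intro s hs
    rw [IsLocalRing.mem_maximalIdeal]
    rintro ⟨u, rfl⟩
    refine h.inv_notMem ?_
    have : x⁻¹ = x⁻¹ * ι u * ι (u⁻¹ : (P1.presheaf.stalk q)ˣ) := by
      rw [mul_assoc, ← map_mul, Units.mul_inv, map_one, mul_one]
    rw [this]
    exact O.mul_mem hs ((hO _).mpr ⟨_, rfl⟩)
  refine ⟨fun hs ↦ ?_, h1 s⟩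
  obtain ⟨c, hc⟩ := h.exists_residue (ι s) ((hO _).mpr ⟨s, rfl⟩)
  obtain ⟨c', hc'⟩ := (hO _).mp (O.algebraMap_mem c)
  rw [← hc', ← map_sub] at hc
  have h2 := (IsLocalRing.maximalIdeal (P1.presheaf.stalk q)).sub_mem hs (h1 _ hc)
  rw [sub_sub_cancel] at h2
  have hc0 : c = 0 := by
    by_contra hc0
    refine (IsLocalRing.mem_maximalIdeal _).mp h2 ?_
    obtain ⟨d, hd⟩ := (hO _).mp (O.algebraMap_mem c⁻¹)
    refine IsUnit.of_mul_eq_one d (hι ?_)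
    rw [map_mul, map_one]
    refine (congrArg₂ (· * ·) hc' hd).trans ?_
    rw [← map_mul, mul_inv_cancel₀ hc0, map_one]
  have hc'0 : c' = 0 := hι (by rw [map_zero]; exact hc'.trans (by rw [hc0, map_zero]))
  rw [hc'0, sub_zero] at hc
  exact hc

/-- The coordinate `x` generates the maximal ideal. -/
lemma IsCoordinate.isDiscreteValuationRing (h : IsCoordinate O A x)
    (hO : ∀ f, f ∈ O ↔ ∃ s : P1.presheaf.stalk q, algebraMap _ P1.functionField s = f)
    [IsNoetherianRing (P1.presheaf.stalk q)] :
    IsDiscreteValuationRing (P1.presheaf.stalk q) := by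
  let ι : P1.presheaf.stalk q →+* P1.functionField := algebraMap _ _
  have hι : Function.Injective ι := IsFractionRing.injective _ _
  obtain ⟨ϖ, hϖ⟩ := (hO _).mp h.mem
  have hϖ : ι ϖ = x := hϖ
  have hmem : ϖ ∈ IsLocalRing.maximalIdeal (P1.presheaf.stalk q) := by
    rw [h.mem_maximalIdeal_iff hO]
    change x⁻¹ * ι ϖ ∈ O
    rw [hϖ, inv_mul_cancel₀ h.ne_zero]
    exact O.one_mem
  have hne : ¬ IsField (P1.presheaf.stalk q) := by
    intro hF
    rw [IsLocalRing.isField_iff_maximalIdeal_eq] at hF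
    rw [hF] at hmem
    refine h.ne_zero ?_
    rw [← hϖ, (Ideal.mem_bot.mp hmem : ϖ = 0), map_zero]
  have hTFAE : IsDiscreteValuationRing (P1.presheaf.stalk q) ↔
      (IsLocalRing.maximalIdeal (P1.presheaf.stalk q)).IsPrincipal :=
    (IsDiscreteValuationRing.TFAE (P1.presheaf.stalk q) hne).out 0 4
  refine hTFAE.mpr ⟨ϖ, ?_⟩
  refine le_antisymm (fun s hs ↦ ?_) ?_
  · rw [h.mem_maximalIdeal_iff hO, hO] at hs
    obtain ⟨r, hr⟩ := hs
    refine Ideal.mem_span_singleton'.mpr ⟨r, hι ?_⟩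
    rw [map_mul, hϖ]
    refine (congrArg (· * x) hr).trans ?_
    change x⁻¹ * ι s * x = ι s
    rw [mul_comm, mul_inv_cancel_left₀ h.ne_zero]
  · rw [Submodule.span_singleton_le_iff_mem]
    exact hmem

end Stalk

end RationalAngle

namespace RationalAngle

/-! ### Functions on the curve restricted to one component. -/

section Branch

variable {C : Scheme.{0}} (f : P1 ⟶ C) {p : C} {q : P1}

/-- The pullback of a function along `f` as a rational function on the projective line. -/
def ev (W : C.Opens) (hW : f (genericPoint P1) ∈ W) : Γ(C, W) →+* P1.functionField :=
  (C.presheaf.germ W _ hW ≫ f.stalkMap (genericPoint P1)).hom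

lemma ev_funRes {V W : C.Opens} (h : V ≤ W) (hV : f (genericPoint P1) ∈ V) (a : Γ(C, W)) :
    ev f V hV (funRes C h a) = ev f W (h hV) a :=
  congrArg (f.stalkMap (genericPoint P1)).hom (TopCat.Presheaf.germ_res_apply C.presheaf _ _ hV a)

lemma ev_eq {W : C.Opens} (hW : f (genericPoint P1) ∈ W) (a : Γ(C, W)) :
    ev f W hW a = P1.presheaf.germ (f ⁻¹ᵁ W) (genericPoint P1) hW (f.app W a) :=
  Scheme.Hom.germ_stalkMap_apply f W (genericPoint P1) hW a

lemma ev_eq_zero_iff {W : C.Opens} (hW : f (genericPoint P1) ∈ W) (a : Γ(C, W)) :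
    ev f W hW a = 0 ↔ f.app W a = 0 := by
  rw [ev_eq]
  exact map_eq_zero_iff _ (germ_injective_of_isIntegral P1 _ hW)

lemma preimage_basicOpen_eq_bot {W : C.Opens} {a : Γ(C, W)} (ha : f.app W a = 0) :
    f ⁻¹ᵁ C.basicOpen a = ⊥ := by
  rw [Scheme.preimage_basicOpen, ha, Scheme.basicOpen_zero]

/-- On an open subset covered by the component, a function that vanishes on the component has empty
nonvanishing locus, hence is zero by reducedness. -/
lemma ev_injective [IsReduced C] {W : C.Opens} (hW : f (genericPoint P1) ∈ W)
    (hWf : (W : Set C) ⊆ Set.range f) : Function.Injective (ev f W hW) := by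
  rw [injective_iff_map_eq_zero]
  intro a ha
  rw [ev_eq_zero_iff] at ha
  rw [← basicOpen_eq_bot_iff, eq_bot_iff]
  intro y hy
  obtain ⟨z, rfl⟩ := hWf (C.basicOpen_le a hy)
  have : z ∈ f ⁻¹ᵁ C.basicOpen a := hy
  rwa [preimage_basicOpen_eq_bot f ha] at this

/-- The map of local rings of a curve through the point `p`. -/
def branch (h : f q = p) : C.presheaf.stalk p →+* P1.presheaf.stalk q :=
  (C.presheaf.stalkSpecializes (specializes_of_eq h) ≫ f.stalkMap q).hom

lemma branch_rfl : branch f (rfl : f q = f q) = (f.stalkMap q).hom := by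
  rw [branch, TopCat.Presheaf.stalkSpecializes_refl, Category.id_comp]

lemma branch_surjective [IsClosedImmersion f] (h : f q = p) : Function.Surjective (branch f h) := by
  subst h
  rw [branch_rfl]
  exact f.stalkMap_surjective q

lemma isUnit_branch_iff (h : f q = p) (r : C.presheaf.stalk p) :
    IsUnit (branch f h r) ↔ IsUnit r := by
  subst h
  rw [branch_rfl]
  exact isUnit_map_iff (f.stalkMap q).hom r

lemma genericPoint_mem (h : f q = p) {W : C.Opens} (hp : p ∈ W) : f (genericPoint P1) ∈ W := by
  subst h
  exact (genericPoint_spec P1).mem_open_set_iff (f ⁻¹ᵁ W).isOpen |>.mpr ⟨q, trivial, hp⟩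

lemma branch_germ (h : f q = p) {W : C.Opens} (hp : p ∈ W) (a : Γ(C, W)) :
    algebraMap _ P1.functionField (branch f h (C.presheaf.germ W p hp a)) =
      ev f W (genericPoint_mem f h hp) a := by
  subst h
  have hne : Nonempty (f ⁻¹ᵁ W : P1.Opens) := ⟨⟨q, hp⟩⟩
  rw [branch_rfl, ev_eq]
  refine (congrArg _ (Scheme.Hom.germ_stalkMap_apply f W q hp a)).trans ?_
  exact P1.algebraMap_germ_eq_germToFunctionField _ _

lemma ev_scalars {s : C ⟶ Spec (.of ℂ)} (hs : f ≫ s = P1.toSpec) {W : C.Opens}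
    (hW : f (genericPoint P1) ∈ W) (c : ℂ) :
    ev f W hW (scalars s W c) = algebraMap ℂ P1.functionField c := by
  rw [← funRes_scalars s (le_top : W ≤ ⊤), ev_funRes, ev_eq]
  have : f.app ⊤ (scalars s ⊤ c) = scalars P1.toSpec ⊤ c := by
    have h1 : ∀ {X : Scheme.{0}} (s : X ⟶ Spec (.of ℂ)) (c : ℂ), scalars s ⊤ c =
        s.appTop ((Scheme.ΓSpecIso (.of ℂ)).inv c) := fun s c ↦ funRes_refl _ _
    rw [← hs, h1, h1, Scheme.Hom.comp_appTop]
    rfl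
  rw [this]
  rfl

/-- A surjective closed immersion into a reduced scheme is an isomorphism. This identifies the
component minus the node with an open subscheme of `C`. -/
lemma isIso_morphismRestrict [IsReduced C] [IsClosedImmersion f] {U : C.Opens}
    (hU : (U : Set C) ⊆ Set.range f) : IsIso (f ∣_ U) := by
  have : Surjective (f ∣_ U) := by
    refine ⟨fun y ↦ ?_⟩
    obtain ⟨z, hz⟩ := hU y.2
    refine ⟨⟨z, show f z ∈ U from hz ▸ y.2⟩, Subtype.ext ?_⟩
    exact (morphismRestrict_base_coe f U _).trans hz
  have : IsClosedImmersion (f ∣_ U) := inferInstance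
  exact isIso_of_isClosedImmersion_of_surjective (f ∣_ U)

lemma isAffineOpen_of_preimage [IsReduced C] [IsClosedImmersion f] {U : C.Opens}
    (hU : (U : Set C) ⊆ Set.range f) (h : IsAffineOpen (f ⁻¹ᵁ U)) : IsAffineOpen U := by
  have := isIso_morphismRestrict f hU
  have : IsAffine (f ⁻¹ᵁ U : P1.Opens) := h
  exact IsAffine.of_isIso (inv (f ∣_ U))

lemma app_bijective [IsReduced C] [IsClosedImmersion f] {U : C.Opens}
    (hU : (U : Set C) ⊆ Set.range f) (h : IsAffineOpen (f ⁻¹ᵁ U)) :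
    Function.Bijective (f.app U) := by
  have h1 := isIso_morphismRestrict f hU
  rw [isIso_morphismRestrict_iff_isIso_app f (isAffineOpen_of_preimage f hU h)] at h1
  exact ConcreteCategory.bijective_of_isIso (f.app U)

end Branch

end RationalAngle

namespace RationalAngle

/-! ### Transition matrices between the node and the affine lines. -/

section Transition

variable {C : Scheme.{0}} {E : C.Modules} {n : ℕ}

/-- Spread out the finitely many germs to a neighbourhood, then shrink to the locus where the
determinant is invertible. -/
lemma exists_matrix_germ_eq {p : C} {N : C.Opens} (hp : p ∈ N)
    (r : Matrix (Fin n) (Fin n) (C.presheaf.stalk p)) (hr : IsUnit r.det) :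
    ∃ (V : C.Opens) (_ : V ≤ N) (hV : p ∈ V) (ρ : Matrix (Fin n) (Fin n) Γ(C, V)),
      IsUnit ρ.det ∧ ρ.map (C.presheaf.germ V p hV) = r := by
  choose W hW a ha using fun x : Fin n × Fin n ↦ C.presheaf.exists_germ_eq (r x.1 x.2)
  let N₀ : C.Opens := N ⊓ Finset.univ.inf W
  have h₀ : p ∈ N₀ := by
    refine ⟨hp, ?_⟩
    rw [TopologicalSpace.Opens.coe_finset_inf]
    simpa using fun i j ↦ hW (i, j)
  have hle : ∀ x, N₀ ≤ W x := fun x ↦ inf_le_right.trans (Finset.inf_le (Finset.mem_univ x))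
  let ρ₀ : Matrix (Fin n) (Fin n) Γ(C, N₀) := .of fun i j ↦ funRes C (hle (i, j)) (a (i, j))
  have hρ₀ : ρ₀.map (C.presheaf.germ N₀ p h₀) = r := by
    ext i j
    exact (TopCat.Presheaf.germ_res_apply C.presheaf _ _ h₀ _).trans (ha (i, j))
  have hdet : C.presheaf.germ N₀ p h₀ ρ₀.det = r.det := by
    rw [← hρ₀]
    exact RingHom.map_det (C.presheaf.germ N₀ p h₀).hom ρ₀
  have hV : p ∈ C.basicOpen ρ₀.det := by
    rw [Scheme.mem_basicOpen _ _ _ h₀, hdet]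
    exact hr
  have hVN : C.basicOpen ρ₀.det ≤ N₀ := C.basicOpen_le _
  refine ⟨C.basicOpen ρ₀.det, hVN.trans inf_le_left, hV, ρ₀.map (funRes C hVN), ?_, ?_⟩
  · have : (ρ₀.map (funRes C hVN)).det = funRes C hVN ρ₀.det := ((funRes C hVN).map_det _).symm
    rw [this]
    exact RingedSpace.isUnit_res_basicOpen _ _
  · ext i j
    rw [← hρ₀]
    exact TopCat.Presheaf.germ_res_apply C.presheaf _ _ hV _

variable (f : P1 ⟶ C) {N U : C.Opens} {w : Fin n → Γ(E, N)} {u : Fin n → Γ(E, U)}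

/-- If the transition matrix of two frames becomes diagonal over the function field of a branch
after changes of the frames, then the new frames differ by units. -/
lemma exists_transition [IsReduced C] (hw : IsFrame w) (hu : IsFrame u)
    (hN : f (genericPoint P1) ∈ N) (hU : f (genericPoint P1) ∈ U)
    (hUf : (U : Set C) ⊆ Set.range f) :
    ∃ G : Matrix (Fin n) (Fin n) P1.functionField, G.det ≠ 0 ∧
      ∀ (V : C.Opens) (hVN : V ≤ N) (hV : f (genericPoint P1) ∈ V)
        (ρ : Matrix (Fin n) (Fin n) Γ(C, V)) (_ : IsUnit ρ.det)
        (β : Matrix (Fin n) (Fin n) Γ(C, U)) (_ : IsUnit β.det)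
        (D : Fin n → P1.functionField),
        G * β.map (ev f U hU) = ρ.map (ev f V hV) * Matrix.diagonal D →
        ∀ j, ∃ t : Γ(C, V ⊓ U), IsUnit t ∧
          secRes E inf_le_right (∑ i, β i j • u i) =
            t • secRes E inf_le_left (∑ i, ρ i j • secRes E hVN (w i)) := by
  have hNU : f (genericPoint P1) ∈ N ⊓ U := ⟨hN, hU⟩
  have hwr := hw.res (inf_le_left : N ⊓ U ≤ N)
  have hur := hu.res (inf_le_right : N ⊓ U ≤ U)
  obtain ⟨g, hg⟩ := hwr.exists_matrix fun i ↦ secRes E (inf_le_right : N ⊓ U ≤ U) (u i)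
  have hgu := hwr.isUnit_det hur hg
  refine ⟨g.map (ev f (N ⊓ U) hNU), ?_, ?_⟩
  · have : (g.map (ev f (N ⊓ U) hNU)).det = ev f (N ⊓ U) hNU g.det :=
      ((ev f (N ⊓ U) hNU).map_det _).symm
    rw [this]
    exact (hgu.map _).ne_zero
  intro V hVN hV ρ hρ β hβ D hD
  have hVU : f (genericPoint P1) ∈ V ⊓ U := ⟨hV, hU⟩
  let hl : V ⊓ U ≤ V := inf_le_left
  let hr : V ⊓ U ≤ U := inf_le_right
  let hh : V ⊓ U ≤ N ⊓ U := inf_le_inf_right U hVN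
  have hw' : IsFrame fun j ↦ secRes E hl (∑ i, ρ i j • secRes E hVN (w i)) :=
    ((hw.res hVN).matrix_smul hρ).res hl
  have hu' : IsFrame fun j ↦ secRes E hr (∑ i, β i j • u i) := (hu.matrix_smul hβ).res hr
  obtain ⟨T, hT⟩ := hw'.exists_matrix fun j ↦ secRes E hr (∑ i, β i j • u i)
  have hTu := hw'.isUnit_det hu' hT
  let w₀ : Fin n → Γ(E, V ⊓ U) := fun i ↦ secRes E (hl.trans hVN) (w i)
  let u₀ : Fin n → Γ(E, V ⊓ U) := fun i ↦ secRes E hr (u i)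
  have hw₀ : IsFrame w₀ := hw.res _
  have e1 : ∀ j, secRes E hl (∑ i, ρ i j • secRes E hVN (w i)) =
      ∑ i, (ρ.map (funRes C hl)) i j • w₀ i := by
    intro j
    rw [secRes_sum_smul]
    simp only [secRes_secRes, Matrix.map_apply, w₀]
  have e2 : ∀ j, secRes E hr (∑ i, β i j • u i) = ∑ i, (β.map (funRes C hr)) i j • u₀ i := by
    intro j
    rw [secRes_sum_smul]
    rfl
  have e3 : ∀ j, u₀ j = ∑ i, (g.map (funRes C hh)) i j • w₀ i := by
    intro j
    have := congrArg (secRes E hh) (hg j)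
    rw [secRes_secRes, secRes_sum_smul] at this
    simp only [secRes_secRes] at this
    exact this
  -- Both sides express the new frame on `U` in terms of `w` over `V ⊓ U`. Over the function field
  -- `ρ` cancels, leaving `T = diag D`, and injectivity of `ev` brings diagonality back to `T`
  -- itself.
  have e4 : ρ.map (funRes C hl) * T = g.map (funRes C hh) * β.map (funRes C hr) := by
    refine hw₀.matrix_eq fun j ↦ ?_
    rw [← sum_matrix_mul_smul e1 hT j, ← sum_matrix_mul_smul e3 e2 j]
  have e5 : T.map (ev f (V ⊓ U) hVU) = Matrix.diagonal D := by
    have h5 := congrArg (fun M : Matrix (Fin n) (Fin n) _ ↦ M.map (ev f (V ⊓ U) hVU)) e4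
    simp only [Matrix.map_mul, Matrix.map_map] at h5
    have k1 : ev f (V ⊓ U) hVU ∘ funRes C hl = ev f V hV := funext (ev_funRes f hl hVU)
    have k2 : ev f (V ⊓ U) hVU ∘ funRes C hh = ev f (N ⊓ U) hNU := funext (ev_funRes f hh hVU)
    have k3 : ev f (V ⊓ U) hVU ∘ funRes C hr = ev f U hU := funext (ev_funRes f hr hVU)
    rw [k1, k2, k3, hD] at h5
    have hu : IsUnit (ρ.map (ev f V hV)) := by
      rw [Matrix.isUnit_iff_isUnit_det]
      have : (ρ.map (ev f V hV)).det = ev f V hV ρ.det := ((ev f V hV).map_det _).symm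
      rw [this]
      exact hρ.map _
    exact hu.mul_left_cancel h5
  have hdiag : T = Matrix.diagonal fun i ↦ T i i := by
    ext i j
    by_cases hij : i = j
    · subst hij; simp
    · rw [Matrix.diagonal_apply_ne _ hij]
      refine (map_eq_zero_iff _ (ev_injective f hVU (fun y hy ↦ hUf hy.2))).mp ?_
      have := congrFun (congrFun e5 i) j
      rwa [Matrix.diagonal_apply_ne _ hij] at this
  intro j
  refine ⟨T j j, ?_, ?_⟩
  · rw [hdiag, Matrix.det_diagonal] at hTu
    exact isUnit_of_dvd_unit (Finset.dvd_prod_of_mem (fun i ↦ T i i) (Finset.mem_univ j)) hTu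
  · refine (hT j).trans (Finset.sum_eq_single j (fun i _ hij ↦ ?_) (by simp))
    rw [hdiag, Matrix.diagonal_apply_ne _ hij, zero_smul]

end Transition

section Chart

variable {C : Scheme.{0}} (f : P1 ⟶ C) {q : P1}

/-- The complement of a closed point `q` in a component has the structure of an affine line. -/
lemma exists_chart [IsReduced C] [IsClosedImmersion f] [LocallyOfFiniteType P1.toSpec]
    (hq : IsClosed {q}) {U : C.Opens} (hU : (U : Set C) ⊆ Set.range f)
    (hUq : (f ⁻¹ᵁ U : Set P1) = {q}ᶜ) :
    IsAffineOpen U ∧ IsDomain Γ(C, U) ∧ IsPrincipalIdealRing Γ(C, U) ∧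
      ∃ (hη : f (genericPoint P1) ∈ U) (O A : Subalgebra ℂ P1.functionField)
        (x : P1.functionField),
        (∀ a, a ∈ O ↔ ∃ s : P1.presheaf.stalk q, algebraMap _ P1.functionField s = a) ∧
        (∀ a ∈ A, ∃ s : Γ(C, U), ev f U hη s = a) ∧ IsCoordinate O A x := by
  obtain ⟨U', hne, hU', haff, hpid, O, A, x, hO, hA, hx⟩ := exists_isCoordinate hq
  obtain rfl : U' = f ⁻¹ᵁ U := SetLike.coe_injective (hU'.trans hUq.symm)
  have hη : f (genericPoint P1) ∈ U := by
    obtain ⟨y, hy⟩ := hne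
    exact genericPoint_mem f rfl hy
  have hbij := app_bijective f hU haff
  let e : Γ(C, U) ≃+* Γ(P1, f ⁻¹ᵁ U) := RingEquiv.ofBijective (f.app U).hom hbij
  have hdom : IsDomain Γ(P1, f ⁻¹ᵁ U) := inferInstance
  refine ⟨isAffineOpen_of_preimage f hU haff, e.toMulEquiv.isDomain _,
    IsPrincipalIdealRing.of_surjective e.symm.toRingHom e.symm.surjective, hη, O, A, x, hO,
    fun a ha ↦ ?_, hx⟩
  obtain ⟨s, hs⟩ := (hA a).mp ha
  obtain ⟨t, rfl⟩ := hbij.2 s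
  exact ⟨t, (ev_eq f hη t).trans hs⟩

lemma exists_matrix_ev_eq [IsReduced C] {n : ℕ} {U : C.Opens} (hU : (U : Set C) ⊆ Set.range f)
    (hη : f (genericPoint P1) ∈ U) {A : Subalgebra ℂ P1.functionField}
    (hA : ∀ a ∈ A, ∃ s : Γ(C, U), ev f U hη s = a)
    (b : Matrix (Fin n) (Fin n) P1.functionField) (hb : ∀ i j, b i j ∈ A) (hb0 : b.det ≠ 0)
    (hbi : (b.det)⁻¹ ∈ A) :
    ∃ β : Matrix (Fin n) (Fin n) Γ(C, U), IsUnit β.det ∧ β.map (ev f U hη) = b := by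
  choose β hβ using fun i j ↦ hA _ (hb i j)
  obtain ⟨d, hd⟩ := hA _ hbi
  have hβb : (Matrix.of β).map (ev f U hη) = b := by
    ext i j
    exact hβ i j
  refine ⟨.of β, ?_, hβb⟩
  refine IsUnit.of_mul_eq_one d (ev_injective f hη hU ?_)
  rw [map_mul, map_one, hd, RingHom.map_det]
  refine Eq.trans ?_ (mul_inv_cancel₀ hb0)
  rw [← hβb]
  rfl

/-- The ranks of the two frames agree because `N ⊓ U` contains the generic point of the component.
-/
lemma exists_isFrame_of_mem {E : C.Modules} [SheafOfModules.IsQuasicoherent E]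
    (h : ∀ x : C, ∃ U : C.Opens, x ∈ U ∧ ∃ (n : ℕ) (s : Fin n → Γ(E, U)), IsFrame s)
    {U N : C.Opens} (hU : IsAffineOpen U) [IsDomain Γ(C, U)] [IsPrincipalIdealRing Γ(C, U)]
    (hηU : f (genericPoint P1) ∈ U) (hηN : f (genericPoint P1) ∈ N) {n : ℕ}
    {w : Fin n → Γ(E, N)} (hw : IsFrame w) : ∃ u : Fin n → Γ(E, U), IsFrame u := by
  obtain ⟨m, u, hu⟩ := exists_isFrame_of_isAffineOpen E h hU
  have : Nontrivial Γ(C, N ⊓ U) := (ev f (N ⊓ U) ⟨hηN, hηU⟩).domain_nontrivial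
  have hc := (hw.res (inf_le_left : N ⊓ U ≤ N)).card_eq (hu.res (inf_le_right : N ⊓ U ≤ U))
  rw [Fintype.card_fin, Fintype.card_fin] at hc
  exact ⟨_, hu.reindex (finCongr hc)⟩

end Chart

/-! ### Gluing germs at the node. -/

section Node

variable {C : Scheme.{0}} {f₁ f₂ : P1 ⟶ C} {p : C} {q₁ q₂ : P1} (h₁ : f₁ q₁ = p) (h₂ : f₂ q₂ = p)

/-- A germ that dies on both branches has a representative vanishing on both components, which cover
the reduced curve. -/
lemma ker_branch_inf_ker_branch [IsReduced C] (hcov : Set.range f₁ ∪ Set.range f₂ = Set.univ) :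
    RingHom.ker (branch f₁ h₁) ⊓ RingHom.ker (branch f₂ h₂) = ⊥ := by
  rw [eq_bot_iff]
  rintro r ⟨hr₁, hr₂⟩
  obtain ⟨W, hW, a, rfl⟩ := C.presheaf.exists_germ_eq r
  have key : ∀ {f : P1 ⟶ C} {q : P1} (h : f q = p),
      branch f h (C.presheaf.germ W p hW a) = 0 → f.app W a = 0 := by
    intro f q h h0
    rw [← ev_eq_zero_iff f (genericPoint_mem f h hW), ← branch_germ f h hW a]
    exact (congrArg _ h0).trans (map_zero _)
  have k₁ := preimage_basicOpen_eq_bot f₁ (key h₁ hr₁)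
  have k₂ := preimage_basicOpen_eq_bot f₂ (key h₂ hr₂)
  have : a = 0 := by
    rw [← basicOpen_eq_bot_iff, eq_bot_iff]
    intro y hy
    rcases hcov.ge (Set.mem_univ y) with ⟨z, rfl⟩ | ⟨z, rfl⟩
    · exact k₁.le (show z ∈ f₁ ⁻¹ᵁ _ from hy)
    · exact k₂.le (show z ∈ f₂ ⁻¹ᵁ _ from hy)
  rw [this]
  exact map_zero (C.presheaf.germ W p hW).hom

/-- On an affine neighbourhood of `p`, choose a function whose nonvanishing locus avoids the first
component but contains the generic point of the second. Its germ at `p` dies on the first branch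
only. -/
lemma not_ker_branch_le [IsClosedImmersion f₁]
    (hη : f₂ (genericPoint P1) ∉ Set.range f₁) :
    ¬ RingHom.ker (branch f₁ h₁) ≤ RingHom.ker (branch f₂ h₂) := by
  intro hle
  obtain ⟨W, hWaff, hW, -⟩ := exists_isAffineOpen_mem_and_subset (x := p) (U := ⊤) trivial
  let V : C.Opens := ⟨(Set.range f₁)ᶜ, f₁.isClosedEmbedding.isClosed_range.isOpen_compl⟩
  obtain ⟨a, haV, ha⟩ := hWaff.exists_basicOpen_le (V := V) ⟨_, hη⟩ (genericPoint_mem f₂ h₂ hW)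
  have ha₁ : f₁.app W a = 0 := by
    rw [← basicOpen_eq_bot_iff, ← Scheme.preimage_basicOpen, eq_bot_iff]
    intro y hy
    exact haV hy ⟨y, rfl⟩
  have ha₂ : branch f₂ h₂ (C.presheaf.germ W p hW a) = 0 := by
    refine hle ?_
    rw [RingHom.mem_ker]
    refine IsFractionRing.injective _ P1.functionField ?_
    rw [branch_germ, map_zero, ev_eq_zero_iff, ha₁]
  have ha₃ : ev f₂ W (genericPoint_mem f₂ h₂ hW) a = 0 := by
    rw [← branch_germ f₂ h₂ hW, ha₂, map_zero]
  have := preimage_basicOpen_eq_bot f₂ ((ev_eq_zero_iff f₂ _ _).mp ha₃)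
  exact this.le (show genericPoint P1 ∈ f₂ ⁻¹ᵁ _ from ha)

/-- Germs on the two branches with the same value at the node come from a germ on the curve. -/
lemma exists_branch_eq [IsClosedImmersion f₁] [IsClosedImmersion f₂]
    (hsup : RingHom.ker (branch f₁ h₁) ⊔ RingHom.ker (branch f₂ h₂) =
      IsLocalRing.maximalIdeal (C.presheaf.stalk p))
    (c : C.presheaf.stalk p) (s₁ : P1.presheaf.stalk q₁) (s₂ : P1.presheaf.stalk q₂)
    (hs₁ : s₁ - branch f₁ h₁ c ∈ IsLocalRing.maximalIdeal (P1.presheaf.stalk q₁))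
    (hs₂ : s₂ - branch f₂ h₂ c ∈ IsLocalRing.maximalIdeal (P1.presheaf.stalk q₂)) :
    ∃ r, branch f₁ h₁ r = s₁ ∧ branch f₂ h₂ r = s₂ := by
  have key : ∀ {f : P1 ⟶ C} {q : P1} [IsClosedImmersion f] (h : f q = p)
      (s : P1.presheaf.stalk q) (_ : s ∈ IsLocalRing.maximalIdeal (P1.presheaf.stalk q)),
      ∃ k₁ k₂, branch f₁ h₁ k₁ = 0 ∧ branch f₂ h₂ k₂ = 0 ∧ branch f h (k₁ + k₂) = s := by
    intro f q _ h s hs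
    obtain ⟨r, rfl⟩ := branch_surjective f h s
    have hr : r ∈ IsLocalRing.maximalIdeal (C.presheaf.stalk p) := by
      rw [IsLocalRing.mem_maximalIdeal, mem_nonunits_iff, isUnit_branch_iff] at hs
      exact hs
    rw [← hsup] at hr
    obtain ⟨k₁, hk₁, k₂, hk₂, rfl⟩ := Submodule.mem_sup.mp hr
    exact ⟨k₁, k₂, hk₁, hk₂, rfl⟩
  obtain ⟨k₁, k₂, hk₁, hk₂, hk⟩ := key h₁ _ hs₁
  obtain ⟨l₁, l₂, hl₁, hl₂, hl⟩ := key h₂ _ hs₂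
  rw [map_add, hk₁, zero_add] at hk
  rw [map_add, hl₂, add_zero] at hl
  -- The correction `k₂` is invisible on the second branch and repairs the first; `l₁` does the
  -- opposite.
  refine ⟨c + k₂ + l₁, ?_, ?_⟩
  · rw [map_add, map_add, hl₁, hk]; ring
  · rw [map_add, map_add, hl, hk₂]; ring

end Node

end RationalAngle

namespace RationalAngle

/-! ### Assembling the decomposition on the rational angle. -/

section Angle

/-- The complement of the image of a closed immersion. -/
def rangeCompl {X C : Scheme.{0}} (f : X ⟶ C) [IsClosedImmersion f] : C.Opens :=
  ⟨(Set.range f)ᶜ, f.isClosedEmbedding.isClosed_range.isOpen_compl⟩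

variable {C : Scheme.{0}} {f f' : P1 ⟶ C} [IsClosedImmersion f] [IsClosedImmersion f']
  {p : C} {q : P1}

lemma rangeCompl_subset (hcov : Set.range f ∪ Set.range f' = Set.univ) :
    (rangeCompl f' : Set C) ⊆ Set.range f :=
  fun y hy ↦ (hcov.ge (Set.mem_univ y)).resolve_right hy

lemma preimage_rangeCompl (hmeet : Set.range f ∩ Set.range f' = {p}) (h : f q = p) :
    (f ⁻¹ᵁ rangeCompl f' : Set P1) = {q}ᶜ := by
  ext y
  refine not_congr (Iff.trans ?_ f.isClosedEmbedding.injective.eq_iff (b := f y = f q))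
  rw [h]
  exact ⟨fun hy ↦ hmeet.le ⟨⟨y, rfl⟩, hy⟩, fun hy ↦ (hmeet.ge hy).2⟩

lemma isClosed_singleton_of_inter (hmeet : Set.range f ∩ Set.range f' = {p}) : IsClosed {p} :=
  hmeet ▸ f.isClosedEmbedding.isClosed_range.inter f'.isClosedEmbedding.isClosed_range

lemma isClosed_singleton_of_preimage (hp : IsClosed {p}) (h : f q = p) : IsClosed {q} := by
  have : ({q} : Set P1) = f ⁻¹' {p} := by
    ext y
    rw [Set.mem_preimage, Set.mem_singleton_iff, Set.mem_singleton_iff, ← h,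
      f.isClosedEmbedding.injective.eq_iff]
  rw [this]
  exact hp.preimage f.continuous

variable {s : C ⟶ Spec (.of ℂ)}

/-- A germ on the branch `f` with the value `c` at `q`. -/
lemma sub_branch_mem_maximalIdeal (hs : f ≫ s = P1.toSpec) (h : f q = p)
    {O A : Subalgebra ℂ P1.functionField} {x : P1.functionField} (hx : IsCoordinate O A x)
    (hO : ∀ a, a ∈ O ↔ ∃ s : P1.presheaf.stalk q, algebraMap _ P1.functionField s = a)
    (t : P1.presheaf.stalk q) (c : ℂ)
    (hc : x⁻¹ * (algebraMap _ P1.functionField t - algebraMap ℂ _ c) ∈ O) :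
    t - branch f h (C.presheaf.germ ⊤ p (TopologicalSpace.Opens.mem_top p) (scalars s ⊤ c)) ∈
      IsLocalRing.maximalIdeal (P1.presheaf.stalk q) := by
  rw [hx.mem_maximalIdeal_iff hO, map_sub, branch_germ, ev_scalars f hs]
  exact hc

variable {f₁ f₂ : P1 ⟶ C} [IsClosedImmersion f₁] [IsClosedImmersion f₂]

/-- The cover consists of a neighbourhood of the node and the two affine lines. The factorization
supplies frames whose transitions from the node to each line are diagonal, and the two lines do not
meet, so nothing else has to be matched. -/
theorem exists_iso_biproduct [LocallyOfFiniteType s] [IsReduced C] (hs₁ : f₁ ≫ s = P1.toSpec)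
    (hs₂ : f₂ ≫ s = P1.toSpec) (hcov : Set.range f₁ ∪ Set.range f₂ = Set.univ)
    (hmeet : Set.range f₁ ∩ Set.range f₂ = {p}) (hp : IsNonsingularCurvePoint C p ∨ IsNode C p)
    (E : C.Modules) [SheafOfModules.IsQuasicoherent E]
    (hE : ∀ x : C, ∃ U : C.Opens, x ∈ U ∧ ∃ (n : ℕ) (s : Fin n → Γ(E, U)), IsFrame s) :
    ∃ (n : ℕ) (L : Fin n → C.Modules), (∀ i, IsLineBundle (L i)) ∧ Nonempty (E ≅ ⨁ L) := by
  obtain ⟨⟨q₁, h₁⟩, ⟨q₂, h₂⟩⟩ := hmeet.ge (Set.mem_singleton p)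
  have hmeet' : Set.range f₂ ∩ Set.range f₁ = {p} := by rw [Set.inter_comm, hmeet]
  have hcov' : Set.range f₂ ∪ Set.range f₁ = Set.univ := by rw [Set.union_comm, hcov]
  have hpc := isClosed_singleton_of_inter hmeet
  have : LocallyOfFiniteType P1.toSpec := hs₁ ▸ inferInstance
  have hnoeth : IsLocallyNoetherian C := LocallyOfFiniteType.isLocallyNoetherian s
  have hR : IsNoetherianRing (C.presheaf.stalk p) := inferInstance
  have hO₁n : IsNoetherianRing (P1.presheaf.stalk q₁) :=
    isNoetherianRing_of_surjective _ _ _ (branch_surjective f₁ h₁)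
  have hO₂n : IsNoetherianRing (P1.presheaf.stalk q₂) :=
    isNoetherianRing_of_surjective _ _ _ (branch_surjective f₂ h₂)
  have hU₁ := rangeCompl_subset hcov
  have hU₂ := rangeCompl_subset hcov'
  obtain ⟨haff₁, hdom₁, hpid₁, hη₁, O₁, A₁, x₁, hO₁, hA₁, hx₁⟩ := exists_chart f₁
    (isClosed_singleton_of_preimage hpc h₁) hU₁ (preimage_rangeCompl hmeet h₁)
  obtain ⟨haff₂, hdom₂, hpid₂, hη₂, O₂, A₂, x₂, hO₂, hA₂, hx₂⟩ := exists_chart f₂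
    (isClosed_singleton_of_preimage hpc h₂) hU₂ (preimage_rangeCompl hmeet' h₂)
  have hdvr₁ := hx₁.isDiscreteValuationRing hO₁
  have hdvr₂ := hx₂.isDiscreteValuationRing hO₂
  have hsup := sup_ker_eq_maximalIdeal (branch f₁ h₁) (branch f₂ h₂)
    (branch_surjective f₁ h₁) (branch_surjective f₂ h₂) (ker_branch_inf_ker_branch h₁ h₂ hcov)
    (not_ker_branch_le h₁ h₂ hη₂) (not_ker_branch_le h₂ h₁ hη₁) hp
  -- frames near the node and on the complements of the node in the components
  obtain ⟨N, hpN, n, w, hw⟩ := hE p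
  have hN₁ := genericPoint_mem f₁ h₁ hpN
  have hN₂ := genericPoint_mem f₂ h₂ hpN
  obtain ⟨u₁, hu₁⟩ := exists_isFrame_of_mem f₁ hE haff₁ hη₁ hN₁ hw
  obtain ⟨u₂, hu₂⟩ := exists_isFrame_of_mem f₂ hE haff₂ hη₂ hN₂ hw
  obtain ⟨G₁, hG₁, hT₁⟩ := exists_transition f₁ hw hu₁ hN₁ hη₁ hU₁
  obtain ⟨G₂, hG₂, hT₂⟩ := exists_transition f₂ hw hu₂ hN₂ hη₂ hU₂
  let φ₁ : C.presheaf.stalk p →+* P1.functionField := (algebraMap _ _).comp (branch f₁ h₁)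
  let φ₂ : C.presheaf.stalk p →+* P1.functionField := (algebraMap _ _).comp (branch f₂ h₂)
  obtain ⟨r, b₁, b₂, D₁, D₂, hr, ⟨hb₁, hb₁0, hb₁i⟩, ⟨hb₂, hb₂0, hb₂i⟩, hD₁, hD₂⟩ :=
    exists_simultaneous_factorization hx₁ hx₂ φ₁ φ₂
      (fun o₁ ho₁ o₂ ho₂ c hc₁ hc₂ ↦ by
        obtain ⟨t₁, rfl⟩ := (hO₁ o₁).mp ho₁
        obtain ⟨t₂, rfl⟩ := (hO₂ o₂).mp ho₂
        obtain ⟨r, hr₁, hr₂⟩ := exists_branch_eq h₁ h₂ hsup _ t₁ t₂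
          (sub_branch_mem_maximalIdeal hs₁ h₁ hx₁ hO₁ t₁ c hc₁)
          (sub_branch_mem_maximalIdeal hs₂ h₂ hx₂ hO₂ t₂ c hc₂)
        exact ⟨r, congrArg _ hr₁, congrArg _ hr₂⟩)
      (fun r hr ↦ by
        by_contra hru
        refine hr ((hx₁.mem_maximalIdeal_iff hO₁ _).mp ?_)
        rw [IsLocalRing.mem_maximalIdeal, mem_nonunits_iff, isUnit_branch_iff]
        exact hru)
      G₁ G₂ hG₁ hG₂
  obtain ⟨V, hVN, hpV, ρ, hρ, hρr⟩ := exists_matrix_germ_eq hpN r hr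
  obtain ⟨β₁, hβ₁, hβb₁⟩ := exists_matrix_ev_eq f₁ hU₁ hη₁ hA₁ b₁ hb₁ hb₁0 hb₁i
  obtain ⟨β₂, hβ₂, hβb₂⟩ := exists_matrix_ev_eq f₂ hU₂ hη₂ hA₂ b₂ hb₂ hb₂0 hb₂i
  have hρ₁ : r.map φ₁ = ρ.map (ev f₁ V (genericPoint_mem f₁ h₁ hpV)) := by
    ext i j
    rw [← hρr]
    exact branch_germ f₁ h₁ hpV (ρ i j)
  have hρ₂ : r.map φ₂ = ρ.map (ev f₂ V (genericPoint_mem f₂ h₂ hpV)) := by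
    ext i j
    rw [← hρr]
    exact branch_germ f₂ h₂ hpV (ρ i j)
  have hd₁ := hT₁ V hVN _ ρ hρ β₁ hβ₁ D₁ (by rw [hβb₁, hD₁, hρ₁])
  have hd₂ := hT₂ V hVN _ ρ hρ β₂ hβ₂ D₂ (by rw [hβb₂, hD₂, hρ₂])
  -- The complement of the second component is the affine line in the first, and conversely; hence
  -- `some true` carries the frame `β₁`, `u₁`.
  let W : Option Bool → C.Opens
    | none => V
    | some true => rangeCompl f₂
    | some false => rangeCompl f₁
  let S : ∀ a, Fin n → Γ(E, W a)
    | none => fun j ↦ ∑ i, ρ i j • secRes E hVN (w i)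
    | some true => fun j ↦ ∑ i, β₁ i j • u₁ i
    | some false => fun j ↦ ∑ i, β₂ i j • u₂ i
  refine ⟨n, exists_iso_biproduct_of_diagonal (W := W) (s := S) ?_ ?_ ?_⟩
  · rw [eq_top_iff]
    intro y _
    rw [TopologicalSpace.Opens.mem_iSup]
    by_cases hy₁ : y ∈ Set.range f₁
    · by_cases hy₂ : y ∈ Set.range f₂
      · obtain rfl : y = p := hmeet.le ⟨hy₁, hy₂⟩
        exact ⟨none, hpV⟩
      · exact ⟨some true, hy₂⟩
    · exact ⟨some false, hy₁⟩
  · rintro (_ | _ | _)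
    · exact (hw.res hVN).matrix_smul hρ
    · exact hu₂.matrix_smul hβ₂
    · exact hu₁.matrix_smul hβ₁
  · have hrefl : ∀ (U : C.Opens) (m : Γ(E, U)), ∃ t : Γ(C, U ⊓ U),
        secRes E inf_le_left m = t • secRes E inf_le_right m := fun U m ↦ ⟨1, (one_smul _ _).symm⟩
    have hsymm : ∀ {U U' : C.Opens} {m : Γ(E, U)} {m' : Γ(E, U')} {t : Γ(C, U ⊓ U')},
        secRes E inf_le_right m' = t • secRes E inf_le_left m →
        ∃ t : Γ(C, U' ⊓ U), secRes E inf_le_left m' = t • secRes E inf_le_right m := by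
      intro U U' m m' t h
      refine ⟨funRes C (le_inf inf_le_right inf_le_left) t, ?_⟩
      have := congrArg (secRes E (le_inf inf_le_right inf_le_left : U' ⊓ U ≤ U ⊓ U')) h
      rwa [secRes_smul, secRes_secRes, secRes_secRes] at this
    have hinv : ∀ {U U' : C.Opens} {m : Γ(E, U)} {m' : Γ(E, U')} {t : Γ(C, U ⊓ U')},
        IsUnit t → secRes E inf_le_right m' = t • secRes E inf_le_left m →
        ∃ t : Γ(C, U ⊓ U'), secRes E inf_le_left m = t • secRes E inf_le_right m' := by
      intro U U' m m' t ht h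
      obtain ⟨t, rfl⟩ := ht
      exact ⟨(t⁻¹ : Γ(C, U ⊓ U')ˣ), by rw [h, smul_smul, Units.inv_mul, one_smul]⟩
    -- Over the empty open subset all sections agree, by the sheaf property for the empty cover.
    have hdisj : ∀ {U U' : C.Opens} (m : Γ(E, U)) (m' : Γ(E, U')), U ⊓ U' = ⊥ →
        ∃ t : Γ(C, U ⊓ U'), secRes E inf_le_left m = t • secRes E inf_le_right m' := by
      intro U U' m m' h
      exact ⟨0, sec_ext (fun a : Empty ↦ a.elim) (by rw [h]; exact bot_le) (fun a ↦ a.elim)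
        (fun a ↦ a.elim)⟩
    have hbot : rangeCompl f₁ ⊓ rangeCompl f₂ = ⊥ := by
      rw [eq_bot_iff]
      intro y hy
      exact (hcov.ge (Set.mem_univ y)).elim hy.1 hy.2
    rintro (_ | _ | _) (_ | _ | _) j
    · exact hrefl _ _
    · obtain ⟨t, ht, h⟩ := hd₂ j
      exact hinv ht h
    · obtain ⟨t, ht, h⟩ := hd₁ j
      exact hinv ht h
    · obtain ⟨t, ht, h⟩ := hd₂ j
      exact hsymm h
    · exact hrefl _ _
    · exact hdisj _ _ hbot
    · obtain ⟨t, ht, h⟩ := hd₁ j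
      exact hsymm h
    · exact hdisj _ _ (inf_comm (rangeCompl f₂) _ ▸ hbot)
    · exact hrefl _ _

end Angle

end RationalAngle

end

/-- On a rational angle every locally free coherent sheaf is a direct sum of line bundles. -/
theorem proposition5p1 {C : Scheme.{0}} (s : C ⟶ Spec (.of ℂ))
    (hC : RationalAngle.IsRationalAngle s) (E : C.Modules)
    (hfree : SheafOfModules.IsLocallyFree E) (hcoh : RationalAngle.IsCoherent E) :
    ∃ (n : ℕ) (L : Fin n → C.Modules),
      (∀ i, RationalAngle.IsLineBundle (L i)) ∧ Nonempty (E ≅ ⨁ L) := by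
  obtain ⟨C₁, C₂, i₁, i₂, p, hi₁, hi₂, ⟨e₁, he₁⟩, ⟨e₂, he₂⟩, hcov, hmeet⟩ := hC.exists_components
  have hproper := hC.isNodalCurve.isProper
  have hred := hC.isNodalCurve.isReduced
  have hq := hcoh.1
  have hr : ∀ {D : Scheme.{0}} (i : D ⟶ C) (e : D ≅ RationalAngle.P1),
      Set.range (e.inv ≫ i) = Set.range i := by
    intro D i e
    ext y
    constructor
    · rintro ⟨z, rfl⟩
      exact ⟨e.inv z, rfl⟩
    · rintro ⟨z, rfl⟩
      refine ⟨e.hom z, ?_⟩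
      rw [← Scheme.Hom.comp_apply, e.hom_inv_id_assoc]
  rw [← hr i₁ e₁, ← hr i₂ e₂] at hcov hmeet
  -- The components are parametrized by the projective line itself, which changes neither their
  -- images nor the structure morphisms.
  exact RationalAngle.exists_iso_biproduct (f₁ := e₁.inv ≫ i₁) (f₂ := e₂.inv ≫ i₂)
    (by rw [Category.assoc, ← he₁, e₁.inv_hom_id_assoc])
    (by rw [Category.assoc, ← he₂, e₂.inv_hom_id_assoc]) hcov hmeet
    (hC.isNodalCurve.nonsingular_or_node p (RationalAngle.isClosed_singleton_of_inter hmeet)) E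
    (RationalAngle.exists_isFrame_of_isLocallyFree E hfree hcoh.2)
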